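/- **Notation.** A polynomial in $(u,v)\in\mathbb R^n\times\mathbb R^n$ is a real polynomial in the $2n$ coordinates. For a finitely supported function $\mu:\mathbb R^n\times\mathbb R^n\to\mathbb R$ and such a polynomial $f$ write $\tilde{\mathbb E}_\mu f=\sum_{x\in\mathrm{supp}\,\mu}\mu(x)f(x)$ (entrywise for vectors and matrices of polynomials). The function $\mu$ is a *degree-$d$ pseudo-distribution over $\mathbb S^{n-1}\times\mathbb S^{n-1}$* if $\tilde{\mathbb E}_\mu 1=1$, $\tilde{\mathbb E}_\mu f^2\ge 0$ for all $f$ of degree at most $d/2$, and $\tilde{\mathbb E}_\mu(\|u\|^2-1)f=\tilde{\mathbb E}_\mu(\|v\|^2-1)f=0$ for all $f$ of degree at most $d-2$. If $p$ is a sum of squares of polynomials of degree at most $k/2$ with $\tilde{\mathbb E}_\mu p>0$, then $\mu'=p\cdot\mu/\tilde{\mathbb E}_\mu p$ is called the *degree-$k$ reweighting of $\mu$ by $p$*. A *moment oracle of degree $D$* for $\mu$ answers a question consisting of a monomial $x^\alpha$ of degree at most $D$ and a precision $t\in\mathbb N$ by an integer $z$ with $|z/2^t-\tilde{\mathbb E}_\mu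 x^\alpha|\le 2^{-t}$. Algorithms are deterministic programs on integer arrays whose running time is the logarithmic cost (every operation costs the number of bits of the integers involved, and an oracle question costs the number of bits of question and answer plus the precision $t$). **Theorem.** There are absolute constants $C\ge 1$ and $B$ and an algorithm such that the following holds for all $n\ge 3$ and $0<\epsilon\le 1$, with $$k=\frac{\sqrt n\,(\log n)^C}{\epsilon^2}\qquad(\log\text{ the natural logarithm}).$$ Let $\mu$ be a pseudo-distribution over $\mathbb S^{n-1}\times\mathbb S^{n-1}$ of degree $d\ge k+2$. Given $n$, $\lceil 1/\epsilon\rceil$ and any moment oracle of degree $k+2$ for $\mu$, the algorithm finds, in time at most $2^{Bk}$, a polynomial $p$ in $(u,v)$, written as a list of monomials with rational coefficients, such that 1. every coefficient of $p$ in the monomial basis is a rational number whose numerator and denominator (in lowest terms) have magnitude at most $2^{Bk}$; 2. $p$ is a sum of squares of polynomials of degree at most $\lfloor k\rfloor/2$, $\tilde{\mathbb E}_\mu p>0$, and the degree-$\lfloor k\rfloor$ reweighting $\mu'=p\cdot\mu/\tilde{\mathbb E}_\mu p$ is a pseudo-distribution over $\mathbb S^{n-1}\times\mathbb S^{n-1}$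 of degree $d-\lfloor k\rfloor$; 3. for $u_0=\tilde{\mathbb E}_{\mu'}u$ and $v_0=\tilde{\mathbb E}_{\mu'}v$, $$\bigl\|u_0v_0^\top-\tilde{\mathbb E}_{\mu'}uv^\top\bigr\|_F\le\epsilon\,\bigl\|u_0v_0^\top\bigr\|_F .$$ In particular every such $\mu$ has a degree-$\lfloor k\rfloor$ reweighting $\mu'$ with these properties. -/

import Mathlib

/-! ## Pseudo-distributions -/

section PseudoDistributions

open MvPolynomial

/-- The pseudo-expectation `∑_{x ∈ supp μ} μ(x) f(x)` of a polynomial `f` with respect to a finitely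
supported function `μ : ℝ^σ → ℝ`. -/
noncomputable def pseudoExp {σ : Type*} (μ : (σ → ℝ) →₀ ℝ) (f : MvPolynomial σ ℝ) : ℝ :=
  μ.sum fun x w => w * eval x f

/-- `μ` is a degree-`d` pseudo-distribution over `ℝ^σ`. -/
def IsPseudoDistribution {σ : Type*} (d : ℕ) (μ : (σ → ℝ) →₀ ℝ) : Prop :=
  pseudoExp μ 1 = 1 ∧
    ∀ f : MvPolynomial σ ℝ, 2 * f.totalDegree ≤ d → 0 ≤ pseudoExp μ (f ^ 2)

/-- The degree-`d` pseudo-distribution `μ` satisfies the constraint `q = 0`. -/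
def SatisfiesEqZero {σ : Type*} (d : ℕ) (μ : (σ → ℝ) →₀ ℝ) (q : MvPolynomial σ ℝ) : Prop :=
  ∀ f : MvPolynomial σ ℝ, q.totalDegree + f.totalDegree ≤ d → pseudoExp μ (q * f) = 0

/-- The index set of the `2 n` coordinates of a pair `(u, v)`, `u, v ∈ ℝ^n`: the coordinate `u i` is
`Sum.inl i`, the coordinate `v i` is `Sum.inr i`. -/
abbrev PairVar (n : ℕ) : Type := Fin n ⊕ Fin n

/-- `μ` is a degree-`d` pseudo-distribution over `S^{n-1} × S^{n-1}`: it satisfies the constraints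
`‖u‖² = 1` and `‖v‖² = 1`. -/
def IsPseudoDistributionOnSpheres (n d : ℕ) (μ : (PairVar n → ℝ) →₀ ℝ) : Prop :=
  IsPseudoDistribution d μ ∧
    SatisfiesEqZero d μ (∑ i : Fin n, X (Sum.inl i) ^ 2 - 1) ∧
    SatisfiesEqZero d μ (∑ i : Fin n, X (Sum.inr i) ^ 2 - 1)

/-- `p` is a sum of squares of polynomials of degree at most `k / 2`. -/
def IsSOS {σ : Type*} (k : ℕ) (p : MvPolynomial σ ℝ) : Prop :=
  ∃ (m : ℕ) (g : Fin m → MvPolynomial σ ℝ),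
    (∀ i, 2 * (g i).totalDegree ≤ k) ∧ p = ∑ i, g i ^ 2

/-- `μ'` is the degree-`k` reweighting of `μ` by the sum-of-squares polynomial `p`, that is,
`μ' = p · μ / Ẽ_μ p`. -/
def IsReweighting {σ : Type*} (k : ℕ) (p : MvPolynomial σ ℝ) (μ μ' : (σ → ℝ) →₀ ℝ) : Prop :=
  IsSOS k p ∧ 0 < pseudoExp μ p ∧ ∀ x, μ' x = eval x p * μ x / pseudoExp μ p

/-- The pseudo-mean of `u`. -/
noncomputable def meanU {n : ℕ} (μ : (PairVar n → ℝ) →₀ ℝ) (i : Fin n) : ℝ :=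
  pseudoExp μ (X (Sum.inl i))

/-- The pseudo-mean of `v`. -/
noncomputable def meanV {n : ℕ} (μ : (PairVar n → ℝ) →₀ ℝ) (i : Fin n) : ℝ :=
  pseudoExp μ (X (Sum.inr i))

/-- The matrix `Ẽ_μ u vᵀ`. -/
noncomputable def momentUV {n : ℕ} (μ : (PairVar n → ℝ) →₀ ℝ) : Matrix (Fin n) (Fin n) ℝ :=
  Matrix.of fun i j => pseudoExp μ (X (Sum.inl i) * X (Sum.inr j))

/-- The Frobenius norm. -/
noncomputable def frobNorm {n : ℕ} (A : Matrix (Fin n) (Fin n) ℝ) : ℝ :=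
  √(∑ i, ∑ j, A i j ^ 2)

/-- The number `k = √n · (log n)^C / ε²`. -/
noncomputable def degreeBound (C n : ℕ) (ε : ℝ) : ℝ :=
  √(n : ℝ) * Real.log n ^ C / ε ^ 2

end PseudoDistributions

/-! ## While-programs over integer arrays, with an oracle and logarithmic cost -/

namespace LogCost

/-- The memory: countably many integer arrays. A program mentions only finitely many of them. -/
abbrev Store : Type := ℕ → ℕ → ℤ

/-- The result of writing `z` into cell `i` of array `a`. -/
def Store.write (s : Store) (a i : ℕ) (z : ℤ) : Store :=
  Function.update s a (Function.update (s a) i z)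

/-- The number of bits that an integer occupies (with its sign). -/
def bits (z : ℤ) : ℕ := Nat.size z.natAbs + 1

/-- Arithmetic expressions. `load a i` is the content of cell `i` of array `a`. -/
inductive Expr : Type
  | const (z : ℤ)
  | load (a : ℕ) (i : Expr)
  | add (e₁ e₂ : Expr)
  | sub (e₁ e₂ : Expr)
  | mul (e₁ e₂ : Expr)
  | div (e₁ e₂ : Expr)
  | lt (e₁ e₂ : Expr)

/-- The value of an expression. Division rounds as on `ℤ`, a comparison gives `1` or `0`. -/
def Expr.val (s : Store) : Expr → ℤ
  | const z => z
  | load a i => s a (i.val s).toNat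
  | add e₁ e₂ => e₁.val s + e₂.val s
  | sub e₁ e₂ => e₁.val s - e₂.val s
  | mul e₁ e₂ => e₁.val s * e₂.val s
  | div e₁ e₂ => e₁.val s / e₂.val s
  | lt e₁ e₂ => if e₁.val s < e₂.val s then 1 else 0

/-- The logarithmic cost of an expression: each operation costs the number of bits of its operands,
and a memory access the number of bits of the address and of the content. -/
def Expr.cost (s : Store) : Expr → ℕ
  | const z => bits z
  | load a i => i.cost s + bits (i.val s) + bits (s a (i.val s).toNat)
  | add e₁ e₂ => e₁.cost s + e₂.cost s + bits (e₁.val s) + bits (e₂.val s)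
  | sub e₁ e₂ => e₁.cost s + e₂.cost s + bits (e₁.val s) + bits (e₂.val s)
  | mul e₁ e₂ => e₁.cost s + e₂.cost s + bits (e₁.val s) + bits (e₂.val s)
  | div e₁ e₂ => e₁.cost s + e₂.cost s + bits (e₁.val s) + bits (e₂.val s)
  | lt e₁ e₂ => e₁.cost s + e₂.cost s + bits (e₁.val s) + bits (e₂.val s)

/-- Programs. -/
inductive Prog : Type
  /-- write the value of `e` into cell `i` of array `a` -/
  | store (a : ℕ) (i e : Expr)
  /-- ask the oracle about the list of the first `len` cells of array `src`, with precision `prec`,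
  and write the answer into cell `0` of array `dst` -/
  | query (src : ℕ) (len prec : Expr) (dst : ℕ)
  | seq (c₁ c₂ : Prog)
  | ite (e : Expr) (c₁ c₂ : Prog)
  | loop (e : Expr) (c : Prog)

/-- An oracle answers a list of integers and a precision by an integer. -/
abbrev Oracle : Type := List ℤ → ℕ → ℤ

/-- The list of the first `l` cells of array `a`. -/
def Store.prefix (s : Store) (a l : ℕ) : List ℤ := List.ofFn fun j : Fin l => s a j

/-- `Exec O c s s' t`: with oracle `O` and started on the memory `s`, the program `c` halts with the
memory `s'` after time `t`. A query costs the number of bits of the question and of the answer,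
plus the precision. -/
inductive Exec (O : Oracle) : Prog → Store → Store → ℕ → Prop
  | store (a : ℕ) (i e : Expr) (s : Store) :
      Exec O (.store a i e) s (s.write a (i.val s).toNat (e.val s))
        (i.cost s + e.cost s + bits (i.val s) + bits (e.val s))
  | query (src : ℕ) (len prec : Expr) (dst : ℕ) (s : Store) (q : List ℤ) (z : ℤ)
      (hq : q = s.prefix src (len.val s).toNat) (hz : z = O q (prec.val s).toNat) :
      Exec O (.query src len prec dst) s (s.write dst 0 z)
        (len.cost s + prec.cost s + (q.map bits).sum + (prec.val s).toNat + bits z)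
  | seq (c₁ c₂ : Prog) (s s' s'' : Store) (t₁ t₂ : ℕ)
      (h₁ : Exec O c₁ s s' t₁) (h₂ : Exec O c₂ s' s'' t₂) :
      Exec O (.seq c₁ c₂) s s'' (t₁ + t₂)
  | ite_true (e : Expr) (c₁ c₂ : Prog) (s s' : Store) (t : ℕ)
      (he : e.val s ≠ 0) (h : Exec O c₁ s s' t) :
      Exec O (.ite e c₁ c₂) s s' (e.cost s + t)
  | ite_false (e : Expr) (c₁ c₂ : Prog) (s s' : Store) (t : ℕ)
      (he : e.val s = 0) (h : Exec O c₂ s s' t) :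
      Exec O (.ite e c₁ c₂) s s' (e.cost s + t)
  | loop_done (e : Expr) (c : Prog) (s : Store) (he : e.val s = 0) :
      Exec O (.loop e c) s s (e.cost s)
  | loop_step (e : Expr) (c : Prog) (s s' s'' : Store) (t₁ t₂ : ℕ)
      (he : e.val s ≠ 0) (h₁ : Exec O c s s' t₁) (h₂ : Exec O (.loop e c) s' s'' t₂) :
      Exec O (.loop e c) s s'' (e.cost s + t₁ + t₂)

/-- The initial memory for the input `n`, `N`: these two numbers are in cell `0` of the arrays `0`
and `1`, and all other cells are `0`. -/
def input (n N : ℕ) : Store :=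
  Store.write (Store.write (fun _ _ => 0) 0 0 n) 1 0 N

/-- The polynomial in `(u, v) ∈ ℝ^n × ℝ^n` that the final memory `s` lists monomial by monomial:
cell `0` of array `2` holds the number of terms, the cells `2nj, …, 2nj + 2n - 1` of array `3` hold
the exponents of `u` and then those of `v` in the `j`-th term, and the cells `j` of the arrays `4`
and `5` hold the numerator and the denominator of its coefficient. -/
noncomputable def output (n : ℕ) (s : Store) : MvPolynomial (PairVar n) ℚ :=
  ∑ j ∈ Finset.range (s 2 0).toNat,
    MvPolynomial.monomial
      (Finsupp.equivFunOnFinite.symm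
        (Sum.elim (fun i : Fin n => (s 3 (2 * n * j + i)).toNat)
          (fun i : Fin n => (s 3 (2 * n * j + n + i)).toNat)))
      ((s 4 j : ℚ) / (s 5 j : ℚ))

end LogCost

/-- The exponents of a monomial in `(u, v)` as a list, those of `u` first. -/
def exponentList {n : ℕ} (α : PairVar n →₀ ℕ) : List ℤ :=
  List.ofFn (fun i : Fin n => (α (Sum.inl i) : ℤ)) ++ List.ofFn (fun i : Fin n => (α (Sum.inr i) : ℤ))

/-- The oracle `O` gives access to the moments of `μ` of degree at most `D`: asked about a monomial
of degree at most `D` with precision `t`, it answers an integer `z` such that `z / 2^t` is within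
`1 / 2^t` of the pseudo-expectation of this monomial. Nothing is said about other questions. -/
def IsMomentOracle {n : ℕ} (D : ℝ) (μ : (PairVar n → ℝ) →₀ ℝ) (O : LogCost.Oracle) : Prop :=
  ∀ α : PairVar n →₀ ℕ, (α.degree : ℝ) ≤ D → ∀ t : ℕ,
    |(O (exponentList α) t : ℝ) / 2 ^ t - pseudoExp μ (MvPolynomial.monomial α 1)| ≤ 1 / 2 ^ t

/-- Every `μ` has such an oracle. -/
theorem exists_isMomentOracle {n : ℕ} (D : ℝ) (μ : (PairVar n → ℝ) →₀ ℝ) :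
    ∃ O, IsMomentOracle D μ O := by
  classical
  have inj : Function.Injective (exponentList (n := n)) := by
    intro α β h
    unfold exponentList at h
    have := List.append_inj h (by simp)
    ext (i | i)
    · have := congrFun (List.ofFn_injective this.1) i; simpa using this
    · have := congrFun (List.ofFn_injective this.2) i; simpa using this
  refine ⟨fun l t => ⌊pseudoExp μ (MvPolynomial.monomial (Function.invFun exponentList l) 1) * 2 ^ t⌋, ?_⟩
  intro α _ t
  simp only [Function.leftInverse_invFun inj α]
  set y := pseudoExp μ (MvPolynomial.monomial α 1)
  have h1 := Int.floor_le (y * 2 ^ t)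
  have h2 := Int.lt_floor_add_one (y * 2 ^ t)
  have hp : (0:ℝ) < 2 ^ t := by positivity
  rw [abs_le]
  constructor
  · have : y - 1/2^t ≤ (⌊y * 2 ^ t⌋:ℝ)/2^t := by
      rw [le_div_iff₀ hp, sub_mul, one_div, inv_mul_cancel₀ hp.ne']; linarith
    linarith
  · have : (⌊y * 2 ^ t⌋:ℝ)/2^t ≤ y := by rw [div_le_iff₀ hp]; exact h1
    have : 0 < 1/(2:ℝ)^t := by positivity
    linarith

/-! Everything is phrased for a linear functional `F`, at first the pseudo-expectation of `μ`. All
reweightings are by squares of products of integral linear forms; each linear factor costs two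
degrees, so the task is to get by with about `√n / ε²` factors, up to powers of `log n`.

One step. Let `z` be the list of all `2n` coordinates and let `l_i` be an integer of order
`F(z_i²)^(-1/2)`, capped at about `√n`. Average `F((3 + c z_i)² f)` over `c = ± l_i` and all `i`
with weights `1 / l_i²`: the signs remove the odd terms and `∑ z_i² = 2` on the spheres, so for `f`
of degree at most 2 the result is a multiple of `F f`. Expectations are therefore preserved on
average, while the convex quantity `‖F u‖²` gains a constant fraction of the squared covariances of
`z` with `u`. Some single choice gains at least as much (`IsSpherePE.exists_step`).

Growth. Suppose that `‖F v‖² ≥ θ / 4` and that the cross-covariance is not small relative to `‖F u‖²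
‖F v‖² / N²`, with `N = ⌈1/ε⌉`. Then a step multiplies `‖F u‖²` by `1 + κ` with `κ` of order `θ /
N²`. Since `‖F u‖² ≤ 1`, this can go on for only `O(log n / κ)` steps (`IsSpherePE.gain`,
`exists_steps`). To keep `‖F v‖²` large, the potential subtracts a penalty for the deviation of a
form `⟨w, v⟩` from a constant `ρ` with `ρ² ≥ θ ‖w‖²`.

Starting point, with `θ` of order `1 / √n`. For `s = ⌈√n⌉`, averaging over signs and multi-indices
gives an integral `w` with at most `s` nonzero entries, `‖w‖² ≤ 4 s` and `F ⟨w, v⟩^(2s) ≥ 18^(-s)`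
(`IsSpherePE.exists_sparse`). The ratios of consecutive even moments of `⟨w, v⟩` are nondecreasing
and bounded by `‖w‖²`, so they are nearly constant somewhere (`exists_window`). Reweighting there by
a power of `⟨w, v⟩` concentrates `⟨w, v⟩²`, and one more factor `N₀ ⟨w, v⟩ + j` selects a sign
(`IsSpherePE.exists_fix`).

Algorithm. The polynomials found in this way are described by polynomially bounded integers, `O(L)`
in number, where `L` bounds the number of factors; the sparsity of `w` is what makes this true for
`w`. So exhaustive search over `2^O(k)` codes is affordable. Each code is tested on moments computed
from oracle answers of precision `2^(-3E)`. The test accepts every candidate of the above kind,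
which has a margin (`LogCost.Params.Sound.accepts`), and whatever it accepts satisfies the
conclusion (`LogCost.Params.Sound.of_accepts`). The program is written in a small expression
language with a verified compiler; its running time is `2^O(E)`, since the rank of a fixed
expression is an absolute constant. -/

section Functionals

/-! ### Pseudo-expectations as linear functionals and their reweightings. -/

open MvPolynomial

/-- `F` behaves on polynomials of degree at most `D` like the expectation of a probability
distribution over pairs of unit vectors. -/
structure IsSpherePE {n : ℕ} (D : ℕ) (F : MvPolynomial (PairVar n) ℝ →ₗ[ℝ] ℝ) : Prop where
  one : F 1 = 1
  nonneg_sq : ∀ f, 2 * f.totalDegree ≤ D → 0 ≤ F (f ^ 2)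
  sphereU : ∀ f, f.totalDegree + 2 ≤ D → F ((∑ i, X (Sum.inl i) ^ 2) * f) = F f
  sphereV : ∀ f, f.totalDegree + 2 ≤ D → F ((∑ i, X (Sum.inr i) ^ 2) * f) = F f

/-- The normalized functional `f ↦ F (g² f) / F (g²)`. -/
noncomputable def reweight {σ : Type*} (F : MvPolynomial σ ℝ →ₗ[ℝ] ℝ) (g : MvPolynomial σ ℝ) :
    MvPolynomial σ ℝ →ₗ[ℝ] ℝ :=
  (F (g ^ 2))⁻¹ • F.comp (LinearMap.mulLeft ℝ (g ^ 2))

theorem reweight_apply {σ : Type*} (F : MvPolynomial σ ℝ →ₗ[ℝ] ℝ) (g f : MvPolynomial σ ℝ) :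
    reweight F g f = F (g ^ 2 * f) / F (g ^ 2) := by
  simp [reweight, div_eq_inv_mul]

/-- A chain of reweightings by squares is thus a single one, by the square of the product of the
factors; this is what turns a sequence of steps into one polynomial. -/
theorem reweight_reweight {σ : Type*} (F : MvPolynomial σ ℝ →ₗ[ℝ] ℝ) (g h : MvPolynomial σ ℝ)
    (hg : F (g ^ 2) ≠ 0) : reweight (reweight F g) h = reweight F (g * h) := by
  ext1 f
  ext
  simp only [reweight_apply, LinearMap.comp_apply]
  rw [div_div_div_cancel_right₀ hg, mul_pow, mul_assoc]

theorem reweight_one {σ : Type*} (F : MvPolynomial σ ℝ →ₗ[ℝ] ℝ) (h : F 1 = 1) :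
    reweight F 1 = F := by
  ext1 f
  ext
  simp [reweight_apply, h]

variable {n : ℕ} {D : ℕ} {F : MvPolynomial (PairVar n) ℝ →ₗ[ℝ] ℝ}

theorem totalDegree_sq_le {σ : Type*} (g : MvPolynomial σ ℝ) :
    (g ^ 2).totalDegree ≤ 2 * g.totalDegree := totalDegree_pow g 2

theorem IsSpherePE.of_reweight (hF : IsSpherePE D F) {D' : ℕ} {g : MvPolynomial (PairVar n) ℝ}
    (hg : 2 * g.totalDegree + D' ≤ D) (hpos : 0 < F (g ^ 2)) : IsSpherePE D' (reweight F g) := by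
  have hd := totalDegree_sq_le g
  refine ⟨?_, fun f hf => ?_, fun f hf => ?_, fun f hf => ?_⟩
  · rw [reweight_apply, mul_one, div_self hpos.ne']
  · rw [reweight_apply, ← mul_pow]
    refine div_nonneg (hF.nonneg_sq _ ?_) hpos.le
    have := totalDegree_mul g f
    omega
  · rw [reweight_apply, reweight_apply, mul_left_comm, hF.sphereU]
    have := totalDegree_mul (g ^ 2) f
    omega
  · rw [reweight_apply, reweight_apply, mul_left_comm, hF.sphereV]
    have := totalDegree_mul (g ^ 2) f
    omega

theorem totalDegree_add_smul_le {σ : Type*} (f g : MvPolynomial σ ℝ) (c : ℝ) {d : ℕ}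
    (hf : f.totalDegree ≤ d) (hg : g.totalDegree ≤ d) : (f + c • g).totalDegree ≤ d :=
  (totalDegree_add _ _).trans (max_le hf ((totalDegree_smul_le _ _).trans hg))

/-- The quadratic `x ↦ F ((f + x g)²)` is nonnegative, so its discriminant is not positive. This
covers `F (g²) = 0` as well. -/
theorem IsSpherePE.cauchy_schwarz (hF : IsSpherePE D F) {f g : MvPolynomial (PairVar n) ℝ}
    (hf : 2 * f.totalDegree ≤ D) (hg : 2 * g.totalDegree ≤ D) :
    F (f * g) ^ 2 ≤ F (f ^ 2) * F (g ^ 2) := by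
  have key : ∀ x : ℝ, 0 ≤ F (g ^ 2) * (x * x) + 2 * F (f * g) * x + F (f ^ 2) := by
    intro x
    have h := hF.nonneg_sq (f + x • g) (by
      have := totalDegree_add_smul_le f g x (d := D / 2) (by omega) (by omega)
      omega)
    have e : (f + x • g) ^ 2 = f ^ 2 + (2 * x) • (f * g) + (x * x) • g ^ 2 := by
      simp only [smul_eq_C_mul, map_mul, map_ofNat]; ring
    rw [e, map_add, map_add, map_smul, map_smul, smul_eq_mul, smul_eq_mul] at h
    linarith
  have := discrim_le_zero key
  rw [discrim] at this
  nlinarith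

theorem IsSpherePE.mean_sq_le (hF : IsSpherePE D F) {f : MvPolynomial (PairVar n) ℝ}
    (hf : 2 * f.totalDegree ≤ D) : F f ^ 2 ≤ F (f ^ 2) := by
  have := hF.cauchy_schwarz (g := 1) hf (by simp)
  simpa [hF.one] using this

theorem IsSpherePE.sum_sq (hF : IsSpherePE D F) (hD : 2 ≤ D) :
    ∑ i, F (X (Sum.inl i) ^ 2) = 1 ∧ ∑ i, F (X (Sum.inr i) ^ 2) = 1 := by
  have h1 := hF.sphereU 1 (by simpa using hD)
  have h2 := hF.sphereV 1 (by simpa using hD)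
  rw [mul_one, hF.one, map_sum] at h1 h2
  exact ⟨h1, h2⟩

theorem IsSpherePE.sum_mean_sq_le (hF : IsSpherePE D F) (hD : 2 ≤ D) :
    ∑ i, F (X (Sum.inl i)) ^ 2 ≤ 1 := by
  rw [← (hF.sum_sq hD).1]
  exact Finset.sum_le_sum fun i _ => hF.mean_sq_le (by simpa using hD)

end Functionals

/-! ### One reweighting step and its gain. -/

section Step

open MvPolynomial

variable {n : ℕ} {D : ℕ} {F : MvPolynomial (PairVar n) ℝ →ₗ[ℝ] ℝ}

/-- The pseudo-covariance of the coordinate `i` and the coordinate `j` of `u`. -/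
noncomputable def covU (F : MvPolynomial (PairVar n) ℝ →ₗ[ℝ] ℝ) (i : PairVar n) (j : Fin n) : ℝ :=
  F (X i * X (Sum.inl j)) - F (X i) * F (X (Sum.inl j))

/-- Used with `m = F (z_i²)` and `δ = 1 / (2n)`. The integer `l` is `√(2 / (m + δ))` rounded down.
The first bound keeps the mass of `3 ± l z_i` bounded, the second makes the sum of `1 / l²` over all
coordinates bounded; `δ` prevents `l` from growing without limit when `m` vanishes. -/
theorem exists_scale {m δ : ℝ} (hm0 : 0 ≤ m) (hm1 : m ≤ 1) (hδ0 : 0 < δ) (hδ1 : δ ≤ 1 / 2) :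
    ∃ l : ℕ, 1 ≤ l ∧ (l : ℝ) ^ 2 * (m + δ) ≤ 2 ∧ 1 ≤ 2 * (m + δ) * (l : ℝ) ^ 2 := by
  have hp : 0 < m + δ := by linarith
  set y := √(2 / (m + δ)) with hy
  have hy2 : y ^ 2 * (m + δ) = 2 := by
    rw [hy, Real.sq_sqrt (by positivity)]; field_simp
  have hy0 : 0 ≤ y := Real.sqrt_nonneg _
  have hy1 : 1 ≤ y := by
    by_contra h
    push Not at h
    nlinarith
  have h1 : 1 ≤ ⌊y⌋₊ := Nat.le_floor (by simpa using hy1)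
  have h1' : (1 : ℝ) ≤ ⌊y⌋₊ := by exact_mod_cast h1
  have h2 := Nat.floor_le hy0
  have h3 := Nat.lt_floor_add_one y
  refine ⟨⌊y⌋₊, h1, ?_, ?_⟩
  · calc (⌊y⌋₊ : ℝ) ^ 2 * (m + δ) ≤ y ^ 2 * (m + δ) := by gcongr
      _ = 2 := hy2
  · have h4 : y ≤ 2 * ⌊y⌋₊ := by linarith
    have h5 : y ^ 2 ≤ (2 * ⌊y⌋₊) ^ 2 := by gcongr
    nlinarith

theorem linear_sq_expand (i : PairVar n) (c : ℝ) (f : MvPolynomial (PairVar n) ℝ) :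
    F ((C 3 + C c * X i) ^ 2 * f) =
      9 * F f + 6 * c * F (X i * f) + c ^ 2 * F (X i ^ 2 * f) := by
  have e : (C 3 + C c * X i) ^ 2 * f =
      (9 : ℝ) • f + (6 * c) • (X i * f) + (c ^ 2) • (X i ^ 2 * f) := by
    simp only [smul_eq_C_mul, map_mul, map_pow, map_ofNat]; ring
  rw [e]; simp [map_add, map_smul]

/-- For `q = F (g²)`, `a = F (g² u_j)`, `U = F u_j` the right side is the gain in `(F u_j)²`,
weighted by the mass. It splits into a term linear in `a - q U`, which cancels in the average over
all steps, and a square, which survives. -/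
theorem sq_div_gain {q a U : ℝ} (hq : 1 ≤ q) (hq' : q ≤ 20) :
    (a - q * U) ^ 2 / 20 + 2 * U * (a - q * U) ≤ q * ((a / q) ^ 2 - U ^ 2) := by
  have h : q * ((a / q) ^ 2 - U ^ 2) = (a - q * U) ^ 2 / q + 2 * U * (a - q * U) := by
    field_simp; ring
  rw [h]
  gcongr

/-- Here `x = c F z` and `y = c² F (z²)`. As `|x| ≤ 3/2`, the mass is at least `(3 + x)² ≥ 9/4` and
at most `9 + 9 + 2`; this is why the factor has the constant term 3. -/
theorem sq_lin_bounds {x y : ℝ} (h : x ^ 2 ≤ y) (hy : y ≤ 2) :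
    1 ≤ 9 + 6 * x + y ∧ 9 + 6 * x + y ≤ 20 := by
  have h1 : |x| ≤ 3 / 2 := abs_le_of_sq_le_sq (by linarith) (by norm_num)
  have := abs_le.mp h1
  constructor <;> nlinarith [sq_nonneg (3 + x)]

/-- Some reweighting by the square of `3 + c zᵢ`, with `c` a small integer, increases the potential
`‖F u‖² - F h` by a constant fraction of the squared Frobenius norm of the covariances with `u`. -/
theorem IsSpherePE.exists_step (hn : 0 < n) (hF : IsSpherePE D F) (hD : 4 ≤ D)
    {h : MvPolynomial (PairVar n) ℝ} (hh : h.totalDegree ≤ 2) :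
    ∃ (i : PairVar n) (c : ℤ), |c| ≤ 2 * n ∧ 1 ≤ F ((C 3 + C (c : ℝ) * X i) ^ 2) ∧
      ∑ j, F (X (Sum.inl j)) ^ 2 - F h + (1 / 40) * ∑ i, ∑ j, covU F i j ^ 2 ≤
        ∑ j, reweight F (C 3 + C (c : ℝ) * X i) (X (Sum.inl j)) ^ 2
          - reweight F (C 3 + C (c : ℝ) * X i) h := by
  have hn' : (1 : ℝ) ≤ n := by exact_mod_cast hn
  set m : PairVar n → ℝ := fun i => F (X i ^ 2) with hm
  have hm0 : ∀ i, 0 ≤ m i := fun i => hF.nonneg_sq _ (by simp; omega)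
  have hmean : ∀ i, F (X i) ^ 2 ≤ m i := fun i => hF.mean_sq_le (by simp; omega)
  have hmu := (hF.sum_sq (by omega)).1
  have hmv := (hF.sum_sq (by omega)).2
  have hm1 : ∀ i, m i ≤ 1 := by
    rintro (i | i)
    · rw [← hmu]
      exact Finset.single_le_sum (f := fun i => m (Sum.inl i)) (fun i _ => hm0 _) (Finset.mem_univ i)
    · rw [← hmv]
      exact Finset.single_le_sum (f := fun i => m (Sum.inr i)) (fun i _ => hm0 _) (Finset.mem_univ i)
  have hsum : ∑ i, m i = 2 := by
    rw [Fintype.sum_sum_type]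
    linarith
  have hδ0 : (0 : ℝ) < 1 / (2 * n) := by positivity
  have hδ1 : (1 : ℝ) / (2 * n) ≤ 1 / 2 := by
    rw [div_le_div_iff₀ (by positivity) (by norm_num)]; linarith
  choose l hl1 hl2 hl3 using fun i => exists_scale (hm0 i) (hm1 i) hδ0 hδ1
  have hl1' : ∀ i, (1 : ℝ) ≤ l i := fun i => by exact_mod_cast hl1 i
  have hlm : ∀ i, (l i : ℝ) ^ 2 * m i ≤ 2 := fun i => by
    have := hl2 i
    have h0 : 0 ≤ (l i : ℝ) ^ 2 * (1 / (2 * n)) := by positivity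
    nlinarith
  have hln : ∀ i, (l i : ℤ) ≤ 2 * n := fun i => by
    have h1 := hl2 i
    have h2 : (l i : ℝ) ^ 2 * (1 / (2 * n)) ≤ 2 := by nlinarith [hm0 i, sq_nonneg (l i : ℝ)]
    have h3 : (l i : ℝ) ^ 2 ≤ 2 * (2 * n) := by
      rw [mul_one_div, div_le_iff₀ (by positivity)] at h2; exact h2
    have h4 : l i ^ 2 ≤ 2 * (2 * n) := by exact_mod_cast h3
    have h5 : l i ≤ 2 * n := by nlinarith
    exact_mod_cast h5
  have hinv : ∑ i, 1 / (l i : ℝ) ^ 2 ≤ 6 := by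
    calc ∑ i, 1 / (l i : ℝ) ^ 2 ≤ ∑ i, 2 * (m i + 1 / (2 * n)) := by
          refine Finset.sum_le_sum fun i _ => ?_
          rw [div_le_iff₀ (by have := hl1' i; positivity)]
          exact hl3 i
      _ = 6 := by
          rw [← Finset.mul_sum, Finset.sum_add_distrib, hsum]
          simp
          field_simp
          norm_num
  -- the second-order terms cancel on average
  have hcancel : ∀ f : MvPolynomial (PairVar n) ℝ, f.totalDegree ≤ 2 →
      ∑ i, (F (X i ^ 2 * f) - m i * F f) = 0 := by
    intro f hf
    have e1 := hF.sphereU f (by omega)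
    have e2 := hF.sphereV f (by omega)
    rw [Finset.sum_mul, map_sum] at e1 e2
    rw [Finset.sum_sub_distrib, ← Finset.sum_mul, hsum, Fintype.sum_sum_type, e1, e2]
    ring
  set U : Fin n → ℝ := fun j => F (X (Sum.inl j)) with hU
  set S := ∑ i, ∑ j, covU F i j ^ 2 with hS
  have hS0 : 0 ≤ S := Finset.sum_nonneg fun i _ => Finset.sum_nonneg fun j _ => sq_nonneg _
  -- If every choice `c = ± l i` failed, the failed inequalities, weighted by mass over `l i ^ 2`
  -- and summed over signs and coordinates, would contradict each other.
  by_contra hcon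
  push Not at hcon
  -- one coordinate, one sign
  have hq : ∀ i (c : ℤ), (c : ℝ) ^ 2 = (l i : ℝ) ^ 2 →
      F ((C 3 + C (c : ℝ) * X i) ^ 2) = 9 + 6 * (c * F (X i)) + (l i : ℝ) ^ 2 * m i ∧
      1 ≤ F ((C 3 + C (c : ℝ) * X i) ^ 2) ∧ F ((C 3 + C (c : ℝ) * X i) ^ 2) ≤ 20 := by
    intro i c hc
    have e := linear_sq_expand (F := F) i c 1
    simp only [mul_one, hF.one] at e
    have e' : F ((C 3 + C (c : ℝ) * X i) ^ 2) = 9 + 6 * (c * F (X i)) + (l i : ℝ) ^ 2 * m i := by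
      rw [e, hc]; ring
    refine ⟨e', ?_⟩
    rw [e']
    refine sq_lin_bounds ?_ (hlm i)
    rw [mul_pow, hc]
    exact mul_le_mul_of_nonneg_left (hmean i) (sq_nonneg _)
  have hone : ∀ i (c : ℤ), (c : ℝ) ^ 2 = (l i : ℝ) ^ 2 → |c| ≤ 2 * n →
      ∑ j, ((6 * c * covU F i j + (l i : ℝ) ^ 2 * (F (X i ^ 2 * X (Sum.inl j)) - m i * U j)) ^ 2 / 20
        + 2 * U j * (6 * c * covU F i j
          + (l i : ℝ) ^ 2 * (F (X i ^ 2 * X (Sum.inl j)) - m i * U j)))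
        - (6 * c * (F (X i * h) - F (X i) * F h) + (l i : ℝ) ^ 2 * (F (X i ^ 2 * h) - m i * F h))
      < (9 + 6 * (c * F (X i)) + (l i : ℝ) ^ 2 * m i) * ((1 / 40) * S) := by
    intro i c hc hcn
    obtain ⟨e, h1, h20⟩ := hq i c hc
    have h2 := hcon i c hcn h1
    set q := F ((C 3 + C (c : ℝ) * X i) ^ 2) with hqdef
    have hq0 : 0 < q := by linarith
    rw [← e]
    have h3 : q * (∑ j, reweight F (C 3 + C (c : ℝ) * X i) (X (Sum.inl j)) ^ 2
        - reweight F (C 3 + C (c : ℝ) * X i) h - (∑ j, U j ^ 2 - F h)) < q * ((1 / 40) * S) := by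
      refine mul_lt_mul_of_pos_left ?_ hq0
      linarith
    refine lt_of_le_of_lt ?_ h3
    have h4 : ∀ f, F ((C 3 + C (c : ℝ) * X i) ^ 2 * f) - q * F f =
        6 * c * (F (X i * f) - F (X i) * F f) + (l i : ℝ) ^ 2 * (F (X i ^ 2 * f) - m i * F f) := by
      intro f
      rw [linear_sq_expand, e, hc]; ring
    have h5 : q * (∑ j, reweight F (C 3 + C (c : ℝ) * X i) (X (Sum.inl j)) ^ 2
        - reweight F (C 3 + C (c : ℝ) * X i) h - (∑ j, U j ^ 2 - F h)) =
        ∑ j, q * ((F ((C 3 + C (c : ℝ) * X i) ^ 2 * X (Sum.inl j)) / q) ^ 2 - U j ^ 2)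
          - (F ((C 3 + C (c : ℝ) * X i) ^ 2 * h) - q * F h) := by
      simp only [reweight_apply, ← hqdef]
      rw [← Finset.mul_sum, Finset.sum_sub_distrib]
      field_simp
      ring
    rw [h5, h4 h]
    refine sub_le_sub_right (Finset.sum_le_sum fun j _ => ?_) _
    have := sq_div_gain (a := F ((C 3 + C (c : ℝ) * X i) ^ 2 * X (Sum.inl j))) (U := U j) h1 h20
    rw [h4 (X (Sum.inl j))] at this
    exact this
  -- The two signs are added and `l i ^ 2` is divided out. The terms odd in `c` cancel; the squares
  -- leave `2 * 36 / 20 = 18 / 5` times the squared covariances, and the masses add up to `18 / l² +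
  -- 2 m`.
  have htwo : ∀ i, (18 / 5) * ∑ j, covU F i j ^ 2
      + (4 * ∑ j, U j * (F (X i ^ 2 * X (Sum.inl j)) - m i * U j)
        - 2 * (F (X i ^ 2 * h) - m i * F h))
      < (18 * (1 / (l i : ℝ) ^ 2) + 2 * m i) * ((1 / 40) * S) := by
    intro i
    have a1 := hone i (l i) (by simp) (by rw [abs_of_nonneg (by positivity)]; exact hln i)
    have a2 := hone i (-(l i : ℤ)) (by simp) (by
      rw [abs_neg, abs_of_nonneg (by positivity)]; exact hln i)
    push_cast at a1 a2
    have hl0 : (0 : ℝ) < (l i : ℝ) ^ 2 := by have := hl1' i; positivity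
    have a3 := add_lt_add a1 a2
    have a4 : (l i : ℝ) ^ 2 * ((18 / 5) * ∑ j, covU F i j ^ 2
      + (4 * ∑ j, U j * (F (X i ^ 2 * X (Sum.inl j)) - m i * U j)
        - 2 * (F (X i ^ 2 * h) - m i * F h)))
      < (l i : ℝ) ^ 2 * ((18 * (1 / (l i : ℝ) ^ 2) + 2 * m i) * ((1 / 40) * S)) := by
      have e1 : (l i : ℝ) ^ 2 * ((18 * (1 / (l i : ℝ) ^ 2) + 2 * m i) * ((1 / 40) * S)) =
          (18 + 2 * ((l i : ℝ) ^ 2 * m i)) * ((1 / 40) * S) := by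
        have : (l i : ℝ) ≠ 0 := by have := hl1' i; positivity
        field_simp
      rw [e1]
      refine lt_of_le_of_lt ?_ (lt_of_lt_of_eq a3 (by ring))
      rw [sub_add_sub_comm, ← Finset.sum_add_distrib]
      have e2 : ∑ j, ((18 / 5) * ((l i : ℝ) ^ 2 * covU F i j ^ 2)
          + 4 * ((l i : ℝ) ^ 2 * (U j * (F (X i ^ 2 * X (Sum.inl j)) - m i * U j)))) =
          (l i : ℝ) ^ 2 * ((18 / 5) * ∑ j, covU F i j ^ 2
            + 4 * ∑ j, U j * (F (X i ^ 2 * X (Sum.inl j)) - m i * U j)) := by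
        rw [Finset.sum_add_distrib, mul_add]
        simp only [Finset.mul_sum]
        congr 1 <;> exact Finset.sum_congr rfl fun j _ => by ring
      have e3 := Finset.sum_le_sum (s := Finset.univ) fun (j : Fin n) _ =>
        show (18 / 5) * ((l i : ℝ) ^ 2 * covU F i j ^ 2)
          + 4 * ((l i : ℝ) ^ 2 * (U j * (F (X i ^ 2 * X (Sum.inl j)) - m i * U j))) ≤
          ((6 * (l i : ℝ) * covU F i j
            + (l i : ℝ) ^ 2 * (F (X i ^ 2 * X (Sum.inl j)) - m i * U j)) ^ 2 / 20
          + 2 * U j * (6 * (l i : ℝ) * covU F i j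
            + (l i : ℝ) ^ 2 * (F (X i ^ 2 * X (Sum.inl j)) - m i * U j))) +
          ((6 * (-(l i : ℝ)) * covU F i j
            + (l i : ℝ) ^ 2 * (F (X i ^ 2 * X (Sum.inl j)) - m i * U j)) ^ 2 / 20
          + 2 * U j * (6 * (-(l i : ℝ)) * covU F i j
            + (l i : ℝ) ^ 2 * (F (X i ^ 2 * X (Sum.inl j)) - m i * U j))) by
          nlinarith [sq_nonneg ((l i : ℝ) ^ 2 * (F (X i ^ 2 * X (Sum.inl j)) - m i * U j))]
      rw [e2] at e3
      linarith
    exact lt_of_mul_lt_mul_left a4 hl0.le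
  have : Nonempty (PairVar n) := ⟨Sum.inl ⟨0, hn⟩⟩
  have hfin := Finset.sum_lt_sum_of_nonempty (s := Finset.univ) Finset.univ_nonempty
    fun i _ => htwo i
  rw [Finset.sum_add_distrib, ← Finset.mul_sum, Finset.sum_sub_distrib, ← Finset.mul_sum,
    ← Finset.mul_sum, hcancel h hh, Finset.sum_comm, ← Finset.sum_mul, Finset.sum_add_distrib,
    ← Finset.mul_sum, ← Finset.mul_sum, hsum] at hfin
  have hz' : ∑ i, ∑ j, U j * (F (X i ^ 2 * X (Sum.inl j)) - m i * U j) = 0 := by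
    rw [Finset.sum_comm]
    refine Finset.sum_eq_zero fun j _ => ?_
    rw [← Finset.mul_sum, hcancel (X (Sum.inl j)) (by simp), mul_zero]
  have hSS : ∑ j, ∑ i, covU F i j ^ 2 = S := Finset.sum_comm
  simp only [hz', hSS] at hfin
  -- Summed over `i`, the left side is `(18/5) S`, the right side at most `(18 * 6 + 2 * 2) / 40 * S
  -- = (14/5) S`.
  nlinarith
end Step

/-! ### The potential and its geometric growth. -/

section Growth

open MvPolynomial

variable {n : ℕ} {D : ℕ} {F : MvPolynomial (PairVar n) ℝ →ₗ[ℝ] ℝ}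

/-- The squared norm of the pseudo-mean of `u`. -/
noncomputable def normSqU (F : MvPolynomial (PairVar n) ℝ →ₗ[ℝ] ℝ) : ℝ :=
  ∑ j, F (X (Sum.inl j)) ^ 2

/-- The squared norm of the pseudo-mean of `v`. -/
noncomputable def normSqV (F : MvPolynomial (PairVar n) ℝ →ₗ[ℝ] ℝ) : ℝ :=
  ∑ j, F (X (Sum.inr j)) ^ 2

/-- The squared Frobenius norm of the cross-covariance of `u` and `v`. -/
noncomputable def crossCov (F : MvPolynomial (PairVar n) ℝ →ₗ[ℝ] ℝ) : ℝ :=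
  ∑ i, ∑ j, covU F (Sum.inr i) j ^ 2

/-- The cross-covariance is small relative to the product of the means, which is not tiny. -/
def IsNearlyProduct (γ δ : ℝ) (F : MvPolynomial (PairVar n) ℝ →ₗ[ℝ] ℝ) : Prop :=
  crossCov F ≤ γ * (normSqU F * normSqV F) ∧ δ ≤ normSqU F * normSqV F

/-- The linear form `⟨w, v⟩`. -/
noncomputable def formV (w : Fin n → ℝ) : MvPolynomial (PairVar n) ℝ :=
  ∑ i, C (w i) * X (Sum.inr i)

theorem totalDegree_formV_le (w : Fin n → ℝ) : (formV w).totalDegree ≤ 1 := by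
  refine (totalDegree_finsetSum _ _).trans (Finset.sup_le fun i _ => ?_)
  refine (totalDegree_mul _ _).trans ?_
  simp

theorem totalDegree_formV_sub_le (w : Fin n → ℝ) (ρ : ℝ) :
    (formV w - C ρ).totalDegree ≤ 1 := by
  refine (totalDegree_sub _ _).trans (max_le (totalDegree_formV_le w) ?_)
  simp

theorem formV_apply (w : Fin n → ℝ) : F (formV w) = ∑ i, w i * F (X (Sum.inr i)) := by
  simp [formV, ← smul_eq_C_mul, map_sum]

/-- The mean of `⟨w, v⟩` differs from `ρ` by at most `|ρ| / 2`, so its square is at least `ρ² / 4`;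
by Cauchy–Schwarz it is at most `‖w‖² ‖F v‖²`. -/
theorem IsSpherePE.normSqV_ge (hF : IsSpherePE D F) (hD : 2 ≤ D) {w : Fin n → ℝ} {ρ θ : ℝ}
    (hw : 0 < ∑ i, w i ^ 2) (hθ : θ * ∑ i, w i ^ 2 ≤ ρ ^ 2)
    (hvar : F ((formV w - C ρ) ^ 2) ≤ ρ ^ 2 / 4) : θ / 4 ≤ normSqV F := by
  have hdeg := totalDegree_formV_sub_le w ρ
  have h1 := hF.mean_sq_le (f := formV w - C ρ) (by omega)
  have h2 : F (formV w - C ρ) = F (formV w) - ρ := by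
    rw [map_sub, show C ρ = ρ • (1 : MvPolynomial (PairVar n) ℝ) by simp [smul_eq_C_mul],
      map_smul, hF.one]
    simp
  rw [h2] at h1
  have h3 : ρ ^ 2 / 4 ≤ F (formV w) ^ 2 := by
    have h5 : (F (formV w) - ρ) ^ 2 ≤ (ρ / 2) ^ 2 := by nlinarith
    have h6 := sq_le_sq.mp h5
    have h7 : |ρ| ≤ |F (formV w) - ρ| + |F (formV w)| := by
      have := abs_sub (F (formV w)) (F (formV w) - ρ)
      rw [sub_sub_cancel] at this
      linarith
    have h8 : |ρ / 2| = |ρ| / 2 := by rw [abs_div, abs_two]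
    have h9 : |ρ / 2| ≤ |F (formV w)| := by linarith
    have := sq_le_sq.mpr h9
    nlinarith
  have h4 : F (formV w) ^ 2 ≤ (∑ i, w i ^ 2) * normSqV F := by
    rw [formV_apply]
    exact Finset.sum_mul_sq_le_sq_mul_sq _ _ _
  have h5 : (∑ i, w i ^ 2) * (θ / 4) ≤ (∑ i, w i ^ 2) * normSqV F := by linarith
  exact le_of_mul_le_mul_left h5 hw

/-- The potential: the squared norm of the mean of `u`, minus a penalty for the deviation of
`⟨w, v⟩` from `ρ`. -/
noncomputable def potential (w : Fin n → ℝ) (ρ : ℝ) (F : MvPolynomial (PairVar n) ℝ →ₗ[ℝ] ℝ) : ℝ :=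
  normSqU F - F (C (8 / ρ ^ 2) * (formV w - C ρ) ^ 2)

theorem penalty_apply (w : Fin n → ℝ) (ρ : ℝ) :
    F (C (8 / ρ ^ 2) * (formV w - C ρ) ^ 2) = 8 / ρ ^ 2 * F ((formV w - C ρ) ^ 2) := by
  rw [← smul_eq_C_mul, map_smul, smul_eq_mul]

/-- The covariance matrix of `u` has trace `1 - ‖F u‖² ≥ 1/2`, and the sum of the squares of `n`
diagonal entries with this sum is at least `1 / (4n)`. -/
theorem IsSpherePE.diag_gain (hn : 0 < n) (hF : IsSpherePE D F) (hD : 2 ≤ D)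
    (hX : normSqU F ≤ 1 / 2) : 1 / (4 * n) ≤ ∑ i : Fin n, ∑ j, covU F (Sum.inl i) j ^ 2 := by
  have hn' : (0 : ℝ) < n := by exact_mod_cast hn
  have h1 : ∑ i : Fin n, covU F (Sum.inl i) i = 1 - normSqU F := by
    simp only [covU, normSqU, Finset.sum_sub_distrib]
    rw [← (hF.sum_sq hD).1]
    simp only [sq]
  have h2 : (∑ i : Fin n, covU F (Sum.inl i) i) ^ 2 ≤ n * ∑ i : Fin n, covU F (Sum.inl i) i ^ 2 := by
    have := sq_sum_le_card_mul_sum_sq (s := (Finset.univ : Finset (Fin n)))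
      (f := fun i => covU F (Sum.inl i) i)
    simpa using this
  have h3 : ∑ i : Fin n, covU F (Sum.inl i) i ^ 2 ≤
      ∑ i : Fin n, ∑ j, covU F (Sum.inl i) j ^ 2 :=
    Finset.sum_le_sum fun i _ => Finset.single_le_sum
      (f := fun j => covU F (Sum.inl i) j ^ 2) (fun j _ => sq_nonneg _) (Finset.mem_univ i)
  rw [h1] at h2
  rw [div_le_iff₀ (by positivity)]
  nlinarith

/-- The offset `a` lets the growth start from a mean of `u` that may be zero. Since `normSqU F ≤ 1`
and the potential exceeds `-a ≥ -1/4`, the penalty is at most `5/4`; with its weight `8 / ρ²` this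
keeps the variance below `ρ² / 4`, so `normSqV F ≥ θ / 4` throughout. A large cross-covariance then
gives the gain, and when the means are too small for that, the covariance of `u` with itself does.
-/
theorem IsSpherePE.gain (hn : 0 < n) (hF : IsSpherePE D F) (hD : 4 ≤ D) {w : Fin n → ℝ}
    {ρ θ a N : ℝ} (hw : 0 < ∑ i, w i ^ 2) (hθ0 : 0 < θ) (hθ : θ * ∑ i, w i ^ 2 ≤ ρ ^ 2)
    (ha0 : 0 < a) (ha : a ≤ 1 / 4) (hN : 1 ≤ N)
    (hκ : 2 * a * (θ / (1280 * N ^ 2)) ≤ 1 / (160 * n))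
    (hpot : 0 < potential w ρ F + a)
    (hnot : ¬ IsNearlyProduct (1 / (4 * N ^ 2)) (a * θ / 4) F) :
    θ / (1280 * N ^ 2) * (potential w ρ F + a) ≤ 1 / 40 * ∑ i, ∑ j, covU F i j ^ 2 := by
  have hρ2 : 0 < ρ ^ 2 := lt_of_lt_of_le (by positivity) hθ
  have hN0 : 0 < N ^ 2 := by positivity
  set κ := θ / (1280 * N ^ 2) with hκd
  have hκ0 : 0 < κ := by positivity
  have hvar0 : 0 ≤ F ((formV w - C ρ) ^ 2) :=
    hF.nonneg_sq _ (by have := totalDegree_formV_sub_le w ρ; omega)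
  set V := F ((formV w - C ρ) ^ 2) with hV
  have hX1 : normSqU F ≤ 1 := hF.sum_mean_sq_le (by omega)
  have hpe : potential w ρ F = normSqU F - 8 / ρ ^ 2 * V := by rw [potential, penalty_apply]
  have hpen : 0 ≤ 8 / ρ ^ 2 * V := by positivity
  have hVb : ∀ y, 8 / ρ ^ 2 * V ≤ y → V ≤ ρ ^ 2 * y / 8 := by
    intro y hy
    rw [div_mul_eq_mul_div, div_le_iff₀ hρ2] at hy
    linarith
  have hY0 : V ≤ ρ ^ 2 / 4 → θ / 4 ≤ normSqV F := fun h => hF.normSqV_ge (by omega) hw hθ h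
  have hsplit : ∑ i, ∑ j, covU F i j ^ 2 =
      (∑ i : Fin n, ∑ j, covU F (Sum.inl i) j ^ 2) + crossCov F := Fintype.sum_sum_type _
  have hA : 0 ≤ ∑ i : Fin n, ∑ j, covU F (Sum.inl i) j ^ 2 :=
    Finset.sum_nonneg fun i _ => Finset.sum_nonneg fun j _ => sq_nonneg _
  have hB : 0 ≤ crossCov F :=
    Finset.sum_nonneg fun i _ => Finset.sum_nonneg fun j _ => sq_nonneg _
  have hviol : a * θ / 4 ≤ normSqU F * normSqV F →
      1 / (4 * N ^ 2) * (normSqU F * normSqV F) ≤ crossCov F := by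
    intro h
    by_contra hc
    exact hnot ⟨(not_le.mp hc).le, h⟩
  rw [hsplit]
  have hκe : κ * 1280 * N ^ 2 = θ := by rw [hκd]; field_simp
  -- A potential of at least `a` makes the product of the squared means at least `a θ / 4`, so it is
  -- the bound on the cross-covariance that fails. A fortieth of the latter is then at least `2 κ`
  -- times the potential.
  rcases le_or_gt a (potential w ρ F) with hcase | hcase
  · have hV1 : V ≤ ρ ^ 2 * 1 / 8 := hVb 1 (by linarith)
    have hY := hY0 (by linarith)
    have hXp : potential w ρ F ≤ normSqU F := by linarith
    have hXY : potential w ρ F * (θ / 4) ≤ normSqU F * normSqV F := by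
      apply mul_le_mul hXp hY (by positivity) (by linarith)
    have h1 := hviol (by nlinarith)
    have h2 : 1 / (4 * N ^ 2) * (potential w ρ F * (θ / 4)) ≤ crossCov F :=
      (mul_le_mul_of_nonneg_left hXY (by positivity)).trans h1
    have h3 : 1 / (4 * N ^ 2) * (potential w ρ F * (θ / 4)) = 80 * κ * potential w ρ F := by
      rw [hκd]; field_simp; ring
    nlinarith
  -- Now the required gain is at most `2 a κ`. For a small mean of `u` the hypothesis `hκ` compares
  -- this with the diagonal gain; for a large mean the cross-covariance alone is at least `40 κ`.
  · rcases le_or_gt (normSqU F) (1 / 2) with hX | hX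
    · have h1 := hF.diag_gain hn (by omega) hX
      have h2 : (1 : ℝ) / (160 * n) = 1 / 40 * (1 / (4 * n)) := by
        field_simp; norm_num
      nlinarith
    · have hV1 : V ≤ ρ ^ 2 * (5 / 4) / 8 := hVb _ (by linarith)
      have hY := hY0 (by linarith)
      have hXY : 1 / 2 * (θ / 4) ≤ normSqU F * normSqV F := by
        apply mul_le_mul hX.le hY (by positivity) (by linarith)
      have h1 := hviol (by nlinarith)
      have h2 : 1 / (4 * N ^ 2) * (1 / 2 * (θ / 4)) ≤ crossCov F :=
        (mul_le_mul_of_nonneg_left hXY (by positivity)).trans h1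
      have h3 : 1 / (4 * N ^ 2) * (1 / 2 * (θ / 4)) = 40 * κ := by
        rw [hκd]; field_simp; norm_num
      nlinarith

/-- The factor `3 + c zᵢ`. -/
noncomputable def stepFactor (p : PairVar n × ℤ) : MvPolynomial (PairVar n) ℝ :=
  C 3 + C (p.2 : ℝ) * X p.1

theorem totalDegree_stepFactor_le (p : PairVar n × ℤ) : (stepFactor p).totalDegree ≤ 1 := by
  refine (totalDegree_add _ _).trans (max_le (by simp) ?_)
  refine (totalDegree_mul _ _).trans ?_
  rw [totalDegree_C, totalDegree_X]

/-- While the means are not nearly a product, the potential grows geometrically; as it is bounded,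
few steps lead to a functional for which they are. -/
theorem exists_steps (hn : 0 < n) {w : Fin n → ℝ} {ρ θ a N : ℝ} (hw : 0 < ∑ i, w i ^ 2)
    (hθ0 : 0 < θ) (hθ : θ * ∑ i, w i ^ 2 ≤ ρ ^ 2) (ha0 : 0 < a) (ha : a ≤ 1 / 4) (hN : 1 ≤ N)
    (hκ : 2 * a * (θ / (1280 * N ^ 2)) ≤ 1 / (160 * n)) (T : ℕ) :
    ∀ (F : MvPolynomial (PairVar n) ℝ →ₗ[ℝ] ℝ), IsSpherePE (2 * T + 4) F →
      0 < potential w ρ F + a →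
      2 < (1 + θ / (1280 * N ^ 2)) ^ T * (potential w ρ F + a) →
      ∃ steps : List (PairVar n × ℤ), steps.length ≤ T ∧ (∀ p ∈ steps, |p.2| ≤ 2 * n) ∧
        1 ≤ F ((steps.map stepFactor).prod ^ 2) ∧
        IsNearlyProduct (1 / (4 * N ^ 2)) (a * θ / 4)
          (reweight F (steps.map stepFactor).prod) := by
  induction T with
  | zero =>
    intro F hF h0 h1
    -- With no steps left, `h1` says that the potential plus `a` exceeds 2, but the potential is at
    -- most 1.
    exfalso
    have h2 : normSqU F ≤ 1 := hF.sum_mean_sq_le (by omega)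
    have h3 : potential w ρ F ≤ normSqU F := by
      have hvar0 : 0 ≤ F ((formV w - C ρ) ^ 2) :=
        hF.nonneg_sq _ (by have := totalDegree_formV_sub_le w ρ; omega)
      rw [potential, penalty_apply]
      have : 0 ≤ 8 / ρ ^ 2 * F ((formV w - C ρ) ^ 2) := by positivity
      linarith
    rw [pow_zero, one_mul] at h1
    linarith
  | succ T ih =>
    intro F hF h0 h1
    by_cases hs : IsNearlyProduct (1 / (4 * N ^ 2)) (a * θ / 4) F
    · exact ⟨[], by simp, by simp, by simp [hF.one], by simpa [reweight_one F hF.one] using hs⟩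
    · have hg := hF.gain hn (by omega) hw hθ0 hθ ha0 ha hN hκ h0 hs
      have hdeg : (C (8 / ρ ^ 2) * (formV w - C ρ) ^ 2).totalDegree ≤ 2 := by
        refine (totalDegree_mul _ _).trans ?_
        have := totalDegree_formV_sub_le w ρ
        have := totalDegree_sq_le (formV w - C ρ)
        simp only [totalDegree_C]
        omega
      obtain ⟨i, c, hc, hq, hstep⟩ := hF.exists_step hn (by omega) hdeg
      have hfac : C 3 + C (c : ℝ) * X i = stepFactor (i, c) := rfl
      rw [hfac] at hq hstep
      have hq0 : 0 < F (stepFactor (i, c) ^ 2) := by linarith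
      have hF1 : IsSpherePE (2 * T + 4) (reweight F (stepFactor (i, c))) :=
        hF.of_reweight (by have := totalDegree_stepFactor_le (i, c); omega) hq0
      -- The increment of the potential dominates `κ` times the potential plus `a`, so that sum is
      -- multiplied by `1 + κ`.
      have hgrow : (1 + θ / (1280 * N ^ 2)) * (potential w ρ F + a) ≤
          potential w ρ (reweight F (stepFactor (i, c))) + a := by
        simp only [potential, normSqU] at hg ⊢
        linarith
      have hκ0 : 0 < θ / (1280 * N ^ 2) := by positivity
      obtain ⟨st, hl, hb, hm, hres⟩ := ih _ hF1
        (lt_of_lt_of_le (by positivity) hgrow) (by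
          refine lt_of_lt_of_le h1 ?_
          rw [pow_succ, mul_assoc]
          gcongr)
      refine ⟨(i, c) :: st, by simpa using hl, ?_, ?_, ?_⟩
      · rintro p (_ | ⟨_, hp⟩)
        exacts [hc, hb p hp]
      · rw [reweight_apply, le_div_iff₀ hq0, one_mul] at hm
        rw [List.map_cons, List.prod_cons, mul_pow]
        linarith
      · rwa [reweight_reweight _ _ _ hq0.ne'] at hres

end Growth

/-! ### A sparse integral direction with a large high moment. -/

section SparseDirection

open MvPolynomial

variable {n : ℕ} {D : ℕ} {F : MvPolynomial (PairVar n) ℝ →ₗ[ℝ] ℝ}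

/-- The monomial `v^k`. -/
noncomputable def monoV (k : Fin n → ℕ) : MvPolynomial (PairVar n) ℝ := ∏ i, X (Sum.inr i) ^ k i

theorem totalDegree_monoV_le (k : Fin n → ℕ) : (monoV k).totalDegree ≤ ∑ i, k i := by
  refine (totalDegree_finsetProd _ _).trans (Finset.sum_le_sum fun i _ => ?_)
  rw [totalDegree_X_pow]

theorem formV_pow_apply (w : Fin n → ℝ) (m : ℕ) :
    F (formV w ^ m) = ∑ k ∈ Finset.piAntidiag Finset.univ m,
      (Nat.multinomial Finset.univ k : ℝ) * (∏ i, w i ^ k i) * F (monoV k) := by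
  rw [formV, Finset.sum_pow_eq_sum_piAntidiag, map_sum]
  refine Finset.sum_congr rfl fun k _ => ?_
  have : (Nat.multinomial Finset.univ k : MvPolynomial (PairVar n) ℝ) *
      ∏ i, (C (w i) * X (Sum.inr i)) ^ k i =
      ((Nat.multinomial Finset.univ k : ℝ) * (∏ i, w i ^ k i)) • monoV k := by
    simp only [mul_pow, Finset.prod_mul_distrib, smul_eq_C_mul, map_mul, map_natCast, map_prod,
      map_pow, monoV]
    ring
  rw [this, map_smul, smul_eq_mul]

/-- Averaging over signs removes every monomial with an odd exponent. -/
theorem sum_signs (k : Fin n → ℕ) :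
    ∑ σ ∈ Fintype.piFinset (fun _ : Fin n => ({1, -1} : Finset ℤ)), ∏ i, ((σ i : ℤ) : ℝ) ^ k i =
      ∏ i, (1 + (-1 : ℝ) ^ k i) := by
  rw [← Finset.prod_univ_sum (fun _ : Fin n => ({1, -1} : Finset ℤ))
    (fun i x => ((x : ℤ) : ℝ) ^ k i)]
  refine Finset.prod_congr rfl fun i _ => ?_
  rw [Finset.sum_pair (by decide)]
  simp

/-- The first factor vanishes unless all exponents are even, and then `v^k` is a square. -/
theorem IsSpherePE.even_nonneg (hF : IsSpherePE D F) {k : Fin n → ℕ} (hk : ∑ i, k i ≤ D) :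
    0 ≤ (∏ i, (1 + (-1 : ℝ) ^ k i)) * F (monoV k) := by
  by_cases h : ∀ i, Even (k i)
  · choose a ha using h
    have e : monoV k = monoV a ^ 2 := by
      simp only [monoV, ← Finset.prod_pow, ← pow_mul]
      refine Finset.prod_congr rfl fun i _ => ?_
      rw [ha i, mul_two]
    refine mul_nonneg (Finset.prod_nonneg fun i _ => ?_) ?_
    · rw [Even.neg_one_pow ⟨a i, ha i⟩]; norm_num
    · rw [e]
      refine hF.nonneg_sq _ ?_
      have h1 := totalDegree_monoV_le a
      have h2 : ∑ i, k i = 2 * ∑ i, a i := by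
        rw [Finset.mul_sum]; exact Finset.sum_congr rfl fun i _ => by rw [ha i]; ring
      omega
  · push Not at h
    obtain ⟨i, hi⟩ := h
    have hi : Odd (k i) := Nat.not_even_iff_odd.mp hi
    rw [Finset.prod_eq_zero (Finset.mem_univ i) (by rw [hi.neg_one_pow]; norm_num), zero_mul]

/-- Stars and bars: the left side is the rising product `n (n + 1) ⋯ (n + s - 1)`, each factor of
which is at most `2 n`. -/
theorem card_piAntidiag_univ_mul_factorial_le (n s : ℕ) (hs : s ≤ n) :
    (Finset.piAntidiag (Finset.univ : Finset (Fin n)) s).card * s.factorial ≤ (2 * n) ^ s := by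
  have h1 : (Finset.piAntidiag (Finset.univ : Finset (Fin n)) s).card = Nat.multichoose n s := by
    rw [← Finset.map_sym_eq_piAntidiag, Finset.card_map]
    simp [Sym.card_sym_eq_multichoose]
  rw [h1, Nat.multichoose_eq, mul_comm, ← Nat.descFactorial_eq_factorial_mul_choose]
  refine (Nat.descFactorial_le_pow _ _).trans (Nat.pow_le_pow_left (by omega) s)

theorem factorial_two_mul_le_pow (a : ℕ) : (2 * a).factorial ≤ (2 * a) ^ a * a.factorial := by
  have h2 : (2 * a).factorial = (2 * a).descFactorial a * a.factorial := by
    have := Nat.factorial_mul_descFactorial (n := 2 * a) (k := a) (by omega)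
    rw [show 2 * a - a = a by omega] at this
    rw [← this, mul_comm]
  rw [h2]
  exact Nat.mul_le_mul_right _ (Nat.descFactorial_le_pow _ _)

/-- Equivalently, the central binomial coefficient is at least `2 ^ s`. -/
theorem factorial_sq_two_pow_le (s : ℕ) : 2 ^ s * s.factorial * s.factorial ≤ (2 * s).factorial := by
  induction s with
  | zero => simp
  | succ s ih =>
    have e1 : (2 * (s + 1)).factorial = (2 * s + 2) * ((2 * s + 1) * (2 * s).factorial) := by
      rw [show 2 * (s + 1) = 2 * s + 1 + 1 by ring, Nat.factorial_succ (2 * s + 1),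
        Nat.factorial_succ (2 * s)]
    have e2 : 2 ^ (s + 1) * (s + 1).factorial * (s + 1).factorial =
        (2 * s + 2) * ((s + 1) * (2 ^ s * s.factorial * s.factorial)) := by
      rw [Nat.factorial_succ s]; ring
    rw [e1, e2]
    exact Nat.mul_le_mul_left _ (Nat.mul_le_mul (by omega) ih)

/-- An integer close to the square root. -/
def ceilSqrt (a : ℕ) : ℕ := if a ≤ Nat.sqrt a ^ 2 then Nat.sqrt a else Nat.sqrt a + 1

/-- The lower bound is used to compare coefficients, the upper one bounds `‖w‖²` by `4 s`. The last
one bounds the entries of `w` and shows that a zero exponent gives a zero entry, hence sparsity. -/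
theorem ceilSqrt_spec (a : ℕ) : a ≤ ceilSqrt a ^ 2 ∧ ceilSqrt a ^ 2 ≤ 4 * a ∧ ceilSqrt a ≤ a := by
  have h1 := Nat.sqrt_le' a
  have h2 := Nat.lt_succ_sqrt' a
  have h3 := Nat.sqrt_le_self a
  rw [Nat.succ_eq_add_one] at h2
  unfold ceilSqrt
  split_ifs with h
  · exact ⟨h, by omega, h3⟩
  · push Not at h
    have h4 : 1 ≤ a := by omega
    have h5 : 1 ≤ Nat.sqrt a := by rw [Nat.le_sqrt']; omega
    exact ⟨h2.le, by nlinarith, by nlinarith⟩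

/-- Compare the coefficient of `v^{2α}` in `⟨w, v⟩^{2s}` with that in `s! · ‖v‖^{2s}`. -/
theorem multinomial_two_mul_ge (α : Fin n → ℕ) {s : ℕ} (hα : ∑ i, α i = s) :
    Nat.multinomial Finset.univ α * s.factorial ≤
      Nat.multinomial Finset.univ (fun i => 2 * α i) * ∏ i, ceilSqrt (α i) ^ (2 * α i) := by
  have h1 := Nat.multinomial_spec Finset.univ α
  have h2 := Nat.multinomial_spec Finset.univ (fun i => 2 * α i)
  rw [hα] at h1
  rw [← Finset.mul_sum, hα] at h2
  set M1 := Nat.multinomial Finset.univ α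
  set M2 := Nat.multinomial Finset.univ (fun i => 2 * α i)
  set P := ∏ i, (α i).factorial with hP
  set R := ∏ i, ceilSqrt (α i) ^ (2 * α i)
  have hP0 : 0 < P := Finset.prod_pos fun i _ => Nat.factorial_pos _
  -- Each factor is `(2a)! ≤ (2a)^a a!`, and `a ≤ ceilSqrt a ^ 2` turns `a ^ a` into a power of
  -- `ceilSqrt a`.
  have h3 : ∏ i, (2 * α i).factorial ≤ 2 ^ s * R * P := by
    calc ∏ i, (2 * α i).factorial
        ≤ ∏ i, (2 ^ α i * ceilSqrt (α i) ^ (2 * α i) * (α i).factorial) := by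
          refine Finset.prod_le_prod' fun i _ => (factorial_two_mul_le_pow _).trans ?_
          refine Nat.mul_le_mul_right _ ?_
          rw [mul_pow, pow_mul]
          exact Nat.mul_le_mul_left _ (Nat.pow_le_pow_left (ceilSqrt_spec _).1 _)
      _ = 2 ^ s * R * P := by
          rw [Finset.prod_mul_distrib, Finset.prod_mul_distrib, Finset.prod_pow_eq_pow_sum, hα]
  have h4 := factorial_sq_two_pow_le s
  have h5 : (2 ^ s * P) * (M1 * s.factorial) ≤ (2 ^ s * P) * (M2 * R) := by
    calc (2 ^ s * P) * (M1 * s.factorial) = 2 ^ s * (P * M1) * s.factorial := by ring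
      _ = 2 ^ s * s.factorial * s.factorial := by rw [h1]
      _ ≤ (2 * s).factorial := h4
      _ = (∏ i, (2 * α i).factorial) * M2 := h2.symm
      _ ≤ (2 ^ s * R * P) * M2 := Nat.mul_le_mul_right _ h3
      _ = _ := by ring
  exact Nat.le_of_mul_le_mul_left h5 (by positivity)

/-- One term of the exponential series gives `s ^ s / s! ≤ e ^ s`, and `e < 3`. -/
theorem div_three_pow_lt_factorial {s : ℕ} (hs : s ≠ 0) : ((s : ℝ) / 3) ^ s < s.factorial := by
  have h := Real.pow_div_factorial_le_exp (x := (s : ℝ)) (by positivity) s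
  have h2 : Real.exp s < 3 ^ s := by
    rw [show (s : ℝ) = s * 1 by ring, Real.exp_nat_mul]
    exact pow_lt_pow_left₀ (Real.exp_one_lt_d9.trans (by norm_num)) (Real.exp_pos _).le hs
  rw [div_le_iff₀ (by positivity)] at h
  rw [div_pow, div_lt_iff₀ (by positivity)]
  calc (s : ℝ) ^ s ≤ Real.exp s * s.factorial := h
    _ < 3 ^ s * s.factorial := by gcongr
    _ = _ := mul_comm _ _

theorem IsSpherePE.formV_one_pow (hF : IsSpherePE D F) (s : ℕ) (hs : 2 * s ≤ D) :
    F ((∑ i : Fin n, X (Sum.inr i) ^ 2) ^ s) = 1 := by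
  induction s with
  | zero => simp [hF.one]
  | succ s ih =>
    rw [pow_succ', hF.sphereV, ih (by omega)]
    have h2 : (∑ i : Fin n, (X (Sum.inr i) : MvPolynomial (PairVar n) ℝ) ^ 2).totalDegree ≤ 2 :=
      (totalDegree_finsetSum _ _).trans (Finset.sup_le fun i _ => by rw [totalDegree_X_pow])
    have h3 := totalDegree_pow (∑ i : Fin n, (X (Sum.inr i) : MvPolynomial (PairVar n) ℝ) ^ 2) s
    have : s * (∑ i : Fin n, (X (Sum.inr i) : MvPolynomial (PairVar n) ℝ) ^ 2).totalDegree ≤ s * 2 :=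
      Nat.mul_le_mul_left _ h2
    omega

/-- The candidates are `w i = ± ceilSqrt (α i)` with `∑ α i = s`. Suppose all their moments of order
`2 s` are below `18^(-s)`. For fixed `α`, the average over the signs involves only even monomials,
all with nonnegative expectation, and the coefficient of `v^(2α)` is at least `s!` times that in
`‖v‖^(2s)` (`multinomial_two_mul_ge`). Summing over `α` and using that `‖v‖^(2s)` has expectation 1,
one gets `s! ≤ 18^(-s)` times the number of `α`, which is at most `(2n)^s / s!`. Hence `s!² ≤
(n/9)^s ≤ (s/3)^(2s)`, against `s! > (s/3)^s`. -/
theorem IsSpherePE.exists_sparse (hF : IsSpherePE D F) {s : ℕ} (hs : 2 * s ≤ D) (hs1 : 1 ≤ s)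
    (hsn : s ≤ n) (hns : n ≤ s ^ 2) :
    ∃ w : Fin n → ℤ, (∀ i, |w i| ≤ s) ∧ (Finset.univ.filter fun i => w i ≠ 0).card ≤ s ∧
      1 ≤ ∑ i, (w i : ℝ) ^ 2 ∧ ∑ i, (w i : ℝ) ^ 2 ≤ 4 * s ∧
      (1 / 18 : ℝ) ^ s ≤ F (formV (fun i => (w i : ℝ)) ^ (2 * s)) := by
  classical
  have hn0 : (0 : ℝ) < n := by have : 0 < n := by omega
                               exact_mod_cast this
  by_contra hcon
  push Not at hcon
  set A := Finset.piAntidiag (Finset.univ : Finset (Fin n)) s with hA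
  set Sg := Fintype.piFinset (fun _ : Fin n => ({1, -1} : Finset ℤ)) with hSg
  have hcard : (Sg.card : ℝ) = 2 ^ n := by
    rw [hSg, Fintype.card_piFinset]; simp
  -- every sparse sign vector has a small moment
  have hsmall : ∀ α ∈ A, ∀ σ ∈ Sg,
      F (formV (fun i => ((σ i : ℤ) : ℝ) * ceilSqrt (α i)) ^ (2 * s)) < (1 / 18 : ℝ) ^ s := by
    intro α hα σ hσ
    have hα' : ∑ i, α i = s := (Finset.mem_piAntidiag.mp hα).1
    have hσ1 : ∀ i, σ i = 1 ∨ σ i = -1 := fun i => by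
      simpa using Fintype.mem_piFinset.mp hσ i
    have hσ2 : ∀ i, (σ i) ^ 2 = 1 := fun i => by rcases hσ1 i with h | h <;> rw [h] <;> norm_num
    have hsq : ∀ i, (σ i * (ceilSqrt (α i) : ℤ)) ^ 2 = ((ceilSqrt (α i) ^ 2 : ℕ) : ℤ) := fun i => by
      rw [mul_pow, hσ2, one_mul]; push_cast; rfl
    have hsum : ∑ i, (((σ i * (ceilSqrt (α i) : ℤ) : ℤ)) : ℝ) ^ 2 =
        ((∑ i, ceilSqrt (α i) ^ 2 : ℕ) : ℝ) := by
      push_cast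
      refine Finset.sum_congr rfl fun i _ => ?_
      have := hsq i
      exact_mod_cast this
    have h := hcon (fun i => σ i * (ceilSqrt (α i) : ℤ)) ?_ ?_ ?_ ?_
    · simpa using h
    · intro i
      have h1 : |σ i| = 1 := by rcases hσ1 i with h | h <;> rw [h] <;> simp
      rw [abs_mul, h1, one_mul, abs_of_nonneg (by positivity)]
      have h2 : α i ≤ s := by
        rw [← hα']; exact Finset.single_le_sum (fun _ _ => Nat.zero_le _) (Finset.mem_univ i)
      exact_mod_cast (ceilSqrt_spec (α i)).2.2.trans h2
    · rw [← hα']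
      calc (Finset.univ.filter fun i => σ i * (ceilSqrt (α i) : ℤ) ≠ 0).card
          ≤ (Finset.univ.filter fun i => α i ≠ 0).card := by
            refine Finset.card_le_card fun i hi => ?_
            simp only [Finset.mem_filter, Finset.mem_univ, true_and] at hi ⊢
            intro h0
            apply hi
            have := (ceilSqrt_spec (α i)).2.2
            have h2 : ceilSqrt (α i) = 0 := by omega
            simp [h2]
        _ = ∑ i ∈ Finset.univ.filter (fun i => α i ≠ 0), 1 := by simp
        _ ≤ ∑ i ∈ Finset.univ.filter (fun i => α i ≠ 0), α i :=
            Finset.sum_le_sum fun i hi => by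
              have := (Finset.mem_filter.mp hi).2
              omega
        _ ≤ ∑ i, α i := Finset.sum_le_univ_sum_of_nonneg fun i => Nat.zero_le _
    · rw [hsum]
      have : 1 ≤ ∑ i, ceilSqrt (α i) ^ 2 :=
        (hs1.trans_eq hα'.symm).trans (Finset.sum_le_sum fun i _ => (ceilSqrt_spec _).1)
      exact_mod_cast this
    · rw [hsum]
      have : ∑ i, ceilSqrt (α i) ^ 2 ≤ 4 * s := by
        rw [← hα', Finset.mul_sum]
        exact Finset.sum_le_sum fun i _ => (ceilSqrt_spec _).2.1
      exact_mod_cast this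
  -- averaging over signs
  have havg : ∀ α ∈ A, 2 ^ n * ((Nat.multinomial Finset.univ α * s.factorial : ℕ) *
      F (monoV fun i => 2 * α i)) ≤ 2 ^ n * (1 / 18 : ℝ) ^ s := by
    intro α hα
    have hα' : ∑ i, α i = s := (Finset.mem_piAntidiag.mp hα).1
    have h1 : ∑ σ ∈ Sg, F (formV (fun i => ((σ i : ℤ) : ℝ) * ceilSqrt (α i)) ^ (2 * s)) ≤
        2 ^ n * (1 / 18 : ℝ) ^ s := by
      rw [← hcard, ← nsmul_eq_mul]
      exact Finset.sum_le_card_nsmul _ _ _ fun σ hσ => (hsmall α hα σ hσ).le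
    refine le_trans ?_ h1
    have h2 : ∑ σ ∈ Sg, F (formV (fun i => ((σ i : ℤ) : ℝ) * ceilSqrt (α i)) ^ (2 * s)) =
        ∑ k ∈ Finset.piAntidiag Finset.univ (2 * s), (Nat.multinomial Finset.univ k : ℝ) *
          (∏ i, (ceilSqrt (α i) : ℝ) ^ k i) * ((∏ i, (1 + (-1 : ℝ) ^ k i)) * F (monoV k)) := by
      simp only [formV_pow_apply]
      rw [Finset.sum_comm]
      refine Finset.sum_congr rfl fun k _ => ?_
      rw [← sum_signs k, Finset.sum_mul, Finset.mul_sum]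
      refine Finset.sum_congr rfl fun σ _ => ?_
      simp only [mul_pow, Finset.prod_mul_distrib]
      ring
    rw [h2]
    have hmem : (fun i => 2 * α i) ∈ Finset.piAntidiag (Finset.univ : Finset (Fin n)) (2 * s) := by
      rw [Finset.mem_piAntidiag]
      refine ⟨?_, fun _ _ => Finset.mem_univ _⟩
      rw [← Finset.mul_sum, hα']
    -- Only the term `k = 2 α` is kept; the other terms are nonnegative.
    refine le_trans ?_ (Finset.single_le_sum (fun k hk => ?_) hmem)
    · have hmono : 0 ≤ F (monoV fun i => 2 * α i) := by
        have := hF.even_nonneg (k := fun i => 2 * α i) (by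
          rw [← Finset.mul_sum, hα']; exact hs)
        have e : ∏ i, (1 + (-1 : ℝ) ^ (2 * α i)) = 2 ^ n := by
          simp [pow_mul]; norm_num
        rw [e] at this
        exact nonneg_of_mul_nonneg_right this (by positivity)
      have e : ∏ i, (1 + (-1 : ℝ) ^ (2 * α i)) = 2 ^ n := by
        simp [pow_mul]; norm_num
      rw [e]
      have hc := multinomial_two_mul_ge α hα'
      have hc' : ((Nat.multinomial Finset.univ α * s.factorial : ℕ) : ℝ) ≤
          (Nat.multinomial Finset.univ (fun i => 2 * α i) : ℝ) *
            ∏ i, (ceilSqrt (α i) : ℝ) ^ (2 * α i) := by exact_mod_cast hc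
      have := mul_le_mul_of_nonneg_right hc' (mul_nonneg (by positivity : (0 : ℝ) ≤ 2 ^ n) hmono)
      linarith
    · have hk' : ∑ i, k i = 2 * s := (Finset.mem_piAntidiag.mp hk).1
      exact mul_nonneg (by positivity) (hF.even_nonneg (by omega))
  have hone : ∑ α ∈ A, (Nat.multinomial Finset.univ α : ℝ) * F (monoV fun i => 2 * α i) = 1 := by
    rw [← hF.formV_one_pow s hs, Finset.sum_pow_eq_sum_piAntidiag, map_sum]
    refine Finset.sum_congr rfl fun k _ => ?_
    rw [← nsmul_eq_mul, ← nsmul_eq_mul, map_nsmul]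
    simp only [monoV, ← pow_mul]
  have htot : (s.factorial : ℝ) ≤ A.card * (1 / 18 : ℝ) ^ s := by
    calc (s.factorial : ℝ)
        = ∑ α ∈ A, s.factorial * ((Nat.multinomial Finset.univ α : ℝ) *
            F (monoV fun i => 2 * α i)) := by rw [← Finset.mul_sum, hone, mul_one]
      _ ≤ ∑ α ∈ A, (1 / 18 : ℝ) ^ s := by
          refine Finset.sum_le_sum fun α hα => ?_
          have := le_of_mul_le_mul_left (havg α hα) (by positivity)
          push_cast at this
          linarith
      _ = _ := by rw [Finset.sum_const, nsmul_eq_mul]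
  have hcount : (A.card : ℝ) * s.factorial ≤ (2 * n) ^ s := by
    exact_mod_cast card_piAntidiag_univ_mul_factorial_le n s hsn
  have hf := div_three_pow_lt_factorial (s := s) (by omega)
  have hf0 : (0 : ℝ) < s.factorial := by positivity
  have h1 : ((s : ℝ) / 3) ^ s * ((s : ℝ) / 3) ^ s < s.factorial * s.factorial := by
    gcongr
  have h2 : (s.factorial : ℝ) * s.factorial ≤ (2 * n) ^ s * (1 / 18 : ℝ) ^ s := by
    calc (s.factorial : ℝ) * s.factorial ≤ A.card * (1 / 18 : ℝ) ^ s * s.factorial := by gcongr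
      _ = A.card * s.factorial * (1 / 18 : ℝ) ^ s := by ring
      _ ≤ _ := by gcongr
  have h3 := h1.trans_le h2
  -- Taking roots of order `s` leaves `s² / 9 < 2 n / 18`, which contradicts `n ≤ s²`.
  rw [← mul_pow, ← mul_pow] at h3
  have h4 := lt_of_pow_lt_pow_left₀ s (by positivity) h3
  have hns' : (n : ℝ) ≤ (s : ℝ) ^ 2 := by exact_mod_cast hns
  nlinarith

end SparseDirection

/-! ### A place where a log-convex sequence grows almost geometrically. -/

section Window

/-- Log-convexity makes the ratios `f (t + 1) / f t` nondecreasing. From `s` on they are at least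
`x`, and they never exceed `ω`. If each of the `m` steps after `s` raised the ratio by the factor `1
+ η`, it would pass `ω`. -/
theorem exists_window {f : ℕ → ℝ} {s m : ℕ} {x ω η : ℝ} (hs : 1 ≤ s) (hf0 : f 0 = 1) (hx : 0 < x)
    (hη : 0 < η) (hfs : x ^ s ≤ f s) (hpos : ∀ t ≤ s + m + 1, 0 ≤ f t)
    (hω : ∀ t ≤ s + m, f (t + 1) ≤ ω * f t)
    (hlc : ∀ t < s + m, f (t + 1) ^ 2 ≤ f t * f (t + 2)) (hlong : ω < (1 + η) ^ m * x) :
    ∃ t, s ≤ t ∧ t < s + m ∧ x ^ t ≤ f t ∧ x * f t ≤ f (t + 1) ∧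
      f (t + 2) * f t ≤ (1 + η) * f (t + 1) ^ 2 := by
  -- If `f 1` vanished, `hω` would propagate the zero up to `f s`, which is at least `x ^ s`.
  have h1 : 0 < f 1 := by
    refine lt_of_le_of_ne (hpos 1 (by omega)) fun h => ?_
    have hz : ∀ t, t + 1 ≤ s → f (t + 1) = 0 := by
      intro t
      induction t with
      | zero => intro _; exact h.symm
      | succ t ih =>
        intro ht
        have := hω (t + 1) (by omega)
        rw [ih (by omega), mul_zero] at this
        exact le_antisymm this (hpos _ (by omega))
    have := hz (s - 1) (by omega)
    rw [show s - 1 + 1 = s by omega] at this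
    rw [this] at hfs
    exact absurd hfs (not_le.mpr (by positivity))
  have hp : ∀ t, t ≤ s + m → 0 < f t ∧ 0 < f (t + 1) := by
    intro t
    induction t with
    | zero => intro _; exact ⟨by rw [hf0]; norm_num, h1⟩
    | succ t ih =>
      intro ht
      obtain ⟨a, b⟩ := ih (by omega)
      refine ⟨b, ?_⟩
      have h2 := hlc t (by omega)
      by_contra hc
      have h3 : f (t + 2) ≤ 0 := not_lt.mp hc
      nlinarith [mul_nonneg a.le (neg_nonneg.mpr h3), pow_pos b 2]
  -- ratios are nondecreasing
  set r : ℕ → ℝ := fun t => f (t + 1) / f t with hr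
  have hfr : ∀ t, t ≤ s + m → f (t + 1) = r t * f t := fun t ht => by
    have := (hp t ht).1
    simp only [hr]; field_simp
  have hmono : ∀ t < s + m, r t ≤ r (t + 1) := by
    intro t ht
    obtain ⟨a, b⟩ := hp t ht.le
    simp only [hr]
    rw [div_le_div_iff₀ a b]
    have := hlc t ht
    nlinarith
  have hmono' : ∀ t u, t ≤ u → u ≤ s + m → r t ≤ r u := by
    intro t u htu
    induction u, htu using Nat.le_induction with
    | base => intro _; exact le_rfl
    | succ u _ ih => intro hu; exact (ih (by omega)).trans (hmono u (by omega))
  -- Otherwise all ratios up to `s` are below `x`, and their product gives `f s < x ^ s`.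
  have hrs : x ≤ r s := by
    by_contra hc
    push Not at hc
    have hlt : ∀ t, t + 1 ≤ s → f (t + 1) < x ^ (t + 1) := by
      intro t
      induction t with
      | zero =>
        intro h
        rw [hfr 0 (by omega), hf0]
        simpa using (hmono' 0 s (by omega) (by omega)).trans_lt hc
      | succ t ih =>
        intro h
        rw [hfr (t + 1) (by omega), pow_succ' x (t + 1)]
        have e1 := (hmono' (t + 1) s (by omega) (by omega)).trans_lt hc
        have e2 := ih (by omega)
        have e3 := (hp (t + 1) (by omega)).1
        exact mul_lt_mul e1 e2.le e3 hx.le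
    have := hlt (s - 1) (by omega)
    rw [show s - 1 + 1 = s by omega] at this
    linarith
  have hge : ∀ t, s ≤ t → t ≤ s + m → x ^ t ≤ f t := by
    intro t hst
    induction t, hst using Nat.le_induction with
    | base => intro _; exact hfs
    | succ t hst ih =>
      intro ht
      rw [hfr t (by omega), pow_succ']
      have e1 := hrs.trans (hmono' s t hst (by omega))
      exact mul_le_mul e1 (ih (by omega)) (by positivity) (hx.le.trans e1)
  by_contra hcon
  push Not at hcon
  have hstep : ∀ t, s ≤ t → t < s + m → (1 + η) * r t ≤ r (t + 1) := by
    intro t hst ht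
    have a := (hp t ht.le).1
    have b := (hp t ht.le).2
    have e1 := hrs.trans (hmono' s t hst ht.le)
    have h2 := hcon t hst ht (hge t hst ht.le) (by rw [hfr t ht.le]; gcongr)
    simp only [hr]
    rw [← mul_div_assoc, div_le_div_iff₀ a b]
    nlinarith
  have hgrow : ∀ j, j ≤ m → (1 + η) ^ j * x ≤ r (s + j) := by
    intro j
    induction j with
    | zero => intro _; simpa using hrs
    | succ j ih =>
      intro hj
      rw [pow_succ', mul_assoc]
      refine le_trans ?_ (hstep (s + j) (by omega) (by omega))
      exact mul_le_mul_of_nonneg_left (ih (by omega)) (by positivity)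
  have h3 := hgrow m le_rfl
  have h4 := hω (s + m) le_rfl
  rw [hfr (s + m) le_rfl] at h4
  have h5 := le_of_mul_le_mul_right h4 (hp (s + m) le_rfl).1
  linarith

/-- Bernoulli: `(1 + 1/e) ^ e ≥ 2`. Growth by `1 + 1/e` for `e j` steps thus doubles at least `j`
times. -/
theorem two_pow_le_one_add_inv_pow {e : ℕ} (he : 1 ≤ e) (j : ℕ) :
    (2 : ℝ) ^ j ≤ (1 + 1 / (e : ℝ)) ^ (e * j) := by
  have he' : (0 : ℝ) < e := by exact_mod_cast he
  rw [pow_mul]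
  refine pow_le_pow_left₀ (by norm_num) ?_ j
  have := one_add_mul_le_pow (a := 1 / (e : ℝ)) (by have : 0 < 1 / (e : ℝ) := by positivity
                                                    linarith) e
  rw [mul_one_div_cancel he'.ne'] at this
  linarith

end Window

/-! ### Moments of a linear form, and making it nearly constant. -/

section Existence

open MvPolynomial

variable {n : ℕ} {D : ℕ} {F : MvPolynomial (PairVar n) ℝ →ₗ[ℝ] ℝ}

theorem totalDegree_formV_pow_le (w : Fin n → ℝ) (t : ℕ) : (formV w ^ t).totalDegree ≤ t := by
  have h := totalDegree_pow (formV w) t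
  have := Nat.mul_le_mul_left t (totalDegree_formV_le w)
  omega

theorem IsSpherePE.formV_logconvex (hF : IsSpherePE D F) (w : Fin n → ℝ) {t : ℕ}
    (ht : 2 * (t + 2) ≤ D) :
    F (formV w ^ (2 * (t + 1))) ^ 2 ≤ F (formV w ^ (2 * t)) * F (formV w ^ (2 * (t + 2))) := by
  have h1 := totalDegree_formV_pow_le w t
  have h2 := totalDegree_formV_pow_le w (t + 2)
  have h := hF.cauchy_schwarz (f := formV w ^ t) (g := formV w ^ (t + 2)) (by omega) (by omega)
  rw [← pow_add, ← pow_mul, ← pow_mul] at h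
  convert h using 4 <;> ring

/-- Lagrange's identity writes `‖w‖² ‖v‖² - ⟨w, v⟩²` as half the sum of the squares `(w i v j - w j
v i)²`; multiplied by `⟨w, v⟩^(2t)` it remains a sum of squares. -/
theorem IsSpherePE.formV_pow_succ_le (hF : IsSpherePE D F) (w : Fin n → ℝ) {t : ℕ}
    (ht : 2 * t + 2 ≤ D) :
    F (formV w ^ (2 * (t + 1))) ≤ (∑ i, w i ^ 2) * F (formV w ^ (2 * t)) := by
  have hB := totalDegree_formV_pow_le w t
  have hB2 := totalDegree_formV_pow_le w (2 * t)
  have hdeg : ∀ i j, (C (w i) * X (Sum.inr j) - C (w j) * X (Sum.inr i) :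
      MvPolynomial (PairVar n) ℝ).totalDegree ≤ 1 := by
    intro i j
    refine (totalDegree_sub _ _).trans (max_le ?_ ?_) <;>
    · refine (totalDegree_mul _ _).trans ?_
      rw [totalDegree_C, totalDegree_X]
  have hnn : 0 ≤ ∑ i, ∑ j, F ((formV w ^ t * (C (w i) * X (Sum.inr j) - C (w j) * X (Sum.inr i))) ^ 2) := by
    refine Finset.sum_nonneg fun i _ => Finset.sum_nonneg fun j _ => hF.nonneg_sq _ ?_
    have h1 := totalDegree_mul (formV w ^ t)
      (C (w i) * X (Sum.inr j) - C (w j) * X (Sum.inr i) : MvPolynomial (PairVar n) ℝ)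
    have h2 := hdeg i j
    omega
  have key : (∑ i, ∑ j, (formV w ^ t *
      (C (w i) * X (Sum.inr j) - C (w j) * X (Sum.inr i))) ^ 2 : MvPolynomial (PairVar n) ℝ) =
      (2 * ∑ i, w i ^ 2) • ((∑ j, X (Sum.inr j) ^ 2) * formV w ^ (2 * t))
        - (2 : ℝ) • formV w ^ (2 * (t + 1)) := by
    have e : ∀ i j, (formV w ^ t * (C (w i) * X (Sum.inr j) - C (w j) * X (Sum.inr i))) ^ 2 =
        formV w ^ (2 * t) * (C (w i) ^ 2 * X (Sum.inr j) ^ 2 + C (w j) ^ 2 * X (Sum.inr i) ^ 2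
          - 2 * ((C (w i) * X (Sum.inr i)) * (C (w j) * X (Sum.inr j)))) := by
      intro i j; ring
    have e3 : (∑ i, ∑ j, (C (w i) ^ 2 * X (Sum.inr j) ^ 2 + C (w j) ^ 2 * X (Sum.inr i) ^ 2
          - 2 * ((C (w i) * X (Sum.inr i)) * (C (w j) * X (Sum.inr j)))) :
          MvPolynomial (PairVar n) ℝ) =
        2 * ((∑ i, C (w i) ^ 2) * ∑ j, X (Sum.inr j) ^ 2) - 2 * (formV w * formV w) := by
      simp only [Finset.sum_sub_distrib, Finset.sum_add_distrib, formV, ← Finset.mul_sum]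
      rw [← Finset.sum_mul, ← Finset.sum_mul]
      rw [show ∑ i, ∑ j, (C (w j) ^ 2 * X (Sum.inr i) ^ 2 : MvPolynomial (PairVar n) ℝ) =
        (∑ i, C (w i) ^ 2) * ∑ j, X (Sum.inr j) ^ 2 by
          rw [Finset.sum_mul_sum, Finset.sum_comm]]
      ring
    simp only [e, ← Finset.mul_sum, e3]
    simp only [smul_eq_C_mul, map_mul, map_sum, map_pow, map_ofNat]
    ring
  simp only [← map_sum] at hnn
  rw [key, map_sub, map_smul, map_smul, hF.sphereV _ (by omega)] at hnn
  simp only [smul_eq_mul] at hnn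
  linarith

/-- After a reweighting by a power of `⟨w, v⟩` for which the moments grow slowly, and by one more
factor that breaks the symmetry, `⟨w, v⟩` is close to a constant `ρ`. -/
theorem IsSpherePE.exists_fix {G : MvPolynomial (PairVar n) ℝ →ₗ[ℝ] ℝ} (hG : IsSpherePE D G)
    {w : Fin n → ℝ} {r η : ℝ} {N₀ : ℕ} (hr : 0 < r) (hη0 : 0 < η) (hη1 : η ≤ 1)
    (h2 : G (formV w ^ 2) = r) (h4 : G (formV w ^ 4) ≤ (1 + η) * r ^ 2) (hN₀ : 3 / η ≤ N₀ * √r) :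
    ∃ (j : ℤ) (ρ : ℝ), |(j : ℝ)| ≤ N₀ * √r + 1 ∧ r ≤ ρ ^ 2 ∧
      N₀ ^ 2 * r ≤ G ((C (N₀ : ℝ) * formV w + C (j : ℝ)) ^ 2) ∧
      reweight G (C (N₀ : ℝ) * formV w + C (j : ℝ)) ((formV w - C ρ) ^ 2) ≤ 2 * η * r := by
  have hsr : 0 < √r := Real.sqrt_pos.mpr hr
  have hsr2 : √r ^ 2 = r := Real.sq_sqrt hr.le
  have hN0 : (0 : ℝ) < N₀ := by
    have : 0 < (N₀ : ℝ) * √r := lt_of_lt_of_le (by positivity) hN₀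
    exact pos_of_mul_pos_left this hsr.le
  -- The number `√r` is rounded up to a multiple `ρ₀` of `1 / N₀`, so that the factor has integral
  -- coefficients. By `hN₀` the relative error is at most `η / 3`.
  set j₀ := ⌈(N₀ : ℝ) * √r⌉₊ with hj₀
  have hj1 : (N₀ : ℝ) * √r ≤ j₀ := Nat.le_ceil _
  have hj2 : (j₀ : ℝ) < N₀ * √r + 1 := Nat.ceil_lt_add_one (by positivity)
  -- The sign is that of the mean of `⟨w, v⟩`. It makes the cross term of the mass nonnegative, so
  -- that the mass does not fall below `N₀² r`.
  obtain ⟨σ, hσ, hσB⟩ : ∃ σ : ℤ, (σ = 1 ∨ σ = -1) ∧ 0 ≤ (σ : ℝ) * G (formV w) := by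
    rcases le_total 0 (G (formV w)) with h | h
    · exact ⟨1, Or.inl rfl, by simpa using h⟩
    · exact ⟨-1, Or.inr rfl, by simpa using h⟩
  have hσ2 : (σ : ℝ) ^ 2 = 1 := by rcases hσ with h | h <;> rw [h] <;> norm_num
  have hσa : |(σ : ℝ)| = 1 := by rcases hσ with h | h <;> rw [h] <;> simp
  set ρ₀ : ℝ := j₀ / N₀ with hρ₀
  have hρj : N₀ * ρ₀ = j₀ := by rw [hρ₀]; field_simp
  have hρ1 : √r ≤ ρ₀ := by rw [hρ₀, le_div_iff₀ hN0]; linarith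
  have hρ2 : ρ₀ ≤ √r * (1 + η / 3) := by
    have h3 : 3 ≤ N₀ * √r * η := by rwa [div_le_iff₀ hη0] at hN₀
    rw [hρ₀, div_le_iff₀ hN0]
    nlinarith
  have hρr : r ≤ ρ₀ ^ 2 := by rw [← hsr2]; gcongr
  have hρr' : ρ₀ ^ 2 ≤ (1 + η) * r := by
    calc ρ₀ ^ 2 ≤ (√r * (1 + η / 3)) ^ 2 := by gcongr
      _ = r * (1 + η / 3) ^ 2 := by rw [mul_pow, hsr2]
      _ ≤ r * (1 + η) := mul_le_mul_of_nonneg_left (by nlinarith) hr.le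
      _ = (1 + η) * r := mul_comm _ _
  have hmass : G ((C (N₀ : ℝ) * formV w + C ((σ * j₀ : ℤ) : ℝ)) ^ 2) =
      N₀ ^ 2 * r + 2 * N₀ * j₀ * (σ * G (formV w)) + j₀ ^ 2 := by
    have e : (C (N₀ : ℝ) * formV w + C ((σ * j₀ : ℤ) : ℝ)) ^ 2 =
        ((N₀ : ℝ) ^ 2) • formV w ^ 2 + (2 * N₀ * (σ * j₀ : ℝ)) • formV w
          + ((σ * j₀ : ℝ) ^ 2) • (1 : MvPolynomial (PairVar n) ℝ) := by
      simp only [smul_eq_C_mul, map_mul, map_pow, map_ofNat, Int.cast_mul, Int.cast_natCast]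
      ring
    rw [e, map_add, map_add, map_smul, map_smul, map_smul, h2, hG.one]
    simp only [smul_eq_mul, mul_pow, hσ2]
    ring
  have hmass' : N₀ ^ 2 * r ≤ G ((C (N₀ : ℝ) * formV w + C ((σ * j₀ : ℤ) : ℝ)) ^ 2) := by
    rw [hmass]
    have : 0 ≤ 2 * N₀ * j₀ * (σ * G (formV w)) := by positivity
    nlinarith [sq_nonneg (j₀ : ℝ)]
  refine ⟨σ * j₀, σ * ρ₀, ?_, ?_, hmass', ?_⟩
  · push_cast
    rw [abs_mul, hσa, one_mul, Nat.abs_cast]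
    exact hj2.le
  · rw [mul_pow, hσ2, one_mul]; exact hρr
  · rw [reweight_apply, div_le_iff₀ (lt_of_lt_of_le (by positivity) hmass')]
    -- The point of the extra factor is `(B + ρ)² (B - ρ)² = (B² - ρ²)²`: concentration of the
    -- square becomes concentration of `B` itself at `ρ`.
    have e : (C (N₀ : ℝ) * formV w + C ((σ * j₀ : ℤ) : ℝ)) ^ 2 * (formV w - C ((σ : ℝ) * ρ₀)) ^ 2 =
        ((N₀ : ℝ) ^ 2) • (formV w ^ 4 - (2 * ρ₀ ^ 2) • formV w ^ 2
          + (ρ₀ ^ 4) • (1 : MvPolynomial (PairVar n) ℝ)) := by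
      have hσC : (C (σ : ℝ) : MvPolynomial (PairVar n) ℝ) ^ 2 = 1 := by rw [← map_pow, hσ2, map_one]
      have e1 : C ((σ * j₀ : ℤ) : ℝ) = (C (N₀ : ℝ) * (C (σ : ℝ) * C ρ₀) : MvPolynomial (PairVar n) ℝ) := by
        rw [← map_mul, ← map_mul]
        congr 1
        push_cast
        rw [← hρj]; ring
      rw [e1]
      simp only [smul_eq_C_mul, map_mul, map_pow, map_ofNat]
      linear_combination (C (N₀ : ℝ) ^ 2 * C ρ₀ ^ 4 * (C (σ : ℝ) ^ 2 + 1)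
        - 2 * C (N₀ : ℝ) ^ 2 * C ρ₀ ^ 2 * formV w ^ 2) * hσC
    rw [e, map_smul, map_add, map_sub, map_smul, map_smul, h2, hG.one]
    simp only [smul_eq_mul, mul_one]
    -- What remains to bound is `(G B⁴ - r²) + (r - ρ₀²)²`, at most `η r² + η² r²`.
    have h5 : (r - ρ₀ ^ 2) ^ 2 ≤ (η * r) ^ 2 := by
      refine sq_le_sq' ?_ ?_ <;> nlinarith
    calc (N₀ : ℝ) ^ 2 * (G (formV w ^ 4) - 2 * ρ₀ ^ 2 * r + ρ₀ ^ 4)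
        ≤ N₀ ^ 2 * (2 * η * r ^ 2) := by
          gcongr
          nlinarith [sq_nonneg r]
      _ = 2 * η * r * (N₀ ^ 2 * r) := by ring
      _ ≤ _ := mul_le_mul_of_nonneg_left hmass' (by positivity)

end Existence

/-! ### Existence of a good product of linear forms. -/

section Candidate

open MvPolynomial

variable {n : ℕ} {D : ℕ} {F : MvPolynomial (PairVar n) ℝ →ₗ[ℝ] ℝ}

set_option maxHeartbeats 1000000 in
/-- Some form `⟨w, v⟩` with sparse integral `w` is close to a constant after a reweighting by a power
of it and one more factor. -/
theorem IsSpherePE.exists_fixed {s ℓ D' N₀ : ℕ} (hF : IsSpherePE D F) (hs1 : 1 ≤ s) (hsn : s ≤ n)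
    (hns : n ≤ s ^ 2) (hℓ : n ≤ 2 ^ ℓ) (hN₀ : N₀ = 3456 * s ^ 2)
    (hD : 2 * (s + 128 * s * (7 + ℓ)) + D' + 6 ≤ D) :
    ∃ (w : Fin n → ℤ) (t : ℕ) (j : ℤ) (ρ : ℝ),
      (∀ i, |w i| ≤ s) ∧ (Finset.univ.filter fun i => w i ≠ 0).card ≤ s ∧
      t ≤ s + 128 * s * (7 + ℓ) ∧ |j| ≤ 7000 * s ^ 3 ∧ 1 ≤ ∑ i, (w i : ℝ) ^ 2 ∧
      1 / (72 * s : ℝ) * ∑ i, (w i : ℝ) ^ 2 ≤ ρ ^ 2 ∧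
      (1 / (72 * s) : ℝ) ^ (t + 1) ≤ F ((formV (fun i => (w i : ℝ)) ^ t *
        (C (N₀ : ℝ) * formV (fun i => (w i : ℝ)) + C (j : ℝ))) ^ 2) ∧
      IsSpherePE D' (reweight F (formV (fun i => (w i : ℝ)) ^ t *
        (C (N₀ : ℝ) * formV (fun i => (w i : ℝ)) + C (j : ℝ)))) ∧
      1 / (8 * s : ℝ) ≤ potential (fun i => (w i : ℝ)) ρ
        (reweight F (formV (fun i => (w i : ℝ)) ^ t *
          (C (N₀ : ℝ) * formV (fun i => (w i : ℝ)) + C (j : ℝ)))) + 1 / (4 * s) := by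
  generalize hm : 128 * s * (7 + ℓ) = m at hD ⊢
  have hs0 : (0 : ℝ) < s := by exact_mod_cast hs1
  have hs1' : (1 : ℝ) ≤ s := by exact_mod_cast hs1
  have hn0 : 0 < n := by omega
  have hn0' : (0 : ℝ) < n := by exact_mod_cast hn0
  have hsn' : (s : ℝ) ≤ n := by exact_mod_cast hsn
  have hns' : (n : ℝ) ≤ (s : ℝ) ^ 2 := by exact_mod_cast hns
  have hℓ' : (n : ℝ) ≤ 2 ^ ℓ := by exact_mod_cast hℓ
  obtain ⟨w, hw1, hw2, hw3, hw4, hw5⟩ := hF.exists_sparse (s := s) (by omega) hs1 hsn hns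
  set B := formV (fun i => (w i : ℝ)) with hB
  set ω := ∑ i, (w i : ℝ) ^ 2 with hω
  set θ : ℝ := 1 / (72 * s) with hθ
  have hθ0 : 0 < θ := by positivity
  have hx0 : 0 < ω * θ := by positivity
  have hxθ : θ ≤ ω * θ := by nlinarith
  -- The value of `η` is such that the initial penalty, at most `16 η`, equals half of the offset `1
  -- / (4 s)`.
  set η : ℝ := 1 / (128 * s : ℕ) with hη
  have hη0 : 0 < η := by rw [hη]; push_cast; positivity
  have hη1 : η ≤ 1 := by
    rw [hη, div_le_one (by push_cast; positivity)]; push_cast; linarith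
  have hηe : η * (128 * s) = 1 := by rw [hη]; push_cast; field_simp
  have hθe : θ * (72 * s) = 1 := by rw [hθ]; field_simp
  -- This is where `72 = 4 * 18` comes from: `ω ≤ 4 s`, and the moment of order `2 s` is at least
  -- `18^(-s)`.
  have hx18 : ω * θ ≤ 1 / 18 := by
    have : ω * θ ≤ 4 * s * θ := by gcongr
    linarith
  obtain ⟨t, hst, htm, hft, hxt, hwin⟩ := exists_window
    (f := fun t => F (B ^ (2 * t))) (s := s) (m := m) (x := ω * θ) (ω := ω) (η := η) hs1
    (by simp [hF.one]) hx0 hη0 ((pow_le_pow_left₀ hx0.le hx18 s).trans hw5)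
    (fun t ht => by
      rw [pow_mul']
      exact hF.nonneg_sq _ (by
        have := totalDegree_formV_pow_le (fun i => (w i : ℝ)) t
        rw [← hB] at this; omega))
    (fun t ht => hF.formV_pow_succ_le _ (by omega))
    (fun t ht => hF.formV_logconvex _ (by omega))
    (by
      -- The ratios lie between `ω θ` and `ω`, so they can grow only by the factor `72 s`. The
      -- window has `7 + ℓ` doublings, hence the factor `128 n`.
      have h1 := two_pow_le_one_add_inv_pow (e := 128 * s) (by omega) (7 + ℓ)
      rw [← hη, hm, pow_add] at h1
      have h2 : 72 * s < (1 + η) ^ m := by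
        have : (128 : ℝ) * n ≤ 2 ^ 7 * 2 ^ ℓ := by nlinarith
        linarith
      have h3 := mul_lt_mul_of_pos_left h2 hx0
      have h4 : ω = ω * θ * (72 * s) := by rw [mul_assoc, hθe, mul_one]
      linarith)
  have hftpos : 0 < F (B ^ (2 * t)) := lt_of_lt_of_le (by positivity) hft
  have hBt : (B ^ t) ^ 2 = B ^ (2 * t) := by rw [← pow_mul, mul_comm]
  have hdegt : (B ^ t).totalDegree ≤ t := totalDegree_formV_pow_le _ t
  -- Two degrees are reserved for the factor that selects the sign.
  have hF1 : IsSpherePE (D' + 2) (reweight F (B ^ t)) :=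
    hF.of_reweight (by omega) (by rw [hBt]; exact hftpos)
  set F1 := reweight F (B ^ t) with hF1d
  have hr2 : F1 (B ^ 2) = F (B ^ (2 * (t + 1))) / F (B ^ (2 * t)) := by
    rw [hF1d, reweight_apply, hBt, ← pow_add]; rfl
  have hr4 : F1 (B ^ 4) = F (B ^ (2 * (t + 2))) / F (B ^ (2 * t)) := by
    rw [hF1d, reweight_apply, hBt, ← pow_add]; rfl
  set r := F1 (B ^ 2) with hrd
  have hrx : ω * θ ≤ r := by
    rw [hr2, le_div_iff₀ hftpos]; exact hxt
  have hr0 : 0 < r := lt_of_lt_of_le hx0 hrx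
  have hrω : r ≤ ω := by
    rw [hr2, div_le_iff₀ hftpos]
    exact hF.formV_pow_succ_le _ (by omega)
  have h4 : F1 (B ^ 4) ≤ (1 + η) * r ^ 2 := by
    rw [hr4, hr2, div_pow, ← mul_div_assoc, div_le_div_iff₀ hftpos (by positivity)]
    nlinarith
  have hsqrt : 1 / (9 * s) ≤ √r := by
    apply Real.le_sqrt_of_sq_le
    have : (1 / (9 * s : ℝ)) ^ 2 ≤ θ := by
      rw [hθ, div_pow, div_le_div_iff₀ (by positivity) (by positivity)]
      nlinarith
    linarith
  have hsqrt2 : √r ≤ 2 * s := by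
    apply Real.sqrt_le_iff.mpr
    constructor
    · positivity
    · nlinarith
  -- The choice `N₀ = 3456 s² = 3 * (128 s) * (9 s)` is what `3 / η ≤ N₀ √r` needs, because `√r ≥ 1
  -- / (9 s)`.
  obtain ⟨j, ρ, hj, hρ, hmass, hdev⟩ := hF1.exists_fix (w := fun i => (w i : ℝ)) (r := r) (η := η)
    (N₀ := N₀) hr0 hη0 hη1 hrd.symm h4 (by
      rw [div_le_iff₀ hη0, hN₀]
      push_cast
      have : 384 * (s : ℝ) ≤ 3456 * s ^ 2 * √r := by
        calc 384 * (s : ℝ) = 3456 * s ^ 2 * (1 / (9 * s)) := by field_simp; norm_num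
          _ ≤ _ := by gcongr
      nlinarith)
  rw [← hB] at hmass hdev
  set g := C (N₀ : ℝ) * B + C (j : ℝ) with hg
  have hN0one : (1 : ℝ) ≤ (N₀ : ℝ) ^ 2 := by
    have : 1 ≤ N₀ ^ 2 := Nat.one_le_pow _ _ (by rw [hN₀]; positivity)
    exact_mod_cast this
  have hmass1 : θ ≤ F1 (g ^ 2) := by
    refine le_trans ?_ hmass
    nlinarith
  have hg0 : 0 < F1 (g ^ 2) := lt_of_lt_of_le hθ0 hmass1
  have hgdeg : g.totalDegree ≤ 1 := by
    refine (totalDegree_add _ _).trans (max_le ?_ (by rw [totalDegree_C]; omega))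
    refine (totalDegree_mul _ _).trans ?_
    rw [totalDegree_C, zero_add]
    exact totalDegree_formV_le _
  have hF2 : IsSpherePE D' (reweight F1 g) := hF1.of_reweight (by omega) hg0
  have hρ0 : 0 < ρ ^ 2 := lt_of_lt_of_le hr0 hρ
  have hpot : 1 / (8 * s : ℝ) ≤ potential (fun i => (w i : ℝ)) ρ (reweight F1 g) + 1 / (4 * s) := by
    rw [potential, penalty_apply, ← hB]
    have hX : 0 ≤ normSqU (reweight F1 g) := Finset.sum_nonneg fun i _ => sq_nonneg _
    have h1 : 8 / ρ ^ 2 * reweight F1 g ((B - C ρ) ^ 2) ≤ 16 * η := by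
      rw [div_mul_eq_mul_div, div_le_iff₀ hρ0]
      nlinarith
    have h2 : 16 * η = 1 / (8 * s) := by rw [hη]; push_cast; field_simp; norm_num
    have h3 : (1 : ℝ) / (4 * s) = 1 / (8 * s) + 1 / (8 * s) := by field_simp; norm_num
    linarith
  have hBg : F (B ^ (2 * t)) * F1 (g ^ 2) = F ((B ^ t * g) ^ 2) := by
    rw [hF1d, reweight_apply, hBt, mul_pow, hBt]
    field_simp
  have hF12 : reweight F1 g = reweight F (B ^ t * g) := by
    rw [hF1d, reweight_reweight _ _ _ (by rw [hBt]; exact hftpos.ne')]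
  rw [hF12] at hF2 hpot
  refine ⟨w, t, j, ρ, hw1, hw2, by omega, ?_, hw3, by linarith, ?_, hF2, hpot⟩
  · have h1 : |(j : ℝ)| ≤ 7000 * s ^ 3 := by
      refine hj.trans ?_
      rw [hN₀]
      push_cast
      have h2 : (1 : ℝ) ≤ s ^ 3 := one_le_pow₀ hs1'
      nlinarith [mul_le_mul_of_nonneg_left hsqrt2 (by positivity : (0 : ℝ) ≤ 3456 * s ^ 2)]
    have h2 : ((|j| : ℤ) : ℝ) ≤ ((7000 * s ^ 3 : ℤ) : ℝ) := by push_cast; exact h1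
    exact_mod_cast h2
  · rw [← hBg, pow_succ]
    refine mul_le_mul ?_ hmass1 hθ0.le hftpos.le
    exact le_trans (pow_le_pow_left₀ hθ0.le hxθ t) hft

/-- Some product of boundedly many integral linear forms from a small explicit class gives a
reweighting for which the cross-covariance is small. -/
theorem IsSpherePE.exists_candidate {s ℓ N N₀ : ℕ} (hF : IsSpherePE D F) (hs1 : 1 ≤ s) (hsn : s ≤ n)
    (hns : n ≤ s ^ 2) (hℓ : n ≤ 2 ^ ℓ) (hN : 1 ≤ N) (hN₀ : N₀ = 3456 * s ^ 2)
    (hD : 2 * (s + 128 * s * (7 + ℓ) + 92160 * s * N ^ 2 * (5 + ℓ)) + 10 ≤ D) :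
    ∃ (w : Fin n → ℤ) (t : ℕ) (j : ℤ) (steps : List (PairVar n × ℤ)),
      (∀ i, |w i| ≤ s) ∧ (Finset.univ.filter fun i => w i ≠ 0).card ≤ s ∧
      t ≤ s + 128 * s * (7 + ℓ) ∧ |j| ≤ 7000 * s ^ 3 ∧
      steps.length ≤ 92160 * s * N ^ 2 * (5 + ℓ) ∧ (∀ p ∈ steps, |p.2| ≤ 2 * n) ∧
      (1 / (72 * s) : ℝ) ^ (t + 1) ≤ F ((formV (fun i => (w i : ℝ)) ^ t *
        (C (N₀ : ℝ) * formV (fun i => (w i : ℝ)) + C (j : ℝ)) *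
          (steps.map stepFactor).prod) ^ 2) ∧
      IsNearlyProduct (1 / (4 * (N : ℝ) ^ 2)) (1 / (1152 * s ^ 2))
        (reweight F (formV (fun i => (w i : ℝ)) ^ t *
          (C (N₀ : ℝ) * formV (fun i => (w i : ℝ)) + C (j : ℝ)) *
            (steps.map stepFactor).prod)) := by
  generalize hT : 92160 * s * N ^ 2 * (5 + ℓ) = T at hD ⊢
  have hs0 : (0 : ℝ) < s := by exact_mod_cast hs1
  have hs1' : (1 : ℝ) ≤ s := by exact_mod_cast hs1
  have hN' : (1 : ℝ) ≤ N := by exact_mod_cast hN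
  have hn0 : 0 < n := by omega
  have hsn' : (s : ℝ) ≤ n := by exact_mod_cast hsn
  have hns' : (n : ℝ) ≤ (s : ℝ) ^ 2 := by exact_mod_cast hns
  have hℓ' : (n : ℝ) ≤ 2 ^ ℓ := by exact_mod_cast hℓ
  obtain ⟨w, t, j, ρ, hw1, hw2, ht, hj, hω1, hρ, hmass, hF2, hpot⟩ :=
    hF.exists_fixed (D' := 2 * T + 4) hs1 hsn hns hℓ hN₀ (by omega)
  generalize hg : formV (fun i => (w i : ℝ)) ^ t *
    (C (N₀ : ℝ) * formV (fun i => (w i : ℝ)) + C (j : ℝ)) = g at hmass hF2 hpot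
  generalize hω : ∑ i, (w i : ℝ) ^ 2 = ω at hω1 hρ
  generalize hθ : 1 / (72 * s : ℝ) = θ at hρ hmass
  have hθ0 : 0 < θ := by rw [← hθ]; positivity
  have hg0 : 0 < F (g ^ 2) := lt_of_lt_of_le (by positivity) hmass
  -- The growth rate is the inverse of the integer `92160 s N²`, with `92160 = 72 * 1280`; the
  -- number of steps is `5 + ℓ` times this integer.
  have hκ : θ / (1280 * (N : ℝ) ^ 2) = 1 / ((92160 * s * N ^ 2 : ℕ) : ℝ) := by
    rw [← hθ]; push_cast; field_simp; norm_num
  have ha0 : (0 : ℝ) < 1 / (4 * s) := by positivity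
  obtain ⟨steps, hl, hb, hm1, hres⟩ := exists_steps hn0 (w := fun i => (w i : ℝ)) (ρ := ρ) (θ := θ)
    (a := 1 / (4 * s)) (N := N) (by rw [hω]; linarith) hθ0
    (by rw [hω]; exact hρ) ha0
    (by rw [div_le_div_iff₀ (by positivity) (by norm_num)]; linarith) hN'
    (by
      rw [hκ]; push_cast
      rw [show 2 * (1 / (4 * (s : ℝ))) * (1 / (92160 * s * N ^ 2)) =
        1 / (184320 * s ^ 2 * N ^ 2) by field_simp; norm_num]
      have h1 : (160 : ℝ) * n ≤ 160 * s ^ 2 * N ^ 2 := by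
        have : (1 : ℝ) ≤ N ^ 2 := by nlinarith
        nlinarith [sq_nonneg (s : ℝ)]
      exact one_div_le_one_div_of_le (by positivity) (by nlinarith [sq_nonneg ((s : ℝ) * N)])) T _ hF2
    (lt_of_lt_of_le (by positivity) hpot)
    (by
      have h1 := two_pow_le_one_add_inv_pow (e := 92160 * s * N ^ 2)
        (by have : 1 ≤ N ^ 2 := Nat.one_le_pow _ _ hN
            nlinarith) (5 + ℓ)
      rw [hT, ← hκ, pow_add] at h1
      -- The sum of the potential and the offset starts at `1 / (8 s)` at least; the factor `32 s`
      -- lifts it above 2.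
      have h2 : 32 * (s : ℝ) ≤ (1 + θ / (1280 * (N : ℝ) ^ 2)) ^ T := by
        have : (32 : ℝ) * n ≤ 2 ^ 5 * 2 ^ ℓ := by linarith
        linarith
      calc (2 : ℝ) < 32 * s * (1 / (8 * s)) := by field_simp; norm_num
        _ ≤ _ := mul_le_mul h2 hpot (by positivity) (by positivity))
  rw [reweight_reweight _ _ _ hg0.ne'] at hres
  rw [reweight_apply, ← mul_pow, le_div_iff₀ hg0, one_mul] at hm1
  refine ⟨w, t, j, steps, hw1, hw2, ht, hj, hl, hb, ?_, ?_⟩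
  · rw [hg]
    exact hmass.trans hm1
  · rw [hg]
    convert hres using 1
    -- The threshold `a θ / 4` with `a = 1 / (4 s)` and `θ = 1 / (72 s)` is `1 / (1152 s²)`.
    rw [← hθ]; field_simp; norm_num

end Candidate

namespace LogCost

/-! ### A language of total functional expressions and its compilation -/

/-- Binary operations. -/
inductive BinOp : Type
  | add
  | sub
  | mul
  | div
  | lt

/-- The program expression for a binary operation. -/
def BinOp.expr : BinOp → Expr → Expr → Expr
  | add => Expr.add
  | sub => Expr.sub
  | mul => Expr.mul
  | div => Expr.div
  | lt => Expr.lt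

/-- The value of a binary operation. -/
def BinOp.eval : BinOp → ℤ → ℤ → ℤ
  | add, a, b => a + b
  | sub, a, b => a - b
  | mul, a, b => a * b
  | div, a, b => a / b
  | lt, a, b => if a < b then 1 else 0

/-- Functional expressions with named integer variables. `fold o x i b e` combines by `o` the values
of `e` for `x = 0, …, b - 1`, starting from `i`; `query x l t e` asks the oracle, with precision `t`,
about the list of the values of `e` for `x = 0, …, l - 1`. -/
inductive FExpr : Type
  | const (z : ℤ)
  | var (x : ℕ)
  | bin (o : BinOp) (a b : FExpr)
  | fold (o : BinOp) (x : ℕ) (i b e : FExpr)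
  | letE (x : ℕ) (a e : FExpr)
  | query (x : ℕ) (l t e : FExpr)

/-- Fold of a sequence by a binary operation. -/
def BinOp.acc (o : BinOp) (i : ℤ) (f : ℕ → ℤ) : ℕ → ℤ
  | 0 => i
  | k + 1 => o.eval (o.acc i f k) (f k)

/-- The value of a functional expression. -/
def FExpr.val (O : Oracle) : FExpr → (ℕ → ℤ) → ℤ
  | const z, _ => z
  | var x, s => s x
  | bin o a b, s => o.eval (a.val O s) (b.val O s)
  | fold o x i b e, s =>
      o.acc (i.val O s) (fun k => e.val O (Function.update s x k)) (b.val O s).toNat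
  | letE x a e, s => e.val O (Function.update s x (a.val O s))
  | query x l t e, s =>
      O (List.ofFn fun j : Fin (l.val O s).toNat => e.val O (Function.update s x (j : ℕ)))
        (t.val O s).toNat

/-- The cost of comparing the loop counter with its bound. -/
def guardCost (k : ℕ) (b : ℤ) : ℕ := 4 + 2 * bits k + 2 * bits b

/-- The cost of incrementing the loop counter. -/
def incCost (k : ℕ) : ℕ := 8 + 2 * bits k + bits (k + 1)

/-- The running time of the compiled expression. -/
def FExpr.time (O : Oracle) : FExpr → (ℕ → ℤ) → ℕ
  | const z, _ => 2 + 2 * bits z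
  | var x, s => 4 + 2 * bits (s x)
  | bin o a b, s => a.time O s + b.time O s
      + (6 + 2 * bits (a.val O s) + 2 * bits (b.val O s) + bits (o.eval (a.val O s) (b.val O s)))
  | fold o x i b e, s => i.time O s + b.time O s + 4
      + ∑ k ∈ Finset.range (b.val O s).toNat,
        (guardCost k (b.val O s) + (e.time O (Function.update s x k) +
          (6 + 2 * bits (o.acc (i.val O s) (fun k => e.val O (Function.update s x k)) k)
            + 2 * bits (e.val O (Function.update s x k))
            + bits (o.acc (i.val O s) (fun k => e.val O (Function.update s x k)) (k + 1)))
          + incCost k))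
      + guardCost (b.val O s).toNat (b.val O s)
  | letE x a e, s => a.time O s + e.time O (Function.update s x (a.val O s))
      + (4 + 2 * bits (e.val O (Function.update s x (a.val O s))))
  | query x l t e, s => l.time O s + t.time O s + 4
      + ∑ k ∈ Finset.range (l.val O s).toNat,
        (guardCost k (l.val O s) + (e.time O (Function.update s x k) +
          (4 + 2 * bits k + 2 * bits (e.val O (Function.update s x k))) + incCost k))
      + guardCost (l.val O s).toNat (l.val O s)
      + (4 + bits (l.val O s) + bits (t.val O s)
        + ((List.ofFn fun j : Fin (l.val O s).toNat =>
            e.val O (Function.update s x (j : ℕ))).map bits).sum + (t.val O s).toNat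
        + bits ((query x l t e).val O s))

/-- The content of cell `0` of an array. -/
def cell (a : ℕ) : Expr := .load a (.const 0)

/-- Write the value of an expression into cell `0` of an array. -/
def assign (a : ℕ) (e : Expr) : Prog := .store a (.const 0) e

/-- Increment cell `0` of an array. -/
def incr (a : ℕ) : Prog := assign a (.add (cell a) (.const 1))

/-- The program that computes the value of an expression into cell `0` of array `m`. The variable `x`
is kept in cell `0` of array `ρ x`; only arrays from `m` on are overwritten. -/
def FExpr.compile : FExpr → (ℕ → ℕ) → ℕ → Prog
  | const z, _, m => assign m (.const z)
  | var x, ρ, m => assign m (cell (ρ x))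
  | bin o a b, ρ, m => .seq (a.compile ρ m) (.seq (b.compile ρ (m + 1))
      (assign m (o.expr (cell m) (cell (m + 1)))))
  | fold o x i b e, ρ, m => .seq (i.compile ρ m) (.seq (b.compile ρ (m + 1))
      (.seq (assign (m + 2) (.const 0))
        (.loop (.lt (cell (m + 2)) (cell (m + 1)))
          (.seq (e.compile (Function.update ρ x (m + 2)) (m + 3))
            (.seq (assign m (o.expr (cell m) (cell (m + 3)))) (incr (m + 2)))))))
  | letE x a e, ρ, m => .seq (a.compile ρ (m + 1))
      (.seq (e.compile (Function.update ρ x (m + 1)) (m + 2)) (assign m (cell (m + 2))))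
  | query x l t e, ρ, m => .seq (l.compile ρ (m + 1)) (.seq (t.compile ρ (m + 2))
      (.seq (assign (m + 3) (.const 0))
        (.seq (.loop (.lt (cell (m + 3)) (cell (m + 1)))
          (.seq (e.compile (Function.update ρ x (m + 3)) (m + 5))
            (.seq (.store (m + 4) (cell (m + 3)) (cell (m + 5))) (incr (m + 3)))))
          (.query (m + 4) (cell (m + 1)) (cell (m + 2)) m))))

theorem cell_val (s : Store) (a : ℕ) : (cell a).val s = s a 0 := rfl

theorem bits_zero : bits 0 = 1 := rfl

theorem bits_one : bits 1 = 2 := rfl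

theorem cell_cost (s : Store) (a : ℕ) : (cell a).cost s = 2 + bits (s a 0) := by
  simp [cell, Expr.cost, Expr.val, bits_zero]

theorem BinOp.expr_val (o : BinOp) (a b : Expr) (s : Store) :
    (o.expr a b).val s = o.eval (a.val s) (b.val s) := by
  cases o <;> rfl

theorem BinOp.expr_cost (o : BinOp) (a b : Expr) (s : Store) :
    (o.expr a b).cost s = a.cost s + b.cost s + bits (a.val s) + bits (b.val s) := by
  cases o <;> rfl

theorem write_same (s : Store) (a i : ℕ) (z : ℤ) : s.write a i z a i = z := by
  simp [Store.write]

theorem write_array_ne (s : Store) {a b : ℕ} (i : ℕ) (z : ℤ) (h : b ≠ a) :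
    s.write a i z b = s b := by
  simp [Store.write, h]

theorem write_cell_ne (s : Store) (a : ℕ) {i j : ℕ} (z : ℤ) (h : j ≠ i) :
    s.write a i z a j = s a j := by
  simp [Store.write, h]

theorem exec_assign (O : Oracle) (a : ℕ) (e : Expr) (s : Store) :
    Exec O (assign a e) s (s.write a 0 (e.val s)) (2 + e.cost s + bits (e.val s)) := by
  have h := Exec.store (O := O) a (.const 0) e s
  have e1 : (Expr.const 0).cost s + e.cost s + bits ((Expr.const 0).val s) + bits (e.val s) =
      2 + e.cost s + bits (e.val s) := by
    simp only [Expr.cost, Expr.val, bits_zero]; ring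
  rw [e1] at h
  exact h

theorem exec_incr (O : Oracle) (a k : ℕ) (s : Store) (h : s a 0 = k) :
    Exec O (incr a) s (s.write a 0 ((k + 1 : ℕ) : ℤ)) (incCost k) := by
  have h1 := exec_assign O a (.add (cell a) (.const 1)) s
  have e1 : (Expr.add (cell a) (.const 1)).val s = ((k + 1 : ℕ) : ℤ) := by
    simp [Expr.val, cell_val, h]
  have e2 : 2 + (Expr.add (cell a) (.const 1)).cost s
      + bits ((Expr.add (cell a) (.const 1)).val s) = incCost k := by
    rw [e1]
    simp only [Expr.cost, cell_cost, cell_val, h, Expr.val, bits_one, incCost]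
    push_cast
    ring
  rw [e2, e1] at h1
  exact h1

theorem Exec.of_eq {O : Oracle} {c : Prog} {s s' : Store} {t t' : ℕ} (h : Exec O c s s' t)
    (e : t = t') : Exec O c s s' t' := e ▸ h

/-- A loop whose body re-establishes an invariant indexed by the number of iterations. -/
theorem exec_loop (O : Oracle) (e : Expr) (c : Prog) (B : ℕ) (I : ℕ → Store → Prop) (γ τ : ℕ → ℕ)
    (hstep : ∀ k < B, ∀ s, I k s → e.val s ≠ 0 ∧ e.cost s = γ k ∧
      ∃ s', Exec O c s s' (τ k) ∧ I (k + 1) s')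
    (hend : ∀ s, I B s → e.val s = 0 ∧ e.cost s = γ B) (s : Store) (h0 : I 0 s) :
    ∃ s', Exec O (.loop e c) s s' (∑ k ∈ Finset.range B, (γ k + τ k) + γ B) ∧ I B s' := by
  -- Induction on the number `j` of iterations that remain.
  have key : ∀ j k, k + j = B → ∀ s, I k s →
      ∃ s', Exec O (.loop e c) s s' (∑ i ∈ Finset.range j, (γ (k + i) + τ (k + i)) + γ B) ∧
        I B s' := by
    intro j
    induction j with
    | zero =>
      intro k hk s hs
      obtain rfl : k = B := by omega
      obtain ⟨h1, h2⟩ := hend s hs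
      refine ⟨s, ?_, hs⟩
      have := Exec.loop_done (O := O) e c s h1
      rw [h2] at this
      simpa using this
    | succ j ih =>
      intro k hk s hs
      obtain ⟨h1, h2, s', h3, h4⟩ := hstep k (by omega) s hs
      obtain ⟨s'', h5, h6⟩ := ih (k + 1) (by omega) s' h4
      refine ⟨s'', ?_, h6⟩
      have := Exec.loop_step (O := O) e c s s' s'' _ _ h1 h3 h5
      convert this using 1
      rw [Finset.sum_range_succ', h2]
      rw [Finset.sum_congr rfl fun i _ => by rw [show k + (i + 1) = k + 1 + i by ring]]
      rw [add_zero]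
      ring
  obtain ⟨s', h1, h2⟩ := key B 0 (by simp) s h0
  exact ⟨s', by simpa using h1, h2⟩

theorem guard_spec {s : Store} {c b k : ℕ} {z : ℤ} (hc : s c 0 = k) (hb : s b 0 = z) :
    (Expr.lt (cell c) (cell b)).cost s = guardCost k z ∧
      (k < z.toNat → (Expr.lt (cell c) (cell b)).val s ≠ 0) ∧
      (k = z.toNat → (Expr.lt (cell c) (cell b)).val s = 0) := by
  refine ⟨?_, ?_, ?_⟩
  · change (cell c).cost s + (cell b).cost s + bits (s c 0) + bits (s b 0) = _
    rw [cell_cost, cell_cost, hc, hb]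
    unfold guardCost
    ring
  · intro h
    have : (k : ℤ) < z := by omega
    show (if s c 0 < s b 0 then (1 : ℤ) else 0) ≠ 0
    rw [hc, hb, if_pos this]; exact one_ne_zero
  · intro h
    have : ¬ (k : ℤ) < z := by omega
    show (if s c 0 < s b 0 then (1 : ℤ) else 0) = 0
    rw [hc, hb, if_neg this]

/-- The store `s` holds the variables `env` in the arrays `ρ x < m`. -/
def Holds (ρ : ℕ → ℕ) (m : ℕ) (s : Store) (env : ℕ → ℤ) : Prop :=
  ∀ x, ρ x < m ∧ s (ρ x) 0 = env x

theorem Holds.frame {ρ : ℕ → ℕ} {m m' : ℕ} {s s' : Store} {env : ℕ → ℤ} (h : Holds ρ m s env)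
    (hm : m ≤ m') (hs : ∀ a < m, s' a = s a) : Holds ρ m' s' env :=
  fun x => ⟨(h x).1.trans_le hm, by rw [hs _ (h x).1]; exact (h x).2⟩

theorem Holds.update {ρ : ℕ → ℕ} {m m' c : ℕ} {s s' : Store} {env : ℕ → ℤ} {z : ℤ} (x : ℕ)
    (h : Holds ρ m s env) (hm : m ≤ m') (hc : c < m') (hs : ∀ a < m, s' a = s a)
    (hz : s' c 0 = z) : Holds (Function.update ρ x c) m' s' (Function.update env x z) := by
  intro y
  rcases eq_or_ne y x with rfl | hy
  · simpa using ⟨hc, hz⟩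
  · simpa [hy] using h.frame hm hs y

/-- The frame clause drives the induction. Variables live below `m` and a subexpression writes only
from its own base on, so results already stored at `m`, `m + 1`, … survive the evaluation of later
subexpressions. -/
theorem FExpr.compile_spec (O : Oracle) (e : FExpr) :
    ∀ (ρ : ℕ → ℕ) (m : ℕ) (s : Store) (env : ℕ → ℤ), Holds ρ m s env →
      ∃ s', Exec O (e.compile ρ m) s s' (e.time O env) ∧ s' m 0 = e.val O env ∧
        ∀ a < m, s' a = s a := by
  induction e with
  | const z =>
    intro ρ m s env _
    refine ⟨_, (exec_assign O m (.const z) s).of_eq ?_, write_same _ _ _ _,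
      fun a ha => write_array_ne _ _ _ (by omega)⟩
    simp only [FExpr.time, Expr.cost, Expr.val]; ring
  | var x =>
    intro ρ m s env h
    have := exec_assign O m (cell (ρ x)) s
    rw [cell_cost, cell_val, (h x).2] at this
    refine ⟨_, this.of_eq ?_, write_same _ _ _ _, fun a ha => write_array_ne _ _ _ (by omega)⟩
    simp only [FExpr.time]; ring
  | bin o a b iha ihb =>
    intro ρ m s env h
    obtain ⟨s1, h1, v1, f1⟩ := iha ρ m s env h
    obtain ⟨s2, h2, v2, f2⟩ := ihb ρ (m + 1) s1 env (h.frame (by omega) f1)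
    have h3 := exec_assign O m (o.expr (cell m) (cell (m + 1))) s2
    have v3 : s2 m 0 = a.val O env := by rw [f2 m (by omega)]; exact v1
    rw [BinOp.expr_cost, BinOp.expr_val, cell_cost, cell_cost, cell_val, cell_val, v2, v3] at h3
    refine ⟨_, (Exec.seq _ _ _ _ _ _ _ h1 (Exec.seq _ _ _ _ _ _ _ h2 h3)).of_eq ?_,
      write_same _ _ _ _, fun c hc => ?_⟩
    · simp only [FExpr.time]; ring
    · rw [write_array_ne _ _ _ (by omega), f2 c (by omega), f1 c hc]
  | fold o x i b e ihi ihb ihe =>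
    intro ρ m s env h
    obtain ⟨s1, h1, v1, f1⟩ := ihi ρ m s env h
    obtain ⟨s2, h2, v2, f2⟩ := ihb ρ (m + 1) s1 env (h.frame (by omega) f1)
    have h3 := exec_assign O (m + 2) (.const 0) s2
    simp only [Expr.cost, Expr.val, bits_zero] at h3
    set f : ℕ → ℤ := fun k => e.val O (Function.update env x k) with hf
    set B := (b.val O env).toNat with hB
    obtain ⟨s4, h4, i4⟩ := exec_loop O (.lt (cell (m + 2)) (cell (m + 1)))
      (.seq (e.compile (Function.update ρ x (m + 2)) (m + 3))
        (.seq (assign m (o.expr (cell m) (cell (m + 3)))) (incr (m + 2)))) B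
      -- Loop invariant: the partial fold is in `m`, the bound in `m + 1`, the counter in `m + 2`;
      -- the body works from `m + 3` on.
      (fun k t => t m 0 = o.acc (i.val O env) f k ∧ t (m + 1) 0 = b.val O env ∧
        t (m + 2) 0 = k ∧ ∀ a < m, t a = s a)
      (fun k => guardCost k (b.val O env))
      (fun k => e.time O (Function.update env x k) +
          (6 + 2 * bits (o.acc (i.val O env) f k) + 2 * bits (f k)
            + bits (o.acc (i.val O env) f (k + 1))) + incCost k)
      (by
        rintro k hk t ⟨t1, t2, t3, t4⟩
        obtain ⟨g1, g2, _⟩ := guard_spec t3 t2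
        refine ⟨g2 hk, g1, ?_⟩
        obtain ⟨u1, e1, w1, p1⟩ := ihe (Function.update ρ x (m + 2)) (m + 3) t
          (Function.update env x k) (h.update x (by omega) (by omega) t4 t3)
        have e2 := exec_assign O m (o.expr (cell m) (cell (m + 3))) u1
        have w2 : u1 m 0 = o.acc (i.val O env) f k := by rw [p1 m (by omega)]; exact t1
        rw [BinOp.expr_cost, BinOp.expr_val, cell_cost, cell_cost, cell_val, cell_val, w1, w2] at e2
        set u2 := u1.write m 0 (o.eval (o.acc (i.val O env) f k)
          (e.val O (Function.update env x k))) with hu2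
        have w3 : u2 (m + 2) 0 = k := by
          rw [hu2, write_array_ne _ _ _ (by omega), p1 _ (by omega)]; exact t3
        have e3 := exec_incr O (m + 2) k u2 w3
        refine ⟨_, (Exec.seq _ _ _ _ _ _ _ e1 (Exec.seq _ _ _ _ _ _ _ e2 e3)).of_eq ?_,
          ?_, ?_, ?_, ?_⟩
        · simp only [hf, BinOp.acc]; ring
        · rw [write_array_ne _ _ _ (by omega), hu2, write_same]; rfl
        · rw [write_array_ne _ _ _ (by omega), hu2, write_array_ne _ _ _ (by omega),
            p1 _ (by omega)]
          exact t2
        · exact write_same _ _ _ _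
        · intro a ha
          rw [write_array_ne _ _ _ (by omega), hu2, write_array_ne _ _ _ (by omega),
            p1 _ (by omega)]
          exact t4 a ha)
      (by
        rintro t ⟨_, t2, t3, _⟩
        obtain ⟨g1, _, g3⟩ := guard_spec t3 t2
        exact ⟨g3 rfl, g1⟩)
      (s2.write (m + 2) 0 0)
      ⟨by rw [write_array_ne _ _ _ (by omega), f2 _ (by omega)]; exact v1,
        by rw [write_array_ne _ _ _ (by omega)]; exact v2,
        by rw [write_same]; rfl,
        fun a ha => by rw [write_array_ne _ _ _ (by omega), f2 _ (by omega), f1 _ ha]⟩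
    refine ⟨s4, (Exec.seq _ _ _ _ _ _ _ h1 (Exec.seq _ _ _ _ _ _ _ h2
      (Exec.seq _ _ _ _ _ _ _ h3 h4))).of_eq ?_, i4.1, i4.2.2.2⟩
    simp only [FExpr.time]
    ring
  | letE x a e iha ihe =>
    intro ρ m s env h
    obtain ⟨s1, h1, v1, f1⟩ := iha ρ (m + 1) s env (h.frame (by omega) fun _ _ => rfl)
    obtain ⟨s2, h2, v2, f2⟩ := ihe (Function.update ρ x (m + 1)) (m + 2) s1
      (Function.update env x (a.val O env))
      (h.update x (by omega) (by omega) (fun c hc => f1 c (by omega)) v1)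
    have h3 := exec_assign O m (cell (m + 2)) s2
    rw [cell_cost, cell_val, v2] at h3
    refine ⟨_, (Exec.seq _ _ _ _ _ _ _ h1 (Exec.seq _ _ _ _ _ _ _ h2 h3)).of_eq ?_,
      write_same _ _ _ _, fun c hc => ?_⟩
    · simp only [FExpr.time]; ring
    · rw [write_array_ne _ _ _ (by omega), f2 c (by omega), f1 c (by omega)]
  | query x l t e ihl iht ihe =>
    intro ρ m s env h
    obtain ⟨s1, h1, v1, f1⟩ := ihl ρ (m + 1) s env (h.frame (by omega) fun _ _ => rfl)
    obtain ⟨s2, h2, v2, f2⟩ := iht ρ (m + 2) s1 env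
      (h.frame (by omega) fun c hc => f1 c (by omega))
    have h3 := exec_assign O (m + 3) (.const 0) s2
    simp only [Expr.cost, Expr.val, bits_zero] at h3
    set f : ℕ → ℤ := fun k => e.val O (Function.update env x k) with hf
    set B := (l.val O env).toNat with hB
    obtain ⟨s4, h4, i1, i2, i3, i4, i5⟩ := exec_loop O (.lt (cell (m + 3)) (cell (m + 1)))
      (.seq (e.compile (Function.update ρ x (m + 3)) (m + 5))
        (.seq (.store (m + 4) (cell (m + 3)) (cell (m + 5))) (incr (m + 3)))) B
      -- Loop invariant: array `m + 4` holds the first `k` entries of the question, while the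
      -- length, the precision and the counter are in `m + 1`, `m + 2` and `m + 3`.
      (fun k u => (∀ j < k, u (m + 4) j = f j) ∧ u (m + 1) 0 = l.val O env ∧
        u (m + 2) 0 = t.val O env ∧ u (m + 3) 0 = k ∧ ∀ a < m, u a = s a)
      (fun k => guardCost k (l.val O env))
      (fun k => e.time O (Function.update env x k) +
          (4 + 2 * bits k + 2 * bits (f k)) + incCost k)
      (by
        rintro k hk u ⟨t1, t2, t2', t3, t4⟩
        obtain ⟨g1, g2, _⟩ := guard_spec t3 t2
        refine ⟨g2 hk, g1, ?_⟩
        obtain ⟨u1, e1, w1, p1⟩ := ihe (Function.update ρ x (m + 3)) (m + 5) u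
          (Function.update env x k) (h.update x (by omega) (by omega) t4 t3)
        have e2 := Exec.store (O := O) (m + 4) (cell (m + 3)) (cell (m + 5)) u1
        have w2 : u1 (m + 3) 0 = k := by rw [p1 _ (by omega)]; exact t3
        rw [cell_cost, cell_cost, cell_val, cell_val, w1, w2, Int.toNat_natCast] at e2
        set u2 := u1.write (m + 4) k (e.val O (Function.update env x k)) with hu2
        have w3 : u2 (m + 3) 0 = k := by
          rw [hu2, write_array_ne _ _ _ (by omega)]; exact w2
        have e3 := exec_incr O (m + 3) k u2 w3
        refine ⟨_, (Exec.seq _ _ _ _ _ _ _ e1 (Exec.seq _ _ _ _ _ _ _ e2 e3)).of_eq ?_,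
          ?_, ?_, ?_, ?_, ?_⟩
        · simp only [hf]; ring
        · intro j hj
          rw [write_array_ne _ _ _ (by omega), hu2]
          rcases eq_or_ne j k with rfl | hjk
          · rw [write_same]
          · rw [write_cell_ne _ _ _ hjk, p1 _ (by omega)]
            exact t1 j (by omega)
        · rw [write_array_ne _ _ _ (by omega), hu2, write_array_ne _ _ _ (by omega),
            p1 _ (by omega)]
          exact t2
        · rw [write_array_ne _ _ _ (by omega), hu2, write_array_ne _ _ _ (by omega),
            p1 _ (by omega)]
          exact t2'
        · exact write_same _ _ _ _
        · intro a ha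
          rw [write_array_ne _ _ _ (by omega), hu2, write_array_ne _ _ _ (by omega),
            p1 _ (by omega)]
          exact t4 a ha)
      (by
        rintro u ⟨_, t2, _, t3, _⟩
        obtain ⟨g1, _, g3⟩ := guard_spec t3 t2
        exact ⟨g3 rfl, g1⟩)
      (s2.write (m + 3) 0 0)
      ⟨by intro j hj; omega,
        by rw [write_array_ne _ _ _ (by omega), f2 _ (by omega)]; exact v1,
        by rw [write_array_ne _ _ _ (by omega)]; exact v2,
        by rw [write_same]; rfl,
        fun a ha => by rw [write_array_ne _ _ _ (by omega), f2 _ (by omega), f1 _ (by omega)]⟩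
    have hq : (List.ofFn fun j : Fin B => e.val O (Function.update env x (j : ℕ))) =
        List.ofFn fun j : Fin B => s4 (m + 4) j := by
      congr 1
      funext j
      exact (i1 j j.2).symm
    have h5 := Exec.query (O := O) (m + 4) (cell (m + 1)) (cell (m + 2)) m s4
      (List.ofFn fun j : Fin B => e.val O (Function.update env x (j : ℕ)))
      ((FExpr.query x l t e).val O env) (by rw [hq, cell_val, i2]; rfl) (by
        rw [cell_val, i3]; rfl)
    rw [cell_cost, cell_cost, cell_val, i2, i3] at h5
    refine ⟨_, (Exec.seq _ _ _ _ _ _ _ h1 (Exec.seq _ _ _ _ _ _ _ h2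
        (Exec.seq _ _ _ _ _ _ _ h3 (Exec.seq _ _ _ _ _ _ _ h4 h5)))).of_eq ?_,
      write_same _ _ _ _, fun a ha => ?_⟩
    · simp only [FExpr.time]
      ring
    · rw [write_array_ne _ _ _ (by omega)]
      exact i5 a ha

/-- Write the values of `e` for `x = 0, …, b - 1` into the cells of array `a`. -/
def fill (a x : ℕ) (b e : FExpr) (ρ : ℕ → ℕ) (m : ℕ) : Prog :=
  .seq (b.compile ρ m) (.seq (assign (m + 1) (.const 0))
    (.loop (.lt (cell (m + 1)) (cell m))
      (.seq (e.compile (Function.update ρ x (m + 1)) (m + 2))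
        (.seq (.store a (cell (m + 1)) (cell (m + 2))) (incr (m + 1))))))

/-- The running time of `fill`. -/
def fillTime (O : Oracle) (x : ℕ) (b e : FExpr) (env : ℕ → ℤ) : ℕ :=
  b.time O env + 4
      + ∑ k ∈ Finset.range (b.val O env).toNat,
        (guardCost k (b.val O env) + (e.time O (Function.update env x k) +
          (4 + 2 * bits k + 2 * bits (e.val O (Function.update env x k))) + incCost k))
      + guardCost (b.val O env).toNat (b.val O env)

/-- The target array lies below the workspace but holds no variable, so writing into it does not
change the values still to be computed. -/
theorem fill_spec (O : Oracle) (a x : ℕ) (b e : FExpr) (ρ : ℕ → ℕ) (m : ℕ) (s : Store)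
    (env : ℕ → ℤ) (h : Holds ρ m s env) (ha : a < m) (hρ : ∀ y, ρ y ≠ a) :
    ∃ s', Exec O (fill a x b e ρ m) s s' (fillTime O x b e env) ∧
      (∀ k < (b.val O env).toNat, s' a k = e.val O (Function.update env x k)) ∧
      ∀ c < m, c ≠ a → s' c = s c := by
  obtain ⟨s2, h2, v2, f2⟩ := b.compile_spec O ρ m s env h
  have h3 := exec_assign O (m + 1) (.const 0) s2
  simp only [Expr.cost, Expr.val, bits_zero] at h3
  set f : ℕ → ℤ := fun k => e.val O (Function.update env x k) with hf
  set B := (b.val O env).toNat with hB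
  obtain ⟨s4, h4, i1, i2, i3, i4⟩ := exec_loop O (.lt (cell (m + 1)) (cell m))
    (.seq (e.compile (Function.update ρ x (m + 1)) (m + 2))
      (.seq (.store a (cell (m + 1)) (cell (m + 2))) (incr (m + 1)))) B
    (fun k u => (∀ j < k, u a j = f j) ∧ u m 0 = b.val O env ∧
      u (m + 1) 0 = k ∧ ∀ c < m, c ≠ a → u c = s c)
    (fun k => guardCost k (b.val O env))
    (fun k => e.time O (Function.update env x k) +
        (4 + 2 * bits k + 2 * bits (f k)) + incCost k)
    (by
      rintro k hk u ⟨t1, t2, t3, t4⟩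
      obtain ⟨g1, g2, _⟩ := guard_spec t3 t2
      refine ⟨g2 hk, g1, ?_⟩
      have hold : Holds (Function.update ρ x (m + 1)) (m + 2) u (Function.update env x k) := by
        intro y
        rcases eq_or_ne y x with rfl | hy
        · simpa using t3
        · have h1 := (h y).1
          have h2 := (h y).2
          simp only [Function.update_of_ne hy]
          exact ⟨by omega, by rw [t4 _ h1 (hρ y)]; exact h2⟩
      obtain ⟨u1, e1, w1, p1⟩ := e.compile_spec O (Function.update ρ x (m + 1)) (m + 2) u
        (Function.update env x k) hold
      have e2 := Exec.store (O := O) a (cell (m + 1)) (cell (m + 2)) u1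
      have w2 : u1 (m + 1) 0 = k := by rw [p1 _ (by omega)]; exact t3
      rw [cell_cost, cell_cost, cell_val, cell_val, w1, w2, Int.toNat_natCast] at e2
      set u2 := u1.write a k (e.val O (Function.update env x k)) with hu2
      have w3 : u2 (m + 1) 0 = k := by
        rw [hu2, write_array_ne _ _ _ (by omega)]; exact w2
      have e3 := exec_incr O (m + 1) k u2 w3
      refine ⟨_, (Exec.seq _ _ _ _ _ _ _ e1 (Exec.seq _ _ _ _ _ _ _ e2 e3)).of_eq ?_,
        ?_, ?_, ?_, ?_⟩
      · simp only [hf]; ring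
      · intro j hj
        rw [write_array_ne _ _ _ (by omega), hu2]
        rcases eq_or_ne j k with rfl | hjk
        · rw [write_same]
        · rw [write_cell_ne _ _ _ hjk, p1 _ (by omega)]
          exact t1 j (by omega)
      · rw [write_array_ne _ _ _ (by omega), hu2, write_array_ne _ _ _ (by omega),
          p1 _ (by omega)]
        exact t2
      · exact write_same _ _ _ _
      · intro c hc hca
        rw [write_array_ne _ _ _ (by omega), hu2, write_array_ne _ _ _ hca, p1 _ (by omega)]
        exact t4 c hc hca)
    (by
      rintro u ⟨_, t2, t3, _⟩
      obtain ⟨g1, _, g3⟩ := guard_spec t3 t2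
      exact ⟨g3 rfl, g1⟩)
    (s2.write (m + 1) 0 0)
    ⟨by intro j hj; omega,
      by rw [write_array_ne _ _ _ (by omega)]; exact v2,
      by rw [write_same]; rfl,
      fun c hc _ => by rw [write_array_ne _ _ _ (by omega), f2 _ hc]⟩
  refine ⟨s4, (Exec.seq _ _ _ _ _ _ _ h2 (Exec.seq _ _ _ _ _ _ _ h3 h4)).of_eq ?_, i1, i4⟩
  simp only [fillTime]
  ring

end LogCost

namespace LogCost

/-! ### Running times of functional expressions -/

theorem bits_le_of_natAbs_lt {z : ℤ} {k : ℕ} (h : z.natAbs < 2 ^ k) : bits z ≤ k + 1 :=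
  Nat.succ_le_succ (Nat.size_le.2 h)

theorem natAbs_lt_two_pow_bits (z : ℤ) : 2 * z.natAbs < 2 ^ bits z := by
  have := Nat.lt_size_self z.natAbs
  unfold bits
  rw [pow_succ]
  omega

theorem bits_le_of_natAbs_le {a b : ℤ} (h : a.natAbs ≤ b.natAbs) : bits a ≤ bits b :=
  Nat.succ_le_succ (Nat.size_le_size h)

theorem BinOp.bits_eval_le (o : BinOp) (a b : ℤ) : bits (o.eval a b) ≤ bits a + bits b + 1 := by
  have ha := natAbs_lt_two_pow_bits a
  have hb := natAbs_lt_two_pow_bits b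
  have ha1 : 1 ≤ 2 ^ bits a := Nat.one_le_two_pow
  have hb1 : 1 ≤ 2 ^ bits b := Nat.one_le_two_pow
  have hsum : a.natAbs + b.natAbs < 2 ^ (bits a + bits b) := by
    rw [pow_add]
    nlinarith
  cases o with
  | add => exact bits_le_of_natAbs_lt ((Int.natAbs_add_le a b).trans_lt hsum)
  | sub => exact bits_le_of_natAbs_lt ((Int.natAbs_sub_le a b).trans_lt hsum)
  | mul =>
    refine bits_le_of_natAbs_lt ?_
    change (a * b).natAbs < _
    rw [Int.natAbs_mul, pow_add]
    exact Nat.mul_lt_mul'' (by omega) (by omega)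
  | div =>
    have : bits (a / b) ≤ bits a := bits_le_of_natAbs_le (Int.natAbs_ediv_le_natAbs a b)
    exact this.trans (by omega)
  | lt =>
    have : bits (if a < b then 1 else 0) ≤ 2 := by split_ifs <;> decide
    have ha : 1 ≤ bits a := Nat.succ_le_succ (Nat.zero_le _)
    have hb : 1 ≤ bits b := Nat.succ_le_succ (Nat.zero_le _)
    exact this.trans (by omega)

/-- One operation adds at most the bits of its operand plus one, so the size of the accumulator is
linear in the number of iterations. This keeps `2 ^ T` iterations from producing numbers of more
than `2 ^ O(T)` bits. -/
theorem BinOp.bits_acc_le (o : BinOp) {i : ℤ} {f : ℕ → ℤ} {y B : ℕ} (hi : bits i ≤ y)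
    (hf : ∀ k < B, bits (f k) ≤ y) : ∀ k ≤ B, bits (o.acc i f k) ≤ y + k * (y + 1) := by
  intro k
  induction k with
  | zero => intro _; simpa [BinOp.acc] using hi
  | succ k ih =>
    intro hk
    have h1 := ih (by omega)
    have h2 := hf k (by omega)
    have h3 := o.bits_eval_le (o.acc i f k) (f k)
    change bits (o.eval (o.acc i f k) (f k)) ≤ _
    calc _ ≤ _ := h3
      _ ≤ y + k * (y + 1) + y + 1 := by omega
      _ = _ := by ring

/-- Writing a value is charged with its bits. Bounding times therefore bounds the sizes of
intermediate values too, and one induction suffices for both. -/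
theorem FExpr.bits_val_le_time (O : Oracle) (e : FExpr) (s : ℕ → ℤ) :
    bits (e.val O s) ≤ e.time O s := by
  cases e with
  | const z => simp only [FExpr.val, FExpr.time]; omega
  | var x => simp only [FExpr.val, FExpr.time]; omega
  | bin o a b => simp only [FExpr.val, FExpr.time]; omega
  | letE x a e => simp only [FExpr.val, FExpr.time]; omega
  | query x l t e =>
    rw [FExpr.time]
    omega
  | fold o x i b e =>
    simp only [FExpr.val, FExpr.time]
    rcases Nat.eq_zero_or_pos (b.val O s).toNat with h | h
    · have := bits_val_le_time O i s
      rw [h]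
      simp only [BinOp.acc]
      omega
    · obtain ⟨k, hk⟩ : ∃ k, (b.val O s).toNat = k + 1 := ⟨_, (Nat.succ_pred_eq_of_pos h).symm⟩
      rw [hk, Finset.sum_range_succ]
      omega

/-- The hypotheses under which the running time is controlled by `FExpr.rank`: loops are run at most
`2 ^ T` times, and the precisions and answers of queries have at most `2 ^ T` bits. -/
def FExpr.Ok (O : Oracle) (T : ℕ) : FExpr → (ℕ → ℤ) → Prop
  | const _, _ => True
  | var _, _ => True
  | bin _ a b, s => a.Ok O T s ∧ b.Ok O T s
  | fold _ x i b e, s => i.Ok O T s ∧ b.Ok O T s ∧ (b.val O s).toNat ≤ 2 ^ T ∧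
      ∀ k < (b.val O s).toNat, e.Ok O T (Function.update s x k)
  | letE x a e, s => a.Ok O T s ∧ e.Ok O T (Function.update s x (a.val O s))
  | query x l t e, s => l.Ok O T s ∧ t.Ok O T s ∧ (l.val O s).toNat ≤ 2 ^ T ∧
      (t.val O s).toNat ≤ 2 ^ T ∧ bits ((query x l t e).val O s) ≤ 2 ^ T ∧
      ∀ k < (l.val O s).toNat, e.Ok O T (Function.update s x k)

/-- A bound for the exponent of the running time, in units of `T`, when the variable `x` has at most
`2 ^ (r x * T)` bits. -/
def FExpr.rank : FExpr → (ℕ → ℕ) → ℕ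
  | const z, _ => 2 + 2 * bits z
  | var x, r => r x + 1
  | bin _ a b, r => a.rank r + b.rank r + 1
  | fold _ x i b e, r => i.rank r + b.rank r + e.rank (Function.update r x 1) + 4
  | letE x a e, r => a.rank r + e.rank (Function.update r x (a.rank r)) + 1
  | query x l t e, r => l.rank r + t.rank r + e.rank (Function.update r x 1) + 4

theorem guardCost_le {k : ℕ} {b : ℤ} (hk : k ≤ b.toNat) : guardCost k b ≤ 4 + 4 * bits b := by
  have : bits k ≤ bits b := bits_le_of_natAbs_le (by omega)
  unfold guardCost
  omega

theorem incCost_le {k : ℕ} {b : ℤ} (hk : k < b.toNat) : incCost k ≤ 8 + 3 * bits b := by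
  have h1 : bits k ≤ bits b := bits_le_of_natAbs_le (by omega)
  have h2 : bits (k + 1) ≤ bits b := bits_le_of_natAbs_le (by omega)
  unfold incCost
  omega

theorem bits_counter_le {k : ℕ} {b : ℤ} (hk : k < b.toNat) : bits k ≤ bits b :=
  bits_le_of_natAbs_le (by omega)

theorem bits_le_two_pow {k T : ℕ} (hT : 1 ≤ T) (hk : k ≤ 2 ^ T) : bits k ≤ 2 ^ (1 * T + 1) := by
  have h1 : bits k ≤ T + 1 + 1 := bits_le_of_natAbs_lt (by
    rw [Int.natAbs_natCast, pow_succ]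
    have : 1 ≤ 2 ^ T := Nat.one_le_two_pow
    omega)
  have h2 := Nat.lt_two_pow_self (n := T)
  rw [one_mul, pow_succ]
  omega

theorem sum_range_le_mul {B Z z : ℕ} {f : ℕ → ℕ} (hB : B ≤ Z) (h : ∀ k < B, f k ≤ z) :
    ∑ k ∈ Finset.range B, f k ≤ Z * z := by
  calc _ ≤ ∑ _k ∈ Finset.range B, z := Finset.sum_le_sum fun k hk => h k (Finset.mem_range.1 hk)
    _ = B * z := by simp
    _ ≤ _ := Nat.mul_le_mul_right _ hB

theorem update_bits_le {s : ℕ → ℤ} {r : ℕ → ℕ} {T : ℕ} (hr : ∀ x, bits (s x) ≤ 2 ^ (r x * T + 1))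
    (x : ℕ) {z : ℤ} {c : ℕ} (hz : bits z ≤ 2 ^ (c * T + 1)) (y : ℕ) :
    bits (Function.update s x z y) ≤ 2 ^ (Function.update r x c y * T + 1) := by
  rcases eq_or_ne y x with rfl | h
  · simpa using hz
  · simpa [h] using hr y

theorem two_pow_le_of_rank_le {c d T : ℕ} (h : c ≤ d) : 2 ^ (c * T) ≤ 2 ^ (d * T) :=
  Nat.pow_le_pow_right (by norm_num) (Nat.mul_le_mul_right _ h)

/-- Constants up to `64 = 2 ^ 6` are absorbed by one unit of rank, as `T ≥ 6`. -/
theorem mul_two_pow_le {a c d T : ℕ} (hT : 6 ≤ T) (ha : a ≤ 64) (h : c + 1 ≤ d) :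
    a * 2 ^ (c * T) ≤ 2 ^ (d * T) := by
  calc a * 2 ^ (c * T) ≤ 2 ^ 6 * 2 ^ (c * T) := Nat.mul_le_mul_right _ (by omega)
    _ ≤ 2 ^ T * 2 ^ (c * T) := Nat.mul_le_mul_right _ (Nat.pow_le_pow_right (by norm_num) hT)
    _ = 2 ^ ((c + 1) * T) := by rw [← pow_add]; ring_nf
    _ ≤ _ := two_pow_le_of_rank_le h

theorem query_sum_bits_le {B Z y : ℕ} {f : ℕ → ℤ} (hB : B ≤ Z) (h : ∀ k < B, bits (f k) ≤ y) :
    ((List.ofFn fun j : Fin B => f j).map bits).sum ≤ Z * y := by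
  rw [List.map_ofFn, List.sum_ofFn]
  exact (Fin.sum_univ_eq_sum_range (fun k => bits (f k)) B).trans_le (sum_range_le_mul hB h)

/-- The running time of an expression that satisfies `FExpr.Ok`. -/
theorem FExpr.time_le (O : Oracle) {T : ℕ} (hT : 6 ≤ T) (e : FExpr) :
    ∀ (s : ℕ → ℤ) (r : ℕ → ℕ), (∀ x, bits (s x) ≤ 2 ^ (r x * T + 1)) → e.Ok O T s →
      e.time O s ≤ 2 ^ (e.rank r * T) := by
  have hbase : ∀ r : ℕ, 2 ^ (r * T + 1) = 2 * 2 ^ (r * T) := fun r => by rw [pow_succ]; ring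
  induction e with
  | const z =>
    intro s r _ _
    rw [FExpr.time, FExpr.rank]
    calc 2 + 2 * bits z ≤ 2 ^ (2 + 2 * bits z) := Nat.lt_two_pow_self.le
      _ ≤ _ := Nat.pow_le_pow_right (by norm_num) (Nat.le_mul_of_pos_right _ (by omega))
  | var x =>
    intro s r hr _
    rw [FExpr.time, FExpr.rank]
    have h1 := hr x
    rw [hbase] at h1
    have h2 := mul_two_pow_le (a := 8) (c := r x) hT (by norm_num) le_rfl
    have h3 : 1 ≤ 2 ^ (r x * T) := Nat.one_le_two_pow
    omega
  | bin o a b iha ihb =>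
    intro s r hr hok
    have h1 := iha s r hr hok.1
    have h2 := ihb s r hr hok.2
    rw [FExpr.time, FExpr.rank]
    have h3 := a.bits_val_le_time O s
    have h4 := b.bits_val_le_time O s
    have h5 := o.bits_eval_le (a.val O s) (b.val O s)
    have h6 := two_pow_le_of_rank_le (T := T) (Nat.le_add_right (a.rank r) (b.rank r))
    have h7 := two_pow_le_of_rank_le (T := T) (Nat.le_add_left (b.rank r) (a.rank r))
    have h8 := mul_two_pow_le (a := 15) (c := a.rank r + b.rank r) hT (by norm_num) le_rfl
    have h9 : 1 ≤ 2 ^ ((a.rank r + b.rank r) * T) := Nat.one_le_two_pow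
    omega
  | letE x a e iha ihe =>
    intro s r hr hok
    have h1 := iha s r hr hok.1
    have h3 := a.bits_val_le_time O s
    have h2 := ihe (Function.update s x (a.val O s)) (Function.update r x (a.rank r))
      (update_bits_le hr x (by rw [hbase]; omega)) hok.2
    rw [FExpr.time, FExpr.rank]
    have h4 := e.bits_val_le_time O (Function.update s x (a.val O s))
    set c := e.rank (Function.update r x (a.rank r))
    have h6 := two_pow_le_of_rank_le (T := T) (Nat.le_add_right (a.rank r) c)
    have h7 := two_pow_le_of_rank_le (T := T) (Nat.le_add_left c (a.rank r))
    have h8 := mul_two_pow_le (a := 8) (c := a.rank r + c) hT (by norm_num) le_rfl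
    have h9 : 1 ≤ 2 ^ ((a.rank r + c) * T) := Nat.one_le_two_pow
    omega
  | fold o x i b e ihi ihb ihe =>
    intro s r hr ⟨oi, ob, hB, oe⟩
    have hi := ihi s r hr oi
    have hb := ihb s r hr ob
    rw [FExpr.time, FExpr.rank]
    set c := e.rank (Function.update r x 1)
    set B := (b.val O s).toNat with hBdef
    set f : ℕ → ℤ := fun k => e.val O (Function.update s x k) with hf
    have he : ∀ k < B, e.time O (Function.update s x k) ≤ 2 ^ (c * T) := fun k hk =>
      ihe _ _ (update_bits_le hr x (bits_le_two_pow (by omega) (by omega))) (oe k hk)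
    set R := i.rank r + b.rank r + c with hR
    set y := 2 ^ (R * T) with hy
    have hy1 : 1 ≤ y := Nat.one_le_two_pow
    have hZ1 : 1 ≤ 2 ^ T := Nat.one_le_two_pow
    have hi' : i.time O s ≤ y := hi.trans (two_pow_le_of_rank_le (by omega))
    have hb' : b.time O s ≤ y := hb.trans (two_pow_le_of_rank_le (by omega))
    have he' : ∀ k < B, e.time O (Function.update s x k) ≤ y := fun k hk =>
      (he k hk).trans (two_pow_le_of_rank_le (by omega))
    have vb := (b.bits_val_le_time O s).trans hb'
    have vf : ∀ k < B, bits (f k) ≤ y := fun k hk => (e.bits_val_le_time O _).trans (he' k hk)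
    have vacc : ∀ k ≤ B, bits (o.acc (i.val O s) f k) ≤ 3 * (2 ^ T * y) := fun k hk => by
      have h1 := o.bits_acc_le ((i.bits_val_le_time O s).trans hi') vf k hk
      have h2 : k * (y + 1) ≤ 2 ^ T * (y + 1) := Nat.mul_le_mul_right _ (by omega)
      nlinarith
    have hsum : ∑ k ∈ Finset.range B, (guardCost k (b.val O s) + (e.time O (Function.update s x k) +
        (6 + 2 * bits (o.acc (i.val O s) f k) + 2 * bits (e.val O (Function.update s x k))
          + bits (o.acc (i.val O s) f (k + 1))) + incCost k)) ≤ 2 ^ T * (37 * (2 ^ T * y)) := by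
      refine sum_range_le_mul hB fun k hk => ?_
      have g1 := guardCost_le (b := b.val O s) hk.le
      have g2 := incCost_le (b := b.val O s) hk
      have g3 := vacc k hk.le
      have g4 := vacc (k + 1) hk
      have g5 := he' k hk
      have g6 := (e.bits_val_le_time O _).trans (he' k hk)
      have g7 : y ≤ 2 ^ T * y := Nat.le_mul_of_pos_left _ hZ1
      omega
    have gend : guardCost B (b.val O s) ≤ _ := guardCost_le le_rfl
    -- One factor `2 ^ T` is the number of iterations, the other one the size of the accumulator.
    have htot : 2 ^ T * (37 * (2 ^ T * y)) + 14 * y ≤ 51 * 2 ^ ((R + 2) * T) := by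
      have e1 : 2 ^ ((R + 2) * T) = 2 ^ T * (2 ^ T * y) := by
        rw [hy, ← pow_add, ← pow_add]; ring_nf
      rw [e1]
      have g7 : y ≤ 2 ^ T * y := Nat.le_mul_of_pos_left _ hZ1
      have g8 : 2 ^ T * y ≤ 2 ^ T * (2 ^ T * y) := Nat.le_mul_of_pos_left _ hZ1
      have g9 : 2 ^ T * (37 * (2 ^ T * y)) = 37 * (2 ^ T * (2 ^ T * y)) := by ring
      omega
    have hfin := mul_two_pow_le (a := 51) (c := R + 2) (d := R + 4) hT (by norm_num) (by omega)
    change _ + _ + 4 + ∑ k ∈ Finset.range B, _ + _ ≤ _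
    omega
  | query x l t e ihl iht ihe =>
    intro s r hr ⟨ol, ot, hB, ht, ha, oe⟩
    have hi := iht s r hr ot
    have hb := ihl s r hr ol
    rw [FExpr.time, FExpr.rank]
    set c := e.rank (Function.update r x 1)
    set B := (l.val O s).toNat with hBdef
    set f : ℕ → ℤ := fun k => e.val O (Function.update s x k) with hf
    have he : ∀ k < B, e.time O (Function.update s x k) ≤ 2 ^ (c * T) := fun k hk =>
      ihe _ _ (update_bits_le hr x (bits_le_two_pow (by omega) (by omega))) (oe k hk)
    set R := l.rank r + t.rank r + c with hR
    set y := 2 ^ (R * T) with hy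
    have hy1 : 1 ≤ y := Nat.one_le_two_pow
    have hZ1 : 1 ≤ 2 ^ T := Nat.one_le_two_pow
    have hi' : t.time O s ≤ y := hi.trans (two_pow_le_of_rank_le (by omega))
    have hb' : l.time O s ≤ y := hb.trans (two_pow_le_of_rank_le (by omega))
    have he' : ∀ k < B, e.time O (Function.update s x k) ≤ y := fun k hk =>
      (he k hk).trans (two_pow_le_of_rank_le (by omega))
    have vb := (l.bits_val_le_time O s).trans hb'
    have vt := (t.bits_val_le_time O s).trans hi'
    have vf : ∀ k < B, bits (f k) ≤ y := fun k hk => (e.bits_val_le_time O _).trans (he' k hk)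
    have hsum : ∑ k ∈ Finset.range B, (guardCost k (l.val O s) + (e.time O (Function.update s x k) +
        (4 + 2 * bits k + 2 * bits (e.val O (Function.update s x k))) + incCost k)) ≤ 2 ^ T * (28 * y) := by
      refine sum_range_le_mul hB fun k hk => ?_
      have g1 := guardCost_le (b := l.val O s) hk.le
      have g2 := incCost_le (b := l.val O s) hk
      have g3 := bits_counter_le (b := l.val O s) hk
      have g5 := he' k hk
      have g6 := (e.bits_val_le_time O _).trans (he' k hk)
      omega
    have gend : guardCost B (l.val O s) ≤ _ := guardCost_le le_rfl
    have gq := query_sum_bits_le hB vf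
    have htot : 2 ^ T * (28 * y) + 2 ^ T * y + 2 * 2 ^ T + 20 * y ≤ 51 * 2 ^ ((R + 1) * T) := by
      have e1 : 2 ^ ((R + 1) * T) = 2 ^ T * y := by
        rw [hy, ← pow_add]; ring_nf
      rw [e1]
      have g7 : y ≤ 2 ^ T * y := Nat.le_mul_of_pos_left _ hZ1
      have g8 : 2 ^ T ≤ 2 ^ T * y := Nat.le_mul_of_pos_right _ hy1
      have g9 : 2 ^ T * (28 * y) = 28 * (2 ^ T * y) := by ring
      omega
    have hfin := mul_two_pow_le (a := 51) (c := R + 1) (d := R + 4) hT (by norm_num) (by omega)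
    change _ + _ + 4 + ∑ k ∈ Finset.range B, _ + _ + (4 + _ + _ + (List.map bits
      (List.ofFn fun j : Fin B => f j)).sum + _ + _) ≤ _
    omega

/-- The running time of `fill`. -/
theorem fillTime_le (O : Oracle) {T : ℕ} (hT : 6 ≤ T) (x : ℕ) (b e : FExpr) (s : ℕ → ℤ) (r : ℕ → ℕ)
    (hr : ∀ x, bits (s x) ≤ 2 ^ (r x * T + 1)) (ob : b.Ok O T s) (hB : (b.val O s).toNat ≤ 2 ^ T)
    (oe : ∀ k < (b.val O s).toNat, e.Ok O T (Function.update s x k)) :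
    fillTime O x b e s ≤ 2 ^ ((b.rank r + e.rank (Function.update r x 1) + 4) * T) := by
  have hb := b.time_le O hT s r hr ob
  unfold fillTime
  set c := e.rank (Function.update r x 1)
  set B := (b.val O s).toNat with hBdef
  have he : ∀ k < B, e.time O (Function.update s x k) ≤ 2 ^ (c * T) := fun k hk =>
    e.time_le O hT _ _ (update_bits_le hr x (bits_le_two_pow (by omega) (by omega))) (oe k hk)
  set R := b.rank r + c with hR
  set y := 2 ^ (R * T) with hy
  have hy1 : 1 ≤ y := Nat.one_le_two_pow
  have hZ1 : 1 ≤ 2 ^ T := Nat.one_le_two_pow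
  have hb' : b.time O s ≤ y := hb.trans (two_pow_le_of_rank_le (by omega))
  have he' : ∀ k < B, e.time O (Function.update s x k) ≤ y := fun k hk =>
    (he k hk).trans (two_pow_le_of_rank_le (by omega))
  have vb := (b.bits_val_le_time O s).trans hb'
  have hsum : ∑ k ∈ Finset.range B, (guardCost k (b.val O s) + (e.time O (Function.update s x k) +
      (4 + 2 * bits k + 2 * bits (e.val O (Function.update s x k))) + incCost k))
      ≤ 2 ^ T * (28 * y) := by
    refine sum_range_le_mul hB fun k hk => ?_
    have g1 := guardCost_le (b := b.val O s) hk.le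
    have g2 := incCost_le (b := b.val O s) hk
    have g3 := bits_counter_le (b := b.val O s) hk
    have g5 := he' k hk
    have g6 := (e.bits_val_le_time O _).trans (he' k hk)
    omega
  have gend : guardCost B (b.val O s) ≤ _ := guardCost_le le_rfl
  have htot : 2 ^ T * (28 * y) + 20 * y ≤ 51 * 2 ^ ((R + 1) * T) := by
    have e1 : 2 ^ ((R + 1) * T) = 2 ^ T * y := by
      rw [hy, ← pow_add]; ring_nf
    rw [e1]
    have g7 : y ≤ 2 ^ T * y := Nat.le_mul_of_pos_left _ hZ1
    have g9 : 2 ^ T * (28 * y) = 28 * (2 ^ T * y) := by ring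
    omega
  have hfin := mul_two_pow_le (a := 51) (c := R + 1) (d := R + 4) hT (by norm_num) (by omega)
  omega

end LogCost

namespace LogCost

/-! ### Arithmetic abbreviations for functional expressions -/

namespace FExpr

instance : Add FExpr := ⟨bin .add⟩
instance : Sub FExpr := ⟨bin .sub⟩
instance : Mul FExpr := ⟨bin .mul⟩
instance : Div FExpr := ⟨bin .div⟩
instance (k : ℕ) : OfNat FExpr k := ⟨const k⟩

/-- The truth value of `a < b`. -/
def less (a b : FExpr) : FExpr := bin .lt a b

/-- The truth value of `a ≤ b`. -/
def leq (a b : FExpr) : FExpr := 1 - less b a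

/-- The truth value of `a = b`. -/
def same (a b : FExpr) : FExpr := leq a b * leq b a

/-- The sum of `e` for `x < b`. -/
def sum (x : ℕ) (b e : FExpr) : FExpr := fold .add x 0 b e

/-- The product of `e` for `x < b`. -/
def prod (x : ℕ) (b e : FExpr) : FExpr := fold .mul x 1 b e

/-- The power of `a`, an expression without the variable `11`. -/
def power (a b : FExpr) : FExpr := prod 11 b a

/-- The digit number `i` of `c` in base `q`, an expression without the variable `11`. -/
def baseDigit (q c i : FExpr) : FExpr := c / power q i - q * (c / power q i / q)

variable (O : Oracle) (s : ℕ → ℤ) (T : ℕ) (a b e : FExpr)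

theorem val_add : (a + b).val O s = a.val O s + b.val O s := rfl
theorem val_sub : (a - b).val O s = a.val O s - b.val O s := rfl
theorem val_mul : (a * b).val O s = a.val O s * b.val O s := rfl
theorem val_div : (a / b).val O s = a.val O s / b.val O s := rfl
theorem val_var (x : ℕ) : (var x).val O s = s x := rfl
theorem val_letE (x : ℕ) :
    (letE x a e).val O s = e.val O (Function.update s x (a.val O s)) := rfl
theorem val_ofNat (k : ℕ) :
    (no_index (OfNat.ofNat k) : FExpr).val O s = ((OfNat.ofNat k : ℕ) : ℤ) := rfl
theorem val_less : (less a b).val O s = if a.val O s < b.val O s then 1 else 0 := rfl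

theorem val_leq : (leq a b).val O s = if a.val O s ≤ b.val O s then 1 else 0 := by
  change (1 : ℤ) - (if b.val O s < a.val O s then 1 else 0) = _
  by_cases h : a.val O s ≤ b.val O s
  · rw [if_neg (not_lt.2 h), if_pos h]; rfl
  · rw [if_pos (not_le.1 h), if_neg h]; rfl

theorem val_same : (same a b).val O s = if a.val O s = b.val O s then 1 else 0 := by
  rw [same, val_mul, val_leq, val_leq]
  split_ifs <;> first | rfl | omega

theorem acc_add (f : ℕ → ℤ) (k : ℕ) : BinOp.add.acc 0 f k = ∑ j ∈ Finset.range k, f j := by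
  induction k with
  | zero => rfl
  | succ k ih => rw [Finset.sum_range_succ, ← ih]; rfl

theorem acc_mul (f : ℕ → ℤ) (k : ℕ) : BinOp.mul.acc 1 f k = ∏ j ∈ Finset.range k, f j := by
  induction k with
  | zero => rfl
  | succ k ih => rw [Finset.prod_range_succ, ← ih]; rfl

theorem val_sum (x : ℕ) : (sum x b e).val O s =
    ∑ k ∈ Finset.range (b.val O s).toNat, e.val O (Function.update s x (k : ℕ)) :=
  acc_add _ _

theorem val_prod (x : ℕ) : (prod x b e).val O s =
    ∏ k ∈ Finset.range (b.val O s).toNat, e.val O (Function.update s x (k : ℕ)) :=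
  acc_mul _ _

theorem val_power (ha : ∀ k : ℤ, a.val O (Function.update s 11 k) = a.val O s) :
    (power a b).val O s = a.val O s ^ (b.val O s).toNat := by
  rw [power, val_prod]
  simp only [ha, Finset.prod_const, Finset.card_range]

theorem ok_add : (a + b).Ok O T s ↔ a.Ok O T s ∧ b.Ok O T s := Iff.rfl
theorem ok_sub : (a - b).Ok O T s ↔ a.Ok O T s ∧ b.Ok O T s := Iff.rfl
theorem ok_mul : (a * b).Ok O T s ↔ a.Ok O T s ∧ b.Ok O T s := Iff.rfl
theorem ok_div : (a / b).Ok O T s ↔ a.Ok O T s ∧ b.Ok O T s := Iff.rfl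
theorem ok_less : (less a b).Ok O T s ↔ a.Ok O T s ∧ b.Ok O T s := Iff.rfl
theorem ok_letE (x : ℕ) : (letE x a e).Ok O T s ↔
    a.Ok O T s ∧ e.Ok O T (Function.update s x (a.val O s)) := Iff.rfl

theorem ok_leq : (leq a b).Ok O T s ↔ a.Ok O T s ∧ b.Ok O T s := by
  rw [leq, ok_sub, ok_less]
  exact ⟨fun h => ⟨h.2.2, h.2.1⟩, fun h => ⟨trivial, h.2, h.1⟩⟩

theorem ok_same : (same a b).Ok O T s ↔ a.Ok O T s ∧ b.Ok O T s := by
  rw [same, ok_mul, ok_leq, ok_leq]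
  tauto

theorem ok_sum (x : ℕ) : (sum x b e).Ok O T s ↔ b.Ok O T s ∧ (b.val O s).toNat ≤ 2 ^ T ∧
    ∀ k < (b.val O s).toNat, e.Ok O T (Function.update s x (k : ℕ)) :=
  ⟨fun h => h.2, fun h => ⟨trivial, h⟩⟩

theorem ok_prod (x : ℕ) : (prod x b e).Ok O T s ↔ b.Ok O T s ∧ (b.val O s).toNat ≤ 2 ^ T ∧
    ∀ k < (b.val O s).toNat, e.Ok O T (Function.update s x (k : ℕ)) :=
  ⟨fun h => h.2, fun h => ⟨trivial, h⟩⟩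

end FExpr

/-- The digit number `i` of `c` in base `q`. -/
def natDigit (q c i : ℕ) : ℕ := c / q ^ i % q

theorem FExpr.val_baseDigit (O : Oracle) (s : ℕ → ℤ) {q c i : FExpr} {q' c' i' : ℕ}
    (hq : ∀ k : ℤ, q.val O (Function.update s 11 k) = q.val O s) (h1 : q.val O s = q')
    (h2 : c.val O s = c') (h3 : i.val O s = i') :
    (baseDigit q c i).val O s = natDigit q' c' i' := by
  simp only [baseDigit, val_sub, val_mul, val_div, val_power O s q i hq, h1, h2, h3,
    Int.toNat_natCast]
  rw [← Int.emod_def]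
  unfold natDigit
  push_cast
  rfl

theorem FExpr.ok_baseDigit (O : Oracle) (s : ℕ → ℤ) (T : ℕ) {q c i : FExpr} {i' : ℕ}
    (h3 : i.val O s = i') (oi : i.Ok O T s) (oc : c.Ok O T s) (oq : q.Ok O T s)
    (oq' : ∀ k : ℤ, q.Ok O T (Function.update s 11 k)) (hi : i' ≤ 2 ^ T) :
    (baseDigit q c i).Ok O T s := by
  have hp : (power q i).Ok O T s := by
    rw [power, ok_prod, h3, Int.toNat_natCast]
    exact ⟨oi, hi, fun k _ => oq' k⟩
  rw [baseDigit, ok_sub, ok_mul, ok_div, ok_div, ok_div]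
  exact ⟨⟨oc, hp⟩, oq, ⟨oc, hp⟩, oq⟩

/-! ### The search -/

/-- The sizes that occur in the search: the dimension `n`, the accuracy `N`, the sparsity `s` of the
linear form, the number `L` of factors, the exponent `E` of the bounds and the bound `h` on the
coefficients. -/
structure Params where
  n : ℕ
  N : ℕ
  s : ℕ
  L : ℕ
  E : ℕ
  h : ℕ

namespace Params

variable (p : Params)

/-- A signed coefficient of the candidate with a given code. -/
def signed (code i : ℕ) : ℤ := natDigit (2 * p.h) code i - p.h

/-- The coefficients of the linear form of a candidate. -/
def weight (code i : ℕ) : ℤ :=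
  ∑ l ∈ Finset.range p.s, (if natDigit (2 * p.h) code (4 * p.L + 2 * l) = i then 1 else 0) *
    p.signed code (4 * p.L + 2 * l + 1)

/-- The coefficients of the factor number `r` of a candidate; the letter `2 n` stands for the constant
term. -/
def entry (code r i : ℕ) : ℤ :=
  p.signed code (4 * r) * p.weight code i
    + (if natDigit (2 * p.h) code (4 * r + 1) = i then 1 else 0) * p.signed code (4 * r + 2)
    + (if i = 2 * p.n then 1 else 0) * p.signed code (4 * r + 3)

/-- The coefficient of a word in the expanded square of a candidate. -/
def wordCoeff (code c : ℕ) : ℤ :=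
  ∏ j ∈ Finset.range (2 * p.L), p.entry code (j / 2) (natDigit (2 * p.n + 1) c j)

/-- The number of occurrences of a letter in a word. -/
def wordExp (c i : ℕ) : ℕ :=
  ∑ j ∈ Finset.range (2 * p.L), if natDigit (2 * p.n + 1) c j = i then 1 else 0

/-- The question about a word followed by two more letters. -/
def question (c a b : ℕ) : List ℤ :=
  List.ofFn fun x : Fin (2 * p.n) => ((p.wordExp c x : ℤ) + (if (x : ℕ) = a then 1 else 0)
    + (if (x : ℕ) = b then 1 else 0))

/-- The approximate moment of the square of a candidate times two more letters. -/
def moment (O : Oracle) (code a b : ℕ) : ℤ :=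
  ∑ c ∈ Finset.range ((2 * p.n + 1) ^ (2 * p.L)),
    p.wordCoeff code c * O (p.question c a b) (3 * p.E)

/-- The approximate covariances of a candidate, summed up. -/
def deviation (O : Oracle) (code : ℕ) : ℤ :=
  ∑ i ∈ Finset.range p.n, ∑ j ∈ Finset.range p.n,
    (p.moment O code i (2 * p.n) * p.moment O code (p.n + j) (2 * p.n)
      - p.moment O code (2 * p.n) (2 * p.n) * p.moment O code i (p.n + j)) ^ 2

/-- The approximate norms of the mean vectors of a candidate, multiplied. -/
def signal (O : Oracle) (code : ℕ) : ℤ :=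
  ∑ i ∈ Finset.range p.n, ∑ j ∈ Finset.range p.n,
    (p.moment O code i (2 * p.n) * p.moment O code (p.n + j) (2 * p.n)) ^ 2

/-- The test that the search applies to a candidate. -/
def Accepts (O : Oracle) (code : ℕ) : Prop :=
  2 ^ (2 * p.E) ≤ p.moment O code (2 * p.n) (2 * p.n) ∧
    4608 * (p.s : ℤ) ^ 2 * (p.N : ℤ) ^ 2 * p.deviation O code
      + p.moment O code (2 * p.n) (2 * p.n) ^ 4 ≤ 4608 * (p.s : ℤ) ^ 2 * p.signal O code

open Classical in
/-- The result of the search: the first code that passes the test. -/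
noncomputable def found (O : Oracle) : ℕ :=
  ∑ c ∈ Finset.range ((2 * p.h) ^ (6 * p.L)),
    ∏ c' ∈ Finset.range (c + 1), (1 - if p.Accepts O c' then 1 else 0)

/-- The inner product is 1 as long as no code up to `c` has been accepted and 0 afterwards, so the
sum counts the codes before the first accepted one and needs no conditional exit. -/
theorem found_spec (O : Oracle) (hex : ∃ c < (2 * p.h) ^ (6 * p.L), p.Accepts O c) :
    p.found O < (2 * p.h) ^ (6 * p.L) ∧ p.Accepts O (p.found O) := by
  classical
  have hex' : ∃ c, p.Accepts O c := hex.imp fun _ h => h.2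
  have hmin : Nat.find hex' < (2 * p.h) ^ (6 * p.L) := by
    obtain ⟨c, hc, hc'⟩ := hex
    exact (Nat.find_min' hex' hc').trans_lt hc
  have key : p.found O = Nat.find hex' := by
    unfold found
    have : ∀ c, ∏ c' ∈ Finset.range (c + 1), (1 - if p.Accepts O c' then 1 else 0) =
        if c < Nat.find hex' then 1 else 0 := by
      intro c
      split_ifs with h
      · refine Finset.prod_eq_one fun c' hc' => ?_
        rw [if_neg (Nat.find_min hex' (by have := Finset.mem_range.1 hc'; omega)), Nat.sub_zero]
      · refine Finset.prod_eq_zero (i := Nat.find hex') (Finset.mem_range.2 (by omega)) ?_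
        rw [if_pos (Nat.find_spec hex'), Nat.sub_self]
    rw [Finset.sum_congr rfl fun c _ => by rw [this]]
    rw [Finset.sum_boole]
    have e : (Finset.range ((2 * p.h) ^ (6 * p.L))).filter (fun c => c < Nat.find hex') =
        Finset.range (Nat.find hex') := by
      ext c
      simp only [Finset.mem_filter, Finset.mem_range]
      omega
    rw [e]
    simp
  rw [key]
  exact ⟨hmin, Nat.find_spec hex'⟩

/-- The environment `s` holds the parameters. -/
structure Good (env : ℕ → ℤ) : Prop where
  n : env 0 = p.n
  N : env 1 = p.N
  s : env 2 = p.s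
  L : env 3 = p.L
  E : env 4 = p.E
  h : env 5 = p.h

variable {p}

theorem Good.update {s : ℕ → ℤ} (g : p.Good s) {x : ℕ} (hx : 6 ≤ x) (z : ℤ) :
    p.Good (Function.update s x z) := by
  constructor <;> rw [Function.update_of_ne (by omega)]
  exacts [g.n, g.N, g.s, g.L, g.E, g.h]

variable (p)

/-- The bounds that control the running time of the search. -/
structure Fits (O : Oracle) (T : ℕ) : Prop where
  s_le : p.s ≤ p.L
  L_le : 6 * p.L ≤ 2 ^ T
  n_le : 2 * p.n ≤ 2 ^ T
  E_le : 3 * p.E ≤ 2 ^ T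
  words_le : (2 * p.n + 1) ^ (2 * p.L) ≤ 2 ^ T
  codes_le : (2 * p.h) ^ (6 * p.L) ≤ 2 ^ T
  answer_le : ∀ c < (2 * p.n + 1) ^ (2 * p.L), ∀ a ≤ 2 * p.n, ∀ b ≤ 2 * p.n,
    bits (O (p.question c a b) (3 * p.E)) ≤ 2 ^ T

end Params

open FExpr

/-- A digit of the code in variable `10`. -/
def codeDigitE (i : FExpr) : FExpr := baseDigit (2 * var 5) (var 10) i

/-- Expression for `Params.signed`. -/
def signedE (i : FExpr) : FExpr := codeDigitE i - var 5

/-- Expression for `Params.weight`, with the letter in variable `13`. -/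
def weightE : FExpr :=
  FExpr.sum 12 (var 2) (same (codeDigitE (4 * var 3 + 2 * var 12)) (var 13) *
    signedE (4 * var 3 + 2 * var 12 + 1))

/-- Expression for `Params.entry`, with the row in variable `14` and the letter in variable `13`. -/
def entryE : FExpr :=
  signedE (4 * var 14) * weightE
    + same (codeDigitE (4 * var 14 + 1)) (var 13) * signedE (4 * var 14 + 2)
    + same (var 13) (2 * var 0) * signedE (4 * var 14 + 3)

/-- The letter number `16` of the word in variable `15`. -/
def letterE : FExpr := baseDigit (2 * var 0 + 1) (var 15) (var 16)

/-- Expression for `Params.wordCoeff`. -/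
def wordCoeffE : FExpr :=
  FExpr.prod 16 (2 * var 3) (letE 14 (var 16 / 2) (letE 13 letterE entryE))

/-- Expression for `Params.wordExp`, with the letter in variable `17`. -/
def wordExpE : FExpr := FExpr.sum 16 (2 * var 3) (same letterE (var 17))

/-- The number of words. -/
def wordCountE : FExpr := power (2 * var 0 + 1) (2 * var 3)

/-- Expression for the answers of the oracle. -/
def answerE : FExpr := query 17 (2 * var 0) (3 * var 4)
  (wordExpE + same (var 17) (var 18) + same (var 17) (var 19))

/-- Expression for `Params.moment`, with the letters in the variables `18` and `19`. -/
def momentE : FExpr := FExpr.sum 15 wordCountE (wordCoeffE * answerE)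

/-- Expression for `Params.moment` with explicit letters. -/
def momentAtE (a b : FExpr) : FExpr := letE 18 a (letE 19 b momentE)

/-- Expression for `Params.deviation`, with the total mass in variable `22`. -/
def deviationE : FExpr := FExpr.sum 20 (var 0) (FExpr.sum 21 (var 0)
  (letE 23 (momentAtE (var 20) (2 * var 0) * momentAtE (var 0 + var 21) (2 * var 0)
    - var 22 * momentAtE (var 20) (var 0 + var 21)) (var 23 * var 23)))

/-- Expression for `Params.signal`. -/
def signalE : FExpr := FExpr.sum 20 (var 0) (FExpr.sum 21 (var 0)
  (letE 23 (momentAtE (var 20) (2 * var 0) * momentAtE (var 0 + var 21) (2 * var 0))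
    (var 23 * var 23)))

/-- Expression for the test. -/
def acceptsE : FExpr := letE 22 (momentAtE (2 * var 0) (2 * var 0))
  (leq (power 2 (2 * var 4)) (var 22) *
    leq (4608 * (var 2 * var 2) * (var 1 * var 1) * deviationE
      + var 22 * var 22 * (var 22 * var 22)) (4608 * (var 2 * var 2) * signalE))

/-- Expression for the search. -/
def foundE : FExpr :=
  FExpr.sum 26 (power (2 * var 5) (6 * var 3)) (FExpr.prod 10 (var 26 + 1) (1 - acceptsE))

/-! ### The expressions compute the quantities of the search. -/

section Values

variable {p : Params} {O : Oracle} {s : ℕ → ℤ}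

theorem codeDigitE_val (g : p.Good s) {code i' : ℕ} (hc : s 10 = code) {i : FExpr}
    (hi : i.val O s = i') : (codeDigitE i).val O s = natDigit (2 * p.h) code i' := by
  refine val_baseDigit O s (fun k => ?_) ?_ hc hi
  · simp [val_mul, val_var, val_ofNat]
  · rw [val_mul, val_var, val_ofNat, g.h]; push_cast; rfl

theorem signedE_val (g : p.Good s) {code i' : ℕ} (hc : s 10 = code) {i : FExpr}
    (hi : i.val O s = i') : (signedE i).val O s = p.signed code i' := by
  rw [signedE, val_sub, codeDigitE_val g hc hi, val_var, g.h]; rfl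

theorem weightE_val (g : p.Good s) {code i : ℕ} (hc : s 10 = code) (hi : s 13 = i) :
    weightE.val O s = p.weight code i := by
  rw [weightE, val_sum, val_var, g.s, Int.toNat_natCast, Params.weight]
  refine Finset.sum_congr rfl fun l _ => ?_
  have g' := g.update (x := 12) (by norm_num) l
  have hc' : Function.update s 12 (l : ℤ) 10 = code := by simp [hc]
  have h1 : (4 * var 3 + 2 * var 12 : FExpr).val O (Function.update s 12 (l : ℤ)) =
      ((4 * p.L + 2 * l : ℕ) : ℤ) := by
    simp only [val_add, val_mul, val_var, val_ofNat, g'.L]; simp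
  have h2 : (4 * var 3 + 2 * var 12 + 1 : FExpr).val O (Function.update s 12 (l : ℤ)) =
      ((4 * p.L + 2 * l + 1 : ℕ) : ℤ) := by
    rw [val_add, h1, val_ofNat]; simp
  rw [val_mul, val_same, codeDigitE_val g' hc' h1, signedE_val g' hc' h2, val_var]
  rw [Function.update_of_ne (by norm_num), hi]
  simp only [Nat.cast_inj]

theorem entryE_val (g : p.Good s) {code r i : ℕ} (hc : s 10 = code) (hr : s 14 = r)
    (hi : s 13 = i) : entryE.val O s = p.entry code r i := by
  have h0 : (4 * var 14 : FExpr).val O s = ((4 * r : ℕ) : ℤ) := by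
    simp only [val_mul, val_var, val_ofNat, hr]; simp
  have h1 : (4 * var 14 + 1 : FExpr).val O s = ((4 * r + 1 : ℕ) : ℤ) := by
    simp only [val_add, val_mul, val_var, val_ofNat, hr]; simp
  have h2 : (4 * var 14 + 2 : FExpr).val O s = ((4 * r + 2 : ℕ) : ℤ) := by
    simp only [val_add, val_mul, val_var, val_ofNat, hr]; simp
  have h3 : (4 * var 14 + 3 : FExpr).val O s = ((4 * r + 3 : ℕ) : ℤ) := by
    simp only [val_add, val_mul, val_var, val_ofNat, hr]; simp
  have h4 : (2 * var 0 : FExpr).val O s = ((2 * p.n : ℕ) : ℤ) := by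
    simp only [val_mul, val_var, val_ofNat, g.n]; simp
  rw [entryE, val_add, val_add, val_mul, val_mul, val_mul, val_same, val_same,
    signedE_val g hc h0, signedE_val g hc h2, signedE_val g hc h3, codeDigitE_val g hc h1,
    weightE_val g hc hi, val_var, hi, h4, Params.entry]
  simp only [Nat.cast_inj]

theorem letterE_val (g : p.Good s) {c j : ℕ} (hc : s 15 = c) (hj : s 16 = j) :
    letterE.val O s = natDigit (2 * p.n + 1) c j := by
  refine val_baseDigit O s (fun k => ?_) ?_ hc hj
  · simp [val_add, val_mul, val_var, val_ofNat]
  · rw [val_add, val_mul, val_var, val_ofNat, val_ofNat, g.n]; push_cast; rfl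

theorem two_mul_val (x k : ℕ) (h : s x = k) : (2 * var x : FExpr).val O s = ((2 * k : ℕ) : ℤ) := by
  simp only [val_mul, val_var, val_ofNat, h]; simp

theorem wordCoeffE_val (g : p.Good s) {code c : ℕ} (hc : s 10 = code) (hw : s 15 = c) :
    wordCoeffE.val O s = p.wordCoeff code c := by
  rw [wordCoeffE, val_prod, two_mul_val 3 _ g.L, Int.toNat_natCast, Params.wordCoeff]
  refine Finset.prod_congr rfl fun j _ => ?_
  rw [val_letE, val_letE]
  have h1 : (var 16 / 2 : FExpr).val O (Function.update s 16 (j : ℤ)) = ((j / 2 : ℕ) : ℤ) := by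
    simp only [val_div, val_var, val_ofNat]; simp
  rw [h1]
  have g' := (g.update (x := 16) (by norm_num) j).update (x := 14) (by norm_num) ((j / 2 : ℕ) : ℤ)
  rw [letterE_val (c := c) (j := j) g' (by simp [hw]) (by simp)]
  exact entryE_val (g'.update (by norm_num) _) (by simp [hc]) (by simp) (by simp)

theorem wordExpE_val (g : p.Good s) {c i : ℕ} (hw : s 15 = c) (hi : s 17 = i) :
    wordExpE.val O s = p.wordExp c i := by
  rw [wordExpE, val_sum, two_mul_val 3 _ g.L, Int.toNat_natCast, Params.wordExp]
  push_cast
  refine Finset.sum_congr rfl fun j _ => ?_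
  have g' := g.update (x := 16) (by norm_num) j
  rw [val_same, letterE_val (c := c) (j := j) g' (by simp [hw]) (by simp), val_var]
  simp [hi]

theorem wordCountE_val (g : p.Good s) :
    wordCountE.val O s = (((2 * p.n + 1) ^ (2 * p.L) : ℕ) : ℤ) := by
  rw [wordCountE, val_power O s _ _ (fun k => by simp [val_add, val_mul, val_var, val_ofNat]),
    two_mul_val 3 _ g.L, Int.toNat_natCast, val_add, two_mul_val 0 _ g.n, val_ofNat]
  push_cast; rfl

theorem answerE_val (g : p.Good s) {c a b : ℕ} (hw : s 15 = c) (ha : s 18 = a) (hb : s 19 = b) :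
    answerE.val O s = O (p.question c a b) (3 * p.E) := by
  have h1 : (3 * var 4 : FExpr).val O s = ((3 * p.E : ℕ) : ℤ) := by
    simp only [val_mul, val_var, val_ofNat, g.E]; simp
  change O (List.ofFn fun j : Fin ((2 * var 0 : FExpr).val O s).toNat => _)
    ((3 * var 4 : FExpr).val O s).toNat = _
  rw [h1, Int.toNat_natCast]
  have h2 : ((2 * var 0 : FExpr).val O s).toNat = 2 * p.n := by
    rw [two_mul_val 0 _ g.n, Int.toNat_natCast]
  rw [h2]
  congr 1
  unfold Params.question
  congr 1
  funext x
  rw [val_add, val_add, val_same, val_same,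
    wordExpE_val (c := c) (i := x) (g.update (by norm_num) _) (by simp [hw]) (by simp)]
  simp [val_var, ha, hb]

theorem momentE_val (g : p.Good s) {code a b : ℕ} (hc : s 10 = code) (ha : s 18 = a)
    (hb : s 19 = b) : momentE.val O s = p.moment O code a b := by
  rw [momentE, val_sum, wordCountE_val g, Int.toNat_natCast, Params.moment]
  refine Finset.sum_congr rfl fun c _ => ?_
  have g' := g.update (x := 15) (by norm_num) c
  rw [val_mul, wordCoeffE_val (code := code) (c := c) g' (by simp [hc]) (by simp),
    answerE_val (c := c) (a := a) (b := b) g' (by simp) (by simp [ha]) (by simp [hb])]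

theorem momentAtE_val (g : p.Good s) {code a b : ℕ} {x y : FExpr} (hc : s 10 = code)
    (ha : x.val O s = a) (hb : y.val O (Function.update s 18 (a : ℤ)) = b) :
    (momentAtE x y).val O s = p.moment O code a b := by
  rw [momentAtE, val_letE, val_letE, ha, hb]
  exact momentE_val ((g.update (by norm_num) _).update (by norm_num) _) (by simp [hc]) (by simp)
    (by simp)

theorem deviationE_val (g : p.Good s) {code : ℕ} (hc : s 10 = code)
    (hm : s 22 = p.moment O code (2 * p.n) (2 * p.n)) :
    deviationE.val O s = p.deviation O code := by
  rw [deviationE, val_sum, val_var, g.n, Int.toNat_natCast, Params.deviation]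
  refine Finset.sum_congr rfl fun i _ => ?_
  have g1 := g.update (x := 20) (by norm_num) i
  rw [val_sum, val_var, g1.n, Int.toNat_natCast]
  refine Finset.sum_congr rfl fun j _ => ?_
  have g2 := g1.update (x := 21) (by norm_num) j
  have hc2 : Function.update (Function.update s 20 (i : ℤ)) 21 (j : ℤ) 10 = code := by simp [hc]
  simp only [val_letE, val_sub, val_mul]
  rw [momentAtE_val (code := code) (a := i) (b := 2 * p.n) g2 hc2 (by simp [val_var])
      (two_mul_val 0 _ (g2.update (by norm_num) _).n),
    momentAtE_val (code := code) (a := p.n + j) (b := 2 * p.n) g2 hc2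
      (by rw [val_add, val_var, g2.n, val_var]; simp)
      (two_mul_val 0 _ (g2.update (by norm_num) _).n),
    momentAtE_val (code := code) (a := i) (b := p.n + j) g2 hc2 (by simp [val_var])
      (by rw [val_add, val_var, (g2.update (by norm_num) _).n, val_var]; simp)]
  simp [val_var, hm, sq]

theorem signalE_val (g : p.Good s) {code : ℕ} (hc : s 10 = code) :
    signalE.val O s = p.signal O code := by
  rw [signalE, val_sum, val_var, g.n, Int.toNat_natCast, Params.signal]
  refine Finset.sum_congr rfl fun i _ => ?_
  have g1 := g.update (x := 20) (by norm_num) i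
  rw [val_sum, val_var, g1.n, Int.toNat_natCast]
  refine Finset.sum_congr rfl fun j _ => ?_
  have g2 := g1.update (x := 21) (by norm_num) j
  have hc2 : Function.update (Function.update s 20 (i : ℤ)) 21 (j : ℤ) 10 = code := by simp [hc]
  simp only [val_letE, val_mul]
  rw [momentAtE_val (code := code) (a := i) (b := 2 * p.n) g2 hc2 (by simp [val_var])
      (two_mul_val 0 _ (g2.update (by norm_num) _).n),
    momentAtE_val (code := code) (a := p.n + j) (b := 2 * p.n) g2 hc2
      (by rw [val_add, val_var, g2.n, val_var]; simp)
      (two_mul_val 0 _ (g2.update (by norm_num) _).n)]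
  simp [val_var, sq]

open Classical in
theorem acceptsE_val (g : p.Good s) {code : ℕ} (hc : s 10 = code) :
    acceptsE.val O s = if p.Accepts O code then 1 else 0 := by
  rw [acceptsE, val_letE,
    momentAtE_val (code := code) (a := 2 * p.n) (b := 2 * p.n) g hc (two_mul_val 0 _ g.n)
      (two_mul_val 0 _ (g.update (by norm_num) _).n)]
  set s' := Function.update s 22 (p.moment O code (2 * p.n) (2 * p.n)) with hs'
  have g' : p.Good s' := g.update (by norm_num) _
  have hm : s' 22 = p.moment O code (2 * p.n) (2 * p.n) := by simp [hs']
  have hc' : s' 10 = code := by simp [hs', hc]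
  have e1 : (power 2 (2 * var 4) : FExpr).val O s' = 2 ^ (2 * p.E) := by
    rw [val_power O s' _ _ (fun k => rfl), two_mul_val 4 _ g'.E, Int.toNat_natCast]; rfl
  rw [val_mul, val_leq, val_leq, e1, val_add, val_mul, val_mul, val_mul, val_mul, val_mul,
    val_mul, val_mul, val_mul, val_mul, deviationE_val g' hc' hm, signalE_val g' hc',
    val_mul, val_var, val_var, val_var, hm, g'.s, g'.N, val_ofNat]
  have e2 : ∀ x : ℤ, x * x * (x * x) = x ^ 4 := fun x => by ring
  rw [e2]
  simp only [← sq, Nat.cast_ofNat]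
  by_cases hA : p.Accepts O code
  · rw [if_pos hA, if_pos hA.1, if_pos hA.2, one_mul]
  · rw [if_neg hA]
    by_cases h1 : 2 ^ (2 * p.E) ≤ p.moment O code (2 * p.n) (2 * p.n)
    · rw [if_neg fun h2 => hA ⟨h1, h2⟩, mul_zero]
    · rw [if_neg h1, zero_mul]

theorem foundE_val (g : p.Good s) : foundE.val O s = p.found O := by
  classical
  have e1 : (power (2 * var 5) (6 * var 3) : FExpr).val O s =
      (((2 * p.h) ^ (6 * p.L) : ℕ) : ℤ) := by
    have : (6 * var 3 : FExpr).val O s = ((6 * p.L : ℕ) : ℤ) := by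
      simp only [val_mul, val_var, val_ofNat, g.L]; simp
    rw [val_power O s _ _ (fun k => by simp [val_mul, val_var, val_ofNat]), this,
      Int.toNat_natCast, two_mul_val 5 _ g.h]
    push_cast; rfl
  rw [foundE, val_sum, e1, Int.toNat_natCast, Params.found]
  push_cast
  refine Finset.sum_congr rfl fun c _ => ?_
  have g1 := g.update (x := 26) (by norm_num) c
  have e2 : ((var 26 + 1 : FExpr).val O (Function.update s 26 (c : ℤ))) = ((c + 1 : ℕ) : ℤ) := by
    rw [val_add, val_var, val_ofNat]; simp
  rw [val_prod, e2, Int.toNat_natCast]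
  refine Finset.prod_congr rfl fun c' _ => ?_
  rw [val_sub, acceptsE_val (code := c') (g1.update (by norm_num) _) (by simp), val_ofNat]
  split_ifs <;> rfl

end Values

/-! ### The expressions of the search stay within the bounds of `FExpr.Ok`. -/

section Times

variable {p : Params} {O : Oracle} {T : ℕ} {s : ℕ → ℤ}

theorem codeDigitE_ok {i' : ℕ} {i : FExpr} (hi : i.val O s = i') (oi : i.Ok O T s)
    (hT : i' ≤ 2 ^ T) : (codeDigitE i).Ok O T s :=
  ok_baseDigit O s T hi oi trivial ⟨trivial, trivial⟩ (fun _ => ⟨trivial, trivial⟩) hT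

theorem signedE_ok {i' : ℕ} {i : FExpr} (hi : i.val O s = i') (oi : i.Ok O T s)
    (hT : i' ≤ 2 ^ T) : (signedE i).Ok O T s :=
  ⟨codeDigitE_ok hi oi hT, trivial⟩

theorem weightE_ok (g : p.Good s) (f : p.Fits O T) : weightE.Ok O T s := by
  have f1 := f.s_le
  have f2 := f.L_le
  rw [weightE, ok_sum, val_var, g.s, Int.toNat_natCast]
  refine ⟨trivial, by omega, fun l hl => ?_⟩
  have g' := g.update (x := 12) (by norm_num) l
  have h1 : (4 * var 3 + 2 * var 12 : FExpr).val O (Function.update s 12 (l : ℤ)) =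
      ((4 * p.L + 2 * l : ℕ) : ℤ) := by
    simp only [val_add, val_mul, val_var, val_ofNat, g'.L]; simp
  have h2 : (4 * var 3 + 2 * var 12 + 1 : FExpr).val O (Function.update s 12 (l : ℤ)) =
      ((4 * p.L + 2 * l + 1 : ℕ) : ℤ) := by
    rw [val_add, h1, val_ofNat]; simp
  rw [ok_mul, ok_same]
  exact ⟨⟨codeDigitE_ok h1 ⟨⟨trivial, trivial⟩, trivial, trivial⟩ (by omega), trivial⟩,
    signedE_ok h2 ⟨⟨⟨trivial, trivial⟩, trivial, trivial⟩, trivial⟩ (by omega)⟩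

theorem entryE_ok (g : p.Good s) (f : p.Fits O T) {r : ℕ} (hr : s 14 = r) (hrL : r < p.L) :
    entryE.Ok O T s := by
  have f2 := f.L_le
  have h0 : (4 * var 14 : FExpr).val O s = ((4 * r : ℕ) : ℤ) := by
    simp only [val_mul, val_var, val_ofNat, hr]; simp
  have h1 : (4 * var 14 + 1 : FExpr).val O s = ((4 * r + 1 : ℕ) : ℤ) := by
    simp only [val_add, val_mul, val_var, val_ofNat, hr]; simp
  have h2 : (4 * var 14 + 2 : FExpr).val O s = ((4 * r + 2 : ℕ) : ℤ) := by
    simp only [val_add, val_mul, val_var, val_ofNat, hr]; simp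
  have h3 : (4 * var 14 + 3 : FExpr).val O s = ((4 * r + 3 : ℕ) : ℤ) := by
    simp only [val_add, val_mul, val_var, val_ofNat, hr]; simp
  rw [entryE, ok_add, ok_add, ok_mul, ok_mul, ok_mul, ok_same, ok_same]
  exact ⟨⟨⟨signedE_ok h0 ⟨trivial, trivial⟩ (by omega), weightE_ok g f⟩,
    ⟨codeDigitE_ok h1 ⟨⟨trivial, trivial⟩, trivial⟩ (by omega), trivial⟩,
    signedE_ok h2 ⟨⟨trivial, trivial⟩, trivial⟩ (by omega)⟩,
    ⟨trivial, trivial, trivial⟩, signedE_ok h3 ⟨⟨trivial, trivial⟩, trivial⟩ (by omega)⟩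

theorem letterE_ok {j : ℕ} (hj : s 16 = j) (hT : j ≤ 2 ^ T) : letterE.Ok O T s :=
  ok_baseDigit O s T hj trivial trivial ⟨⟨trivial, trivial⟩, trivial⟩
    (fun _ => ⟨⟨trivial, trivial⟩, trivial⟩) hT

theorem wordCoeffE_ok (g : p.Good s) (f : p.Fits O T) : wordCoeffE.Ok O T s := by
  have f2 := f.L_le
  rw [wordCoeffE, ok_prod, two_mul_val 3 _ g.L, Int.toNat_natCast]
  refine ⟨⟨trivial, trivial⟩, by omega, fun j hj => ?_⟩
  rw [ok_letE, ok_letE]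
  have h1 : (var 16 / 2 : FExpr).val O (Function.update s 16 (j : ℤ)) = ((j / 2 : ℕ) : ℤ) := by
    simp only [val_div, val_var, val_ofNat]; simp
  rw [h1]
  have g' := (g.update (x := 16) (by norm_num) j).update (x := 14) (by norm_num) ((j / 2 : ℕ) : ℤ)
  exact ⟨⟨trivial, trivial⟩, letterE_ok (j := j) (by simp) (by omega),
    entryE_ok (r := j / 2) (g'.update (by norm_num) _) f (by simp) (by omega)⟩

theorem wordExpE_ok (g : p.Good s) (f : p.Fits O T) : wordExpE.Ok O T s := by
  have f2 := f.L_le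
  rw [wordExpE, ok_sum, two_mul_val 3 _ g.L, Int.toNat_natCast]
  refine ⟨⟨trivial, trivial⟩, by omega, fun j hj => ?_⟩
  rw [ok_same]
  exact ⟨letterE_ok (j := j) (by simp) (by omega), trivial⟩

theorem wordCountE_ok (g : p.Good s) (f : p.Fits O T) : wordCountE.Ok O T s := by
  have f2 := f.L_le
  rw [wordCountE, power, ok_prod, two_mul_val 3 _ g.L, Int.toNat_natCast]
  exact ⟨⟨trivial, trivial⟩, by omega, fun _ _ => ⟨⟨trivial, trivial⟩, trivial⟩⟩

theorem answerE_ok (g : p.Good s) (f : p.Fits O T) {c a b : ℕ} (hw : s 15 = c) (ha : s 18 = a)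
    (hb : s 19 = b) (hc : c < (2 * p.n + 1) ^ (2 * p.L)) (ha' : a ≤ 2 * p.n) (hb' : b ≤ 2 * p.n) :
    answerE.Ok O T s := by
  have h1 : (3 * var 4 : FExpr).val O s = ((3 * p.E : ℕ) : ℤ) := by
    simp only [val_mul, val_var, val_ofNat, g.E]; simp
  have h2 : ((2 * var 0 : FExpr).val O s).toNat = 2 * p.n := by
    rw [two_mul_val 0 _ g.n, Int.toNat_natCast]
  refine ⟨⟨trivial, trivial⟩, ⟨trivial, trivial⟩, ?_, ?_, ?_, fun k _ => ?_⟩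
  · rw [h2]; exact f.n_le
  · rw [h1, Int.toNat_natCast]; exact f.E_le
  · rw [← answerE, answerE_val g hw ha hb]
    exact f.answer_le c hc a ha' b hb'
  · rw [ok_add, ok_add, ok_same, ok_same]
    exact ⟨⟨wordExpE_ok (g.update (by norm_num) _) f, trivial, trivial⟩, trivial, trivial⟩

theorem momentE_ok (g : p.Good s) (f : p.Fits O T) {a b : ℕ} (ha : s 18 = a) (hb : s 19 = b)
    (ha' : a ≤ 2 * p.n) (hb' : b ≤ 2 * p.n) : momentE.Ok O T s := by
  rw [momentE, ok_sum, wordCountE_val g, Int.toNat_natCast]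
  refine ⟨wordCountE_ok g f, f.words_le, fun c hc => ?_⟩
  have g' := g.update (x := 15) (by norm_num) c
  rw [ok_mul]
  exact ⟨wordCoeffE_ok g' f, answerE_ok (c := c) (a := a) (b := b) g' f (by simp) (by simp [ha])
    (by simp [hb]) hc ha' hb'⟩

theorem momentAtE_ok (g : p.Good s) (f : p.Fits O T) {a b : ℕ} {x y : FExpr}
    (ha : x.val O s = a) (hb : y.val O (Function.update s 18 (a : ℤ)) = b)
    (ox : x.Ok O T s) (oy : y.Ok O T (Function.update s 18 (a : ℤ)))
    (ha' : a ≤ 2 * p.n) (hb' : b ≤ 2 * p.n) : (momentAtE x y).Ok O T s := by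
  rw [momentAtE, ok_letE, ok_letE, ha, hb]
  exact ⟨ox, oy, momentE_ok ((g.update (by norm_num) _).update (by norm_num) _) f (by simp)
    (by simp) ha' hb'⟩

theorem momentAtE_two_mul_ok (g : p.Good s) (f : p.Fits O T) {a : ℕ} {x : FExpr}
    (ha : x.val O s = a) (ox : x.Ok O T s) (ha' : a ≤ 2 * p.n) :
    (momentAtE x (2 * var 0)).Ok O T s :=
  momentAtE_ok g f ha (two_mul_val 0 _ (g.update (by norm_num) _).n) ox ⟨trivial, trivial⟩ ha' le_rfl

theorem deviationE_ok (g : p.Good s) (f : p.Fits O T) : deviationE.Ok O T s := by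
  have f1 := f.n_le
  rw [deviationE, ok_sum, val_var, g.n, Int.toNat_natCast]
  refine ⟨trivial, by omega, fun i hi => ?_⟩
  have g1 := g.update (x := 20) (by norm_num) i
  rw [ok_sum, val_var, g1.n, Int.toNat_natCast]
  refine ⟨trivial, by omega, fun j hj => ?_⟩
  have g2 := g1.update (x := 21) (by norm_num) j
  rw [ok_letE, ok_sub, ok_mul, ok_mul]
  exact ⟨⟨⟨momentAtE_two_mul_ok (a := i) g2 f (by simp [val_var]) trivial (by omega),
    momentAtE_two_mul_ok (a := p.n + j) g2 f (by rw [val_add, val_var, g2.n, val_var]; simp)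
      ⟨trivial, trivial⟩ (by omega)⟩, trivial,
    momentAtE_ok (a := i) (b := p.n + j) g2 f (by simp [val_var])
      (by rw [val_add, val_var, (g2.update (by norm_num) _).n, val_var]; simp) trivial
      ⟨trivial, trivial⟩ (by omega) (by omega)⟩, trivial, trivial⟩

theorem signalE_ok (g : p.Good s) (f : p.Fits O T) : signalE.Ok O T s := by
  have f1 := f.n_le
  rw [signalE, ok_sum, val_var, g.n, Int.toNat_natCast]
  refine ⟨trivial, by omega, fun i hi => ?_⟩
  have g1 := g.update (x := 20) (by norm_num) i
  rw [ok_sum, val_var, g1.n, Int.toNat_natCast]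
  refine ⟨trivial, by omega, fun j hj => ?_⟩
  have g2 := g1.update (x := 21) (by norm_num) j
  rw [ok_letE, ok_mul]
  exact ⟨⟨momentAtE_two_mul_ok (a := i) g2 f (by simp [val_var]) trivial (by omega),
    momentAtE_two_mul_ok (a := p.n + j) g2 f (by rw [val_add, val_var, g2.n, val_var]; simp)
      ⟨trivial, trivial⟩ (by omega)⟩, trivial, trivial⟩

theorem acceptsE_ok (g : p.Good s) (f : p.Fits O T) : acceptsE.Ok O T s := by
  have f1 := f.E_le
  rw [acceptsE, ok_letE]
  refine ⟨momentAtE_two_mul_ok g f (two_mul_val 0 _ g.n) ⟨trivial, trivial⟩ le_rfl, ?_⟩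
  have g' := g.update (x := 22) (by norm_num)
    ((momentAtE (2 * var 0) (2 * var 0)).val O s)
  rw [ok_mul, ok_leq, ok_leq, power, ok_prod, two_mul_val 4 _ g'.E, Int.toNat_natCast]
  exact ⟨⟨⟨⟨trivial, trivial⟩, by omega, fun _ _ => trivial⟩, trivial⟩,
    ⟨⟨⟨⟨trivial, trivial, trivial⟩, trivial, trivial⟩, deviationE_ok g' f⟩,
      ⟨trivial, trivial⟩, trivial, trivial⟩, ⟨trivial, trivial, trivial⟩, signalE_ok g' f⟩

theorem foundE_ok (g : p.Good s) (f : p.Fits O T) : foundE.Ok O T s := by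
  have h6 : (6 * var 3 : FExpr).val O s = ((6 * p.L : ℕ) : ℤ) := by
    simp only [val_mul, val_var, val_ofNat, g.L]; simp
  have e1 : (power (2 * var 5) (6 * var 3) : FExpr).val O s =
      (((2 * p.h) ^ (6 * p.L) : ℕ) : ℤ) := by
    rw [val_power O s _ _ (fun k => by simp [val_mul, val_var, val_ofNat]), h6,
      Int.toNat_natCast, two_mul_val 5 _ g.h]
    push_cast; rfl
  have f1 := f.codes_le
  rw [foundE, ok_sum, e1, Int.toNat_natCast]
  refine ⟨?_, f1, fun c hc => ?_⟩
  · rw [power, ok_prod, h6, Int.toNat_natCast]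
    exact ⟨⟨trivial, trivial⟩, f.L_le, fun _ _ => ⟨trivial, trivial⟩⟩
  · have g1 := g.update (x := 26) (by norm_num) c
    have e2 : ((var 26 + 1 : FExpr).val O (Function.update s 26 (c : ℤ))) = ((c + 1 : ℕ) : ℤ) := by
      rw [val_add, val_var, val_ofNat]; simp
    rw [ok_prod, e2, Int.toNat_natCast]
    exact ⟨⟨trivial, trivial⟩, by omega,
      fun c' _ => ⟨trivial, acceptsE_ok (g1.update (by norm_num) _) f⟩⟩

end Times

end LogCost

namespace LogCost

open FExpr

/-! ### The program -/

/-- The parameters of the search. -/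
def searchParams (n N : ℕ) : Params where
  n := n
  N := N
  s := Nat.sqrt (n - 1) + 1
  L := 1000000 * (Nat.sqrt (n - 1) + 1) * Nat.clog 2 n * (N * N)
  E := 100 * (1000000 * (Nat.sqrt (n - 1) + 1) * Nat.clog 2 n * (N * N)) * Nat.clog 2 n
  h := 8000 * (n * n * n)

/-- Expression for the least integer whose square is at least the integer in variable `0`. -/
def ceilSqrtE : FExpr := FExpr.sum 12 (var 0) (less (var 12 * var 12) (var 0))

/-- Expression for the binary logarithm, rounded up, of the integer in variable `0`. -/
def clogE : FExpr := FExpr.sum 12 (var 0) (less (power 2 (var 12)) (var 0))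

/-- Compute the parameters of the search, then `e`. -/
def withParams (e : FExpr) : FExpr :=
  letE 2 ceilSqrtE (letE 6 clogE (letE 3 (1000000 * var 2 * var 6 * (var 1 * var 1))
    (letE 4 (100 * var 3 * var 6) (letE 5 (8000 * (var 0 * var 0 * var 0)) e))))

/-- The environment in which `withParams` evaluates its argument. -/
def paramEnv (n N : ℕ) (s : ℕ → ℤ) : ℕ → ℤ :=
  Function.update (Function.update (Function.update (Function.update (Function.update s
    2 ((searchParams n N).s : ℤ)) 6 (Nat.clog 2 n : ℤ)) 3 ((searchParams n N).L : ℤ))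
    4 ((searchParams n N).E : ℤ)) 5 ((searchParams n N).h : ℤ)

/-! ### Computing the parameters from the input. -/

section Params

variable {O : Oracle} {s : ℕ → ℤ} {n N T : ℕ}

theorem sum_range_ite_lt {b : ℕ} {P : ℕ → Prop} [DecidablePred P] (k : ℕ) (hk : k ≤ b)
    (h : ∀ j < b, P j ↔ j < k) : ∑ j ∈ Finset.range b, (if P j then (1 : ℤ) else 0) = k := by
  rw [Finset.sum_boole]
  have e : (Finset.range b).filter P = Finset.range k := by
    ext j
    simp only [Finset.mem_filter, Finset.mem_range]
    constructor
    · rintro ⟨h1, h2⟩; exact (h j h1).1 h2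
    · intro h1; exact ⟨by omega, (h j (by omega)).2 h1⟩
  rw [e, Finset.card_range]

/-- The value `⌈√n⌉` is the number of `j < n` with `j² < n`; the logarithm below is counted in the
same way. -/
theorem ceilSqrtE_val (hn : 2 ≤ n) (h0 : s 0 = n) :
    ceilSqrtE.val O s = ((Nat.sqrt (n - 1) + 1 : ℕ) : ℤ) := by
  rw [ceilSqrtE, val_sum, val_var, h0, Int.toNat_natCast]
  rw [← sum_range_ite_lt (b := n) (P := fun j => j * j < n) (Nat.sqrt (n - 1) + 1)]
  · refine Finset.sum_congr rfl fun j _ => ?_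
    rw [val_less, val_mul, val_var, val_var, Function.update_self,
      Function.update_of_ne (by norm_num), h0]
    norm_cast
  · have := Nat.sqrt_le_self (n - 1)
    omega
  · intro j _
    have := Nat.le_sqrt (m := j) (n := n - 1)
    omega

theorem clogE_val (h0 : s 0 = n) : clogE.val O s = (Nat.clog 2 n : ℤ) := by
  rw [clogE, val_sum, val_var, h0, Int.toNat_natCast]
  rw [← sum_range_ite_lt (b := n) (P := fun j => 2 ^ j < n) (Nat.clog 2 n)]
  · refine Finset.sum_congr rfl fun j _ => ?_
    rw [val_less, val_power O _ _ _ (fun _ => rfl), val_var, val_var, Function.update_self,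
      Function.update_of_ne (by norm_num), h0, Int.toNat_natCast, val_ofNat]
    norm_cast
  · exact Nat.clog_le_of_le_pow Nat.lt_two_pow_self.le
  · intro j _
    exact (Nat.lt_clog_iff_pow_lt (by norm_num)).symm

theorem withParams_val (e : FExpr) (hn : 2 ≤ n) (h0 : s 0 = n) (h1 : s 1 = N) :
    (withParams e).val O s = e.val O (paramEnv n N s) := by
  simp only [withParams, val_letE]
  rw [ceilSqrtE_val hn h0, clogE_val (n := n) (by simp [h0])]
  simp only [val_mul, val_var, val_ofNat]
  simp [paramEnv, searchParams, h0, h1]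

theorem paramEnv_good (h0 : s 0 = n) (h1 : s 1 = N) :
    (searchParams n N).Good (paramEnv n N s) := by
  constructor <;> simp [paramEnv, searchParams, h0, h1]

theorem paramEnv_of_lt {x : ℕ} (hx : 7 ≤ x) : paramEnv n N s x = s x := by
  unfold paramEnv
  iterate 5 rw [Function.update_of_ne (by omega)]

theorem ceilSqrtE_ok (h0 : s 0 = n) (hT : n ≤ 2 ^ T) : ceilSqrtE.Ok O T s := by
  rw [ceilSqrtE, ok_sum, val_var, h0, Int.toNat_natCast]
  exact ⟨trivial, hT, fun _ _ => ⟨⟨trivial, trivial⟩, trivial⟩⟩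

theorem clogE_ok (h0 : s 0 = n) (hT : n ≤ 2 ^ T) : clogE.Ok O T s := by
  rw [clogE, ok_sum, val_var, h0, Int.toNat_natCast]
  refine ⟨trivial, hT, fun j hj => ⟨?_, trivial⟩⟩
  rw [power, ok_prod, val_var, Function.update_self, Int.toNat_natCast]
  exact ⟨trivial, by omega, fun _ _ => trivial⟩

theorem withParams_ok (e : FExpr) (hn : 2 ≤ n) (h0 : s 0 = n) (h1 : s 1 = N) (hT : n ≤ 2 ^ T)
    (he : e.Ok O T (paramEnv n N s)) : (withParams e).Ok O T s := by
  simp only [withParams, ok_letE]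
  refine ⟨ceilSqrtE_ok h0 hT, clogE_ok (n := n) (by simp [h0]) hT,
    ⟨⟨⟨trivial, trivial⟩, trivial⟩, trivial, trivial⟩, ⟨⟨trivial, trivial⟩, trivial⟩,
    ⟨trivial, ⟨trivial, trivial⟩, trivial⟩, ?_⟩
  rw [ceilSqrtE_val hn h0, clogE_val (n := n) (by simp [h0])]
  simp only [val_mul, val_var, val_ofNat]
  simpa [paramEnv, searchParams, h0, h1] using he

end Params

/-- The number of terms of the output. -/
def termCountE : FExpr := withParams wordCountE

/-- The coefficient number `30` of the output. -/
def termCoeffE : FExpr := withParams (letE 10 foundE (letE 15 (var 30) wordCoeffE))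

/-- The number of exponents of the output. -/
def expCountE : FExpr := withParams (2 * var 0 * wordCountE)

/-- The exponent number `30` of the output. -/
def termExpE : FExpr := withParams (letE 15 (var 30 / (2 * var 0))
  (letE 17 (var 30 - 2 * var 0 * var 15) wordExpE))

/-- The arrays that hold the input. -/
def inputArray (x : ℕ) : ℕ := if x = 1 then 1 else 0

/-- The values of the input. -/
def inputEnv (n N : ℕ) (x : ℕ) : ℤ := if x = 1 then N else n

/-- The program that searches a reweighting polynomial and lists its terms. -/
def searchProg : Prog :=
  .seq (fill 2 30 1 termCountE inputArray 6) (.seq (fill 4 30 termCountE termCoeffE inputArray 6)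
    (.seq (fill 5 30 termCountE 1 inputArray 6) (fill 3 30 expCountE termExpE inputArray 6)))

/-- The exponent of the running time of `searchProg`. -/
def searchRank : ℕ :=
  (FExpr.rank 1 (fun _ => 1) + termCountE.rank (Function.update (fun _ => 1) 30 1) + 4)
  + (termCountE.rank (fun _ => 1) + termCoeffE.rank (Function.update (fun _ => 1) 30 1) + 4)
  + (termCountE.rank (fun _ => 1) + FExpr.rank 1 (Function.update (fun _ => 1) 30 1) + 4)
  + (expCountE.rank (fun _ => 1) + termExpE.rank (Function.update (fun _ => 1) 30 1) + 4)

/-- The input stays untouched in the arrays 0 and 1 and the workspace starts at 6, so the four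
passes that fill the arrays 2, 4, 5 and 3 are independent. The whole search is repeated for every
coefficient, which only adds to the rank. -/
theorem searchProg_spec (O : Oracle) {n N T : ℕ} (hn : 2 ≤ n) (hT : 6 ≤ T) (hN : N ≤ 2 ^ T)
    (f : (searchParams n N).Fits O T)
    (hterms : 2 * n * (2 * n + 1) ^ (2 * (searchParams n N).L) ≤ 2 ^ T) :
    ∃ s t, Exec O searchProg (input n N) s t ∧ t ≤ 2 ^ ((searchRank + 1) * T) ∧
      s 2 0 = (((2 * n + 1) ^ (2 * (searchParams n N).L) : ℕ) : ℤ) ∧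
      ∀ c < (2 * n + 1) ^ (2 * (searchParams n N).L),
        s 4 c = (searchParams n N).wordCoeff ((searchParams n N).found O) c ∧ s 5 c = 1 ∧
        ∀ i < 2 * n, s 3 (2 * n * c + i) = (searchParams n N).wordExp c i := by
  set p := searchParams n N with hp
  set M := (2 * n + 1) ^ (2 * p.L) with hM
  have hnT : n ≤ 2 ^ T := by have : 2 * n ≤ 2 ^ T := f.n_le; omega
  have hM1 : 1 ≤ M := Nat.one_le_pow _ _ (by omega)
  have e0 : inputEnv n N 0 = n := rfl
  have e1 : inputEnv n N 1 = N := rfl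
  have u0 : ∀ k : ℤ, Function.update (inputEnv n N) 30 k 0 = n := fun k => by simp [e0]
  have u1 : ∀ k : ℤ, Function.update (inputEnv n N) 30 k 1 = N := fun k => by simp [e1]
  have hr : ∀ x, bits (inputEnv n N x) ≤ 2 ^ ((fun _ : ℕ => 1) x * T + 1) := by
    intro x
    unfold inputEnv
    split_ifs
    exacts [bits_le_two_pow (by omega) hN, bits_le_two_pow (by omega) hnT]
  have holds : ∀ s : Store, s 0 = input n N 0 → s 1 = input n N 1 →
      Holds inputArray 6 s (inputEnv n N) := by
    intro s h0 h1 x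
    unfold inputArray inputEnv
    split_ifs
    · exact ⟨by norm_num, by rw [h1]; simp [input, Store.write]⟩
    · exact ⟨by norm_num, by rw [h0]; simp [input, Store.write]⟩
  have ρne : ∀ a, 2 ≤ a → ∀ y, inputArray y ≠ a := by
    intro a ha y
    unfold inputArray
    split_ifs <;> omega
  have cval : ∀ s : ℕ → ℤ, s 0 = n → s 1 = N → termCountE.val O s = (M : ℤ) := by
    intro s h0 h1
    rw [termCountE, withParams_val _ hn h0 h1, wordCountE_val (paramEnv_good h0 h1)]
    rfl
  have cok : ∀ s : ℕ → ℤ, s 0 = n → s 1 = N → termCountE.Ok O T s := fun s h0 h1 =>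
    withParams_ok _ hn h0 h1 hnT (wordCountE_ok (paramEnv_good h0 h1) f)
  have xval : expCountE.val O (inputEnv n N) = ((2 * n * M : ℕ) : ℤ) := by
    rw [expCountE, withParams_val _ hn e0 e1, val_mul, wordCountE_val (paramEnv_good e0 e1),
      two_mul_val 0 n (paramEnv_good e0 e1).n]
    push_cast [hM]; rfl
  have xok : expCountE.Ok O T (inputEnv n N) :=
    withParams_ok _ hn e0 e1 hnT ⟨⟨trivial, trivial⟩, wordCountE_ok (paramEnv_good e0 e1) f⟩
  have aval : ∀ k : ℕ, termCoeffE.val O (Function.update (inputEnv n N) 30 (k : ℤ)) =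
      p.wordCoeff (p.found O) k := by
    intro k
    have g := paramEnv_good (u0 k) (u1 k)
    rw [termCoeffE, withParams_val _ hn (u0 k) (u1 k), val_letE, val_letE, foundE_val g]
    refine wordCoeffE_val ((g.update (by norm_num) _).update (by norm_num) _) (by simp [hp]) ?_
    simp [val_var, paramEnv_of_lt (show 7 ≤ 30 by norm_num)]
  have aok : ∀ k : ℕ, termCoeffE.Ok O T (Function.update (inputEnv n N) 30 (k : ℤ)) := by
    intro k
    have g := paramEnv_good (u0 k) (u1 k)
    refine withParams_ok _ hn (u0 k) (u1 k) hnT ⟨foundE_ok g f, trivial, ?_⟩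
    exact wordCoeffE_ok ((g.update (by norm_num) _).update (by norm_num) _) f
  have dval : ∀ c i : ℕ, i < 2 * n →
      termExpE.val O (Function.update (inputEnv n N) 30 ((2 * n * c + i : ℕ) : ℤ)) =
      p.wordExp c i := by
    intro c i hi
    set k := 2 * n * c + i with hk
    have g := paramEnv_good (u0 k) (u1 k)
    have hdiv : k / (2 * n) = c := by
      rw [hk, Nat.mul_add_div (by omega), Nat.div_eq_of_lt hi, add_zero]
    have v1 : (var 30 / (2 * var 0) : FExpr).val O
        (paramEnv n N (Function.update (inputEnv n N) 30 (k : ℤ))) = (c : ℤ) := by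
      rw [val_div, val_var, two_mul_val 0 n g.n, paramEnv_of_lt (by norm_num),
        Function.update_self, ← hdiv]
      push_cast; rfl
    rw [termExpE, withParams_val _ hn (u0 k) (u1 k), val_letE, v1, val_letE]
    have v2 : (var 30 - 2 * var 0 * var 15 : FExpr).val O (Function.update
        (paramEnv n N (Function.update (inputEnv n N) 30 (k : ℤ))) 15 (c : ℤ)) = (i : ℤ) := by
      rw [val_sub, val_mul, two_mul_val 0 n (g.update (by norm_num) _).n, val_var, val_var,
        Function.update_self, Function.update_of_ne (by norm_num), paramEnv_of_lt (by norm_num),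
        Function.update_self, hk]
      push_cast; ring
    rw [v2]
    exact wordExpE_val ((g.update (by norm_num) _).update (by norm_num) _) (by simp) (by simp)
  have dok : ∀ k : ℕ, termExpE.Ok O T (Function.update (inputEnv n N) 30 (k : ℤ)) := by
    intro k
    have g := paramEnv_good (u0 k) (u1 k)
    refine withParams_ok _ hn (u0 k) (u1 k) hnT ⟨⟨trivial, trivial, trivial⟩,
      ⟨trivial, ⟨trivial, trivial⟩, trivial⟩, ?_⟩
    exact wordExpE_ok ((g.update (by norm_num) _).update (by norm_num) _) f
  have onev : (1 : FExpr).val O (inputEnv n N) = 1 := rfl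
  obtain ⟨s1, x1, v1, k1⟩ := fill_spec O 2 30 1 termCountE inputArray 6 (input n N) (inputEnv n N)
    (holds _ rfl rfl) (by norm_num) (ρne 2 (by norm_num))
  obtain ⟨s2, x2, v2, k2⟩ := fill_spec O 4 30 termCountE termCoeffE inputArray 6 s1 (inputEnv n N)
    (holds _ (k1 0 (by norm_num) (by norm_num)) (k1 1 (by norm_num) (by norm_num)))
    (by norm_num) (ρne 4 (by norm_num))
  obtain ⟨s3, x3, v3, k3⟩ := fill_spec O 5 30 termCountE 1 inputArray 6 s2 (inputEnv n N)
    (holds _ ((k2 0 (by norm_num) (by norm_num)).trans (k1 0 (by norm_num) (by norm_num)))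
      ((k2 1 (by norm_num) (by norm_num)).trans (k1 1 (by norm_num) (by norm_num))))
    (by norm_num) (ρne 5 (by norm_num))
  obtain ⟨s4, x4, v4, k4⟩ := fill_spec O 3 30 expCountE termExpE inputArray 6 s3 (inputEnv n N)
    (holds _ ((k3 0 (by norm_num) (by norm_num)).trans
        ((k2 0 (by norm_num) (by norm_num)).trans (k1 0 (by norm_num) (by norm_num))))
      ((k3 1 (by norm_num) (by norm_num)).trans
        ((k2 1 (by norm_num) (by norm_num)).trans (k1 1 (by norm_num) (by norm_num)))))
    (by norm_num) (ρne 3 (by norm_num))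
  have t1 := fillTime_le O hT 30 1 termCountE (inputEnv n N) (fun _ => 1) hr trivial
    (by rw [onev]; exact Nat.one_le_two_pow) (fun k _ => cok _ (u0 k) (u1 k))
  have t2 := fillTime_le O hT 30 termCountE termCoeffE (inputEnv n N) (fun _ => 1) hr
    (cok _ e0 e1) (by rw [cval _ e0 e1, Int.toNat_natCast]; exact f.words_le) (fun k _ => aok k)
  have t3 := fillTime_le O hT 30 termCountE 1 (inputEnv n N) (fun _ => 1) hr
    (cok _ e0 e1) (by rw [cval _ e0 e1, Int.toNat_natCast]; exact f.words_le) (fun k _ => trivial)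
  have t4 := fillTime_le O hT 30 expCountE termExpE (inputEnv n N) (fun _ => 1) hr
    xok (by rw [xval, Int.toNat_natCast]; exact hterms) (fun k _ => dok k)
  rw [cval _ e0 e1, Int.toNat_natCast] at v2 v3
  rw [xval, Int.toNat_natCast] at v4
  refine ⟨s4, _, Exec.seq _ _ _ _ _ _ _ x1 (Exec.seq _ _ _ _ _ _ _ x2
    (Exec.seq _ _ _ _ _ _ _ x3 x4)), ?_, ?_, fun c hc => ⟨?_, ?_, fun i hi => ?_⟩⟩
  · have h5 := mul_two_pow_le (a := 4) (c := searchRank) hT (by norm_num) le_rfl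
    have b1 := t1.trans (two_pow_le_of_rank_le (d := searchRank) (by unfold searchRank; omega))
    have b2 := t2.trans (two_pow_le_of_rank_le (d := searchRank) (by unfold searchRank; omega))
    have b3 := t3.trans (two_pow_le_of_rank_le (d := searchRank) (by unfold searchRank; omega))
    have b4 := t4.trans (two_pow_le_of_rank_le (d := searchRank) (by unfold searchRank; omega))
    omega
  · rw [k4 2 (by norm_num) (by norm_num), k3 2 (by norm_num) (by norm_num),
      k2 2 (by norm_num) (by norm_num)]
    exact (v1 0 (by rw [onev]; norm_num)).trans (cval _ (u0 _) (u1 _))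
  · rw [k4 4 (by norm_num) (by norm_num), k3 4 (by norm_num) (by norm_num), v2 c hc, aval]
  · rw [k4 5 (by norm_num) (by norm_num), v3 c hc]
    rfl
  · rw [v4 (2 * n * c + i) (by nlinarith), dval c i hi]

end LogCost

/-! ### Expanding candidates over words, and bounds for pseudo-moments. -/

section Words

open MvPolynomial LogCost

/-- Expansion of a product of sums over the words of letters `0, …, m - 1`. -/
theorem prod_range_sum_range {R : Type*} [CommSemiring R] (m K : ℕ) (f : ℕ → ℕ → R) :
    ∏ j ∈ Finset.range K, ∑ i ∈ Finset.range m, f j i =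
      ∑ c ∈ Finset.range (m ^ K), ∏ j ∈ Finset.range K, f j (natDigit m c j) := by
  calc ∏ j ∈ Finset.range K, ∑ i ∈ Finset.range m, f j i
      = ∏ j : Fin K, ∑ i : Fin m, f j i := by
        rw [← Fin.prod_univ_eq_prod_range (fun j => ∑ i ∈ Finset.range m, f j i)]
        exact Finset.prod_congr rfl fun j _ => (Fin.sum_univ_eq_sum_range (f j) m).symm
    _ = ∑ φ : Fin K → Fin m, ∏ j : Fin K, f j (φ j) := by
        rw [Finset.prod_univ_sum, Fintype.piFinset_univ]
    _ = ∑ c : Fin (m ^ K), ∏ j : Fin K, f j (natDigit m c j) :=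
        (Equiv.sum_comp finFunctionFinEquiv.symm fun φ : Fin K → Fin m =>
          ∏ j : Fin K, f j (φ j)).symm
    _ = _ := by
        rw [← Fin.sum_univ_eq_sum_range fun c => ∏ j ∈ Finset.range K, f j (natDigit m c j)]
        exact Finset.sum_congr rfl fun c _ =>
          Fin.prod_univ_eq_prod_range (fun j => f j (natDigit m c j)) K

/-- Every sequence of digits is the sequence of digits of a number. -/
theorem exists_natDigit_eq (q K : ℕ) (φ : ℕ → ℕ) (hφ : ∀ i < K, φ i < q) :
    ∃ c < q ^ K, ∀ i < K, natDigit q c i = φ i := by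
  let ψ : Fin K → Fin q := fun i => ⟨φ i, hφ i i.2⟩
  refine ⟨finFunctionFinEquiv ψ, (finFunctionFinEquiv ψ).2, fun i hi => ?_⟩
  have h := congrFun (finFunctionFinEquiv.symm_apply_apply ψ) ⟨i, hi⟩
  exact congrArg Fin.val h

/-- The positions `2 r` and `2 r + 1` of a word both belong to row `r`; this is how words of `2 L`
letters encode the square of a product of `L` rows. -/
theorem prod_range_two_mul_div {R : Type*} [CommMonoid R] (L : ℕ) (f : ℕ → R) :
    ∏ j ∈ Finset.range (2 * L), f (j / 2) = (∏ r ∈ Finset.range L, f r) ^ 2 := by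
  induction L with
  | zero => simp
  | succ L ih =>
    rw [show 2 * (L + 1) = 2 * L + 1 + 1 by ring, Finset.prod_range_succ, Finset.prod_range_succ,
      ih, Finset.prod_range_succ, show (2 * L + 1) / 2 = L by omega, show 2 * L / 2 = L by omega,
      mul_pow, sq (f L), mul_assoc]

/-- The number of a coordinate. -/
def coordIndex {n : ℕ} : PairVar n → ℕ := Sum.elim (fun i => i) (fun i => n + i)

/-- The exponents of the letter number `i`: a coordinate if `i < 2 n`, and the constant `1` if
`i = 2 n`. -/
noncomputable def letterExp (n i : ℕ) : PairVar n →₀ ℕ :=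
  Finsupp.equivFunOnFinite.symm fun v => if coordIndex v = i then 1 else 0

theorem coordIndex_injective {n : ℕ} : Function.Injective (coordIndex (n := n)) := by
  rintro (i | i) (j | j) h <;> simp only [coordIndex, Sum.elim_inl, Sum.elim_inr] at h
  · rw [Fin.ext h]
  · have := i.2; omega
  · have := j.2; omega
  · rw [Fin.ext (by omega : (i : ℕ) = j)]

theorem coordIndex_lt {n : ℕ} (v : PairVar n) : coordIndex v < 2 * n := by
  rcases v with i | i <;> simp only [coordIndex, Sum.elim_inl, Sum.elim_inr] <;>
    have := i.2 <;> omega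

theorem letterExp_coordIndex {n : ℕ} (v : PairVar n) :
    letterExp n (coordIndex v) = Finsupp.single v 1 := by
  ext w
  rw [letterExp, Finsupp.equivFunOnFinite_symm_apply_apply, Finsupp.single_apply]
  simp only [coordIndex_injective.eq_iff, eq_comm]

theorem letterExp_two_mul (n : ℕ) : letterExp n (2 * n) = 0 := by
  ext w
  rw [letterExp, Finsupp.equivFunOnFinite_symm_apply_apply, if_neg (coordIndex_lt w).ne]
  rfl

theorem exists_coordIndex_eq {n i : ℕ} (hi : i < 2 * n) : ∃ v : PairVar n, coordIndex v = i := by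
  by_cases h : i < n
  · exact ⟨Sum.inl ⟨i, h⟩, rfl⟩
  · exact ⟨Sum.inr ⟨i - n, by omega⟩, by simp only [coordIndex, Sum.elim_inr]; omega⟩

theorem degree_letterExp_le {n i : ℕ} (hi : i ≤ 2 * n) : (letterExp n i).degree ≤ 1 := by
  rcases hi.lt_or_eq with h | rfl
  · obtain ⟨v, rfl⟩ := exists_coordIndex_eq h
    rw [letterExp_coordIndex]
    simp
  · rw [letterExp_two_mul]; simp

/-- The letter number `i` as a polynomial. -/
noncomputable def letter (n i : ℕ) : MvPolynomial (PairVar n) ℝ := monomial (letterExp n i) 1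

theorem letter_coordIndex {n : ℕ} (v : PairVar n) : letter n (coordIndex v) = X v := by
  rw [letter, letterExp_coordIndex]; rfl

theorem letter_two_mul (n : ℕ) : letter n (2 * n) = 1 := by
  rw [letter, letterExp_two_mul]; rfl

theorem totalDegree_letter_le {n i : ℕ} (hi : i ≤ 2 * n) : (letter n i).totalDegree ≤ 1 := by
  refine (totalDegree_monomial_le _ _).trans ?_
  exact degree_letterExp_le hi

namespace LogCost.Params

variable (p : Params)

/-- The exponents of a word. -/
noncomputable def wordMonomial (c : ℕ) : PairVar p.n →₀ ℕ :=
  Finsupp.equivFunOnFinite.symm fun v => p.wordExp c (coordIndex v)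

theorem wordMonomial_eq_sum (c : ℕ) : p.wordMonomial c =
    ∑ j ∈ Finset.range (2 * p.L), letterExp p.n (natDigit (2 * p.n + 1) c j) := by
  ext v
  rw [wordMonomial, Finsupp.equivFunOnFinite_symm_apply_apply, Finsupp.finsetSum_apply, wordExp]
  refine Finset.sum_congr rfl fun j _ => ?_
  rw [letterExp, Finsupp.equivFunOnFinite_symm_apply_apply]
  simp only [eq_comm]

/-- A factor of a candidate. -/
noncomputable def row (code r : ℕ) : MvPolynomial (PairVar p.n) ℝ :=
  ∑ i ∈ Finset.range (2 * p.n + 1), C (p.entry code r i : ℝ) * letter p.n i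

/-- The polynomial with a given code; candidates for reweightings are the squares of these. -/
noncomputable def candidate (code : ℕ) : MvPolynomial (PairVar p.n) ℝ :=
  ∏ r ∈ Finset.range p.L, p.row code r

theorem totalDegree_row_le (code r : ℕ) : (p.row code r).totalDegree ≤ 1 := by
  refine (totalDegree_finsetSum _ _).trans (Finset.sup_le fun i hi => ?_)
  refine (totalDegree_mul _ _).trans ?_
  have := totalDegree_letter_le (n := p.n) (i := i) (by have := Finset.mem_range.1 hi; omega)
  rw [totalDegree_C]
  omega

theorem totalDegree_candidate_le (code : ℕ) : (p.candidate code).totalDegree ≤ p.L := by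
  refine (totalDegree_finsetProd _ _).trans ?_
  calc _ ≤ ∑ _r ∈ Finset.range p.L, 1 := Finset.sum_le_sum fun r _ => p.totalDegree_row_le code r
    _ = p.L := by simp

/-- Many words give the same monomial. The terms need not be collected, because the output is read
as a sum of its listed terms. -/
theorem candidate_sq (code : ℕ) : p.candidate code ^ 2 =
    ∑ c ∈ Finset.range ((2 * p.n + 1) ^ (2 * p.L)),
      monomial (p.wordMonomial c) (p.wordCoeff code c : ℝ) := by
  rw [candidate, ← prod_range_two_mul_div]
  unfold row
  rw [prod_range_sum_range]
  refine Finset.sum_congr rfl fun c _ => ?_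
  rw [Finset.prod_mul_distrib, ← map_prod, wordMonomial_eq_sum, wordCoeff]
  simp only [letter]
  rw [← monomial_sum_one, C_mul_monomial, mul_one]
  push_cast
  rfl

theorem natDigit_lt {q : ℕ} (hq : 0 < q) (c i : ℕ) : natDigit q c i < q := Nat.mod_lt _ hq

theorem degree_question_le {c a b : ℕ} (ha : a ≤ 2 * p.n) (hb : b ≤ 2 * p.n) :
    (p.wordMonomial c + letterExp p.n a + letterExp p.n b).degree ≤ 2 * p.L + 2 := by
  rw [map_add, map_add, wordMonomial_eq_sum, map_sum]
  have h1 := degree_letterExp_le ha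
  have h2 := degree_letterExp_le hb
  have h3 : ∑ j ∈ Finset.range (2 * p.L),
      (letterExp p.n (natDigit (2 * p.n + 1) c j)).degree ≤ 2 * p.L := by
    calc _ ≤ ∑ _j ∈ Finset.range (2 * p.L), 1 := Finset.sum_le_sum fun j _ =>
          degree_letterExp_le (by have := natDigit_lt (q := 2 * p.n + 1) (by omega) c j; omega)
      _ = _ := by simp
  omega

theorem question_eq (c a b : ℕ) : p.question c a b =
    exponentList (p.wordMonomial c + letterExp p.n a + letterExp p.n b) := by
  unfold question exponentList
  have key : ∀ v : PairVar p.n,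
      (((p.wordMonomial c + letterExp p.n a + letterExp p.n b) v : ℕ) : ℤ) =
      (p.wordExp c (coordIndex v) : ℤ) + (if coordIndex v = a then 1 else 0)
        + (if coordIndex v = b then 1 else 0) := by
    intro v
    simp only [Finsupp.add_apply, wordMonomial, letterExp,
      Finsupp.equivFunOnFinite_symm_apply_apply]
    push_cast
    rfl
  simp only [key]
  refine List.ext_getElem (by simp; ring) fun i h1 h2 => ?_
  rw [List.getElem_append]
  split_ifs with h
  · simp [coordIndex]
    rfl
  · have h' : p.n ≤ i := by simpa using h
    simp [coordIndex, h']

end LogCost.Params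

variable {n D : ℕ} {F : MvPolynomial (PairVar n) ℝ →ₗ[ℝ] ℝ}

/-- The left side is one of the nonnegative terms of `F (‖u‖² f²)` or `F (‖v‖² f²)`, each of which
equals `F (f²)`. -/
theorem IsSpherePE.mul_X_sq_le (hF : IsSpherePE D F) {f : MvPolynomial (PairVar n) ℝ} (v : PairVar n)
    (hf : 2 * f.totalDegree + 2 ≤ D) : F ((X v * f) ^ 2) ≤ F (f ^ 2) := by
  have hd := totalDegree_sq_le f
  have hnn : ∀ w : PairVar n, 0 ≤ F ((X w * f) ^ 2) := fun w => hF.nonneg_sq _ (by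
    have := totalDegree_mul (X w) f
    rw [totalDegree_X] at this
    omega)
  rcases v with i | i
  · rw [← hF.sphereU (f ^ 2) (by omega), Finset.sum_mul, map_sum]
    simp only [← mul_pow]
    exact Finset.single_le_sum (f := fun j => F ((X (Sum.inl j) * f) ^ 2)) (fun j _ => hnn _)
      (Finset.mem_univ i)
  · rw [← hF.sphereV (f ^ 2) (by omega), Finset.sum_mul, map_sum]
    simp only [← mul_pow]
    exact Finset.single_le_sum (f := fun j => F ((X (Sum.inr j) * f) ^ 2)) (fun j _ => hnn _)
      (Finset.mem_univ i)

theorem IsSpherePE.monomial_sq_le (hF : IsSpherePE D F) (k : ℕ) :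
    ∀ α : PairVar n →₀ ℕ, α.degree = k → 2 * k ≤ D → F (monomial α 1 ^ 2) ≤ 1 := by
  induction k with
  | zero =>
    intro α hα _
    rw [Finsupp.degree_eq_zero_iff] at hα
    rw [hα]
    change F (1 ^ 2) ≤ 1
    rw [one_pow, hF.one]
  | succ k ih =>
    intro α hα hD
    obtain ⟨v, hv⟩ : ∃ v, α v ≠ 0 := by
      by_contra! h
      have : α = 0 := Finsupp.ext h
      rw [this] at hα
      simp at hα
    have hle : Finsupp.single v 1 ≤ α := by
      rw [Finsupp.single_le_iff]
      omega
    have e : α = Finsupp.single v 1 + (α - Finsupp.single v 1) := (add_tsub_cancel_of_le hle).symm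
    have hdeg : (α - Finsupp.single v 1).degree = k := by
      have := congrArg Finsupp.degree e
      rw [map_add, hα, Finsupp.degree_single] at this
      omega
    have e2 : (monomial α (1 : ℝ)) = X v * monomial (α - Finsupp.single v 1) 1 := by
      rw [X, monomial_mul, mul_one, ← e]
    rw [e2]
    refine (hF.mul_X_sq_le v ?_).trans (ih _ hdeg (by omega))
    have : (monomial (α - Finsupp.single v 1) (1 : ℝ)).totalDegree ≤ k :=
      (totalDegree_monomial_le _ _).trans hdeg.le
    omega

/-- The monomial is split into two halves of degree at most `K`, to which Cauchy–Schwarz and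
`IsSpherePE.monomial_sq_le` apply. -/
theorem IsSpherePE.abs_monomial_le (hF : IsSpherePE D F) {K : ℕ} (hK : 2 * K ≤ D)
    {α : PairVar n →₀ ℕ} (hα : α.degree ≤ 2 * K) : |F (monomial α 1)| ≤ 1 := by
  obtain ⟨β, hβ, hβd⟩ := Finsupp.exists_le_degree_eq α (min K α.degree) (min_le_right _ _)
  have e : α = β + (α - β) := (add_tsub_cancel_of_le hβ).symm
  have hd : α.degree = β.degree + (α - β).degree := by rw [← map_add, ← e]
  have h1 := hF.monomial_sq_le _ β rfl (by omega)
  have h2 := hF.monomial_sq_le _ (α - β) rfl (by omega)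
  have hdeg : ∀ γ : PairVar n →₀ ℕ, (monomial γ (1 : ℝ)).totalDegree ≤ γ.degree := fun γ =>
    totalDegree_monomial_le _ _
  have h1' := hdeg β
  have h2' := hdeg (α - β)
  have h3 := hF.cauchy_schwarz (f := monomial β 1) (g := monomial (α - β) 1) (by omega) (by omega)
  rw [monomial_mul, mul_one, ← e] at h3
  have h4 := hF.nonneg_sq (monomial β 1) (by omega)
  have h5 := hF.nonneg_sq (monomial (α - β) 1) (by omega)
  rw [← sq_le_one_iff_abs_le_one]
  nlinarith

end Words

/-! ### Correctness of the approximate test. -/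

section Test

open MvPolynomial LogCost

theorem abs_mul_sub_mul_le {a b a' b' α β A B : ℝ} (ha : |a - a'| ≤ α) (hb : |b - b'| ≤ β)
    (hA : |a'| ≤ A) (hB : |b| ≤ B) : |a * b - a' * b'| ≤ α * B + A * β := by
  have e : a * b - a' * b' = (a - a') * b + a' * (b - b') := by ring
  rw [e]
  refine (abs_add_le _ _).trans ?_
  rw [abs_mul, abs_mul]
  have h0 := abs_nonneg (a - a')
  have h1 := abs_nonneg b
  have h2 := abs_nonneg a'
  have h3 := abs_nonneg (b - b')
  exact add_le_add (mul_le_mul ha hB h1 (h0.trans ha)) (mul_le_mul hA hb h3 (h2.trans hA))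

theorem abs_sq_sub_sq_le {a b δ K : ℝ} (h : |a - b| ≤ δ) (ha : |a| + |b| ≤ K) :
    |a ^ 2 - b ^ 2| ≤ δ * K := by
  rw [sq_sub_sq, abs_mul, mul_comm]
  exact mul_le_mul h ((abs_add_le _ _).trans ha) (abs_nonneg _) ((abs_nonneg _).trans h)

/-- Primed quantities are exact normalized moments, the others are divided by the approximate mass,
and `π` is the quotient of the exact and the approximate mass. Products scale by `π²` but `w` only
by `π`; the mismatch is covered by `|π - 1| ≤ η`. -/
theorem test_term_error {u v w u' v' w' π η : ℝ} (hη : η ≤ 1) (hπ : |π - 1| ≤ η)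
    (hu' : |u'| ≤ 1) (hv' : |v'| ≤ 1) (hw' : |w'| ≤ 1) (hu : |u - π * u'| ≤ η)
    (hv : |v - π * v'| ≤ η) (hw : |w - π * w'| ≤ η) :
    |(u * v - w) ^ 2 - π ^ 4 * (u' * v' - w') ^ 2| ≤ 160 * η ∧
      |(u * v) ^ 2 - π ^ 4 * (u' * v') ^ 2| ≤ 65 * η := by
  have hπ2 : |π| ≤ 2 := by
    have := abs_le.1 hπ
    rw [abs_le]; constructor <;> linarith
  have scale : ∀ x : ℝ, |x| ≤ 1 → |π * x| ≤ 2 := fun x hx => by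
    rw [abs_mul]; nlinarith [abs_nonneg x, abs_nonneg π]
  have near : ∀ x x' : ℝ, |x'| ≤ 1 → |x - π * x'| ≤ η → |x| ≤ 3 := fun x x' h1 h2 => by
    have h3 := scale x' h1
    have h4 := abs_sub_abs_le_abs_sub x (π * x')
    linarith
  have h1 : |u * v - π * u' * (π * v')| ≤ 5 * η := by
    have := abs_mul_sub_mul_le hu hv (scale u' hu') (near v v' hv' hv)
    linarith
  have h2 : |w - π * (π * w')| ≤ 3 * η := by
    have e : w - π * (π * w') = (w - π * w') + (π * w') * (1 - π) := by ring
    rw [e]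
    refine (abs_add_le _ _).trans ?_
    rw [abs_mul, abs_sub_comm 1 π]
    have := mul_le_mul (scale w' hw') hπ (abs_nonneg _) (by norm_num)
    linarith
  have h3 : |u * v| ≤ 9 := by
    rw [abs_mul]; nlinarith [near u u' hu' hu, near v v' hv' hv, abs_nonneg u, abs_nonneg v]
  have h4 : |π * u' * (π * v')| ≤ 4 := by
    rw [abs_mul]; nlinarith [scale u' hu', scale v' hv', abs_nonneg (π * u'), abs_nonneg (π * v')]
  have h5 : |π * (π * w')| ≤ 4 := by
    rw [abs_mul]; nlinarith [scale w' hw', abs_nonneg (π * w'), abs_nonneg π]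
  have h6 := near w w' hw' hw
  constructor
  · have e : π ^ 4 * (u' * v' - w') ^ 2 = (π * u' * (π * v') - π * (π * w')) ^ 2 := by ring
    rw [e]
    have d : |u * v - w - (π * u' * (π * v') - π * (π * w'))| ≤ 8 * η := by
      rw [show u * v - w - (π * u' * (π * v') - π * (π * w')) =
        (u * v - π * u' * (π * v')) - (w - π * (π * w')) by ring]
      refine (abs_sub _ _).trans ?_
      linarith
    have b1 := abs_sub (u * v) w
    have b2 := abs_sub (π * u' * (π * v')) (π * (π * w'))
    have := abs_sq_sub_sq_le d (K := 20) (by linarith)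
    linarith
  · have e : π ^ 4 * (u' * v') ^ 2 = (π * u' * (π * v')) ^ 2 := by ring
    rw [e]
    have := abs_sq_sub_sq_le h1 (K := 13) (by linarith)
    linarith

/-- Each of the `n²` pairs contributes at most `160 η` and `65 η`; the sum 225 is half of the
constant 450 in the hypothesis. -/
theorem test_error {n : ℕ} {u v u' v' : Fin n → ℝ} {w w' : Fin n → Fin n → ℝ} {π η Z N : ℝ}
    (hη : η ≤ 1) (hπ : |π - 1| ≤ η) (hu' : ∀ i, |u' i| ≤ 1) (hv' : ∀ i, |v' i| ≤ 1)
    (hw' : ∀ i j, |w' i j| ≤ 1) (hu : ∀ i, |u i - π * u' i| ≤ η) (hv : ∀ i, |v i - π * v' i| ≤ η)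
    (hw : ∀ i j, |w i j - π * w' i j| ≤ η) (hN : 1 ≤ N) (hZ : 0 ≤ Z)
    (hsmall : 450 * Z * N ^ 2 * n ^ 2 * η ≤ 1) :
    |(Z * N ^ 2 * ∑ i, ∑ j, (u i * v j - w i j) ^ 2 - Z * ∑ i, ∑ j, (u i * v j) ^ 2)
      - π ^ 4 * (Z * N ^ 2 * ∑ i, ∑ j, (u' i * v' j - w' i j) ^ 2
        - Z * ∑ i, ∑ j, (u' i * v' j) ^ 2)| ≤ 1 / 2 := by
  have key := fun i j => test_term_error hη hπ (hu' i) (hv' j) (hw' i j) (hu i) (hv j) (hw i j)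
  have hη0 : 0 ≤ η := (abs_nonneg _).trans hπ
  have dbl : ∀ (f g : Fin n → Fin n → ℝ) (δ : ℝ), (∀ i j, |f i j - π ^ 4 * g i j| ≤ δ) →
      |∑ i, ∑ j, f i j - π ^ 4 * ∑ i, ∑ j, g i j| ≤ n ^ 2 * δ := by
    intro f g δ h
    rw [Finset.mul_sum, ← Finset.sum_sub_distrib]
    simp only [Finset.mul_sum, ← Finset.sum_sub_distrib]
    refine (Finset.abs_sum_le_sum_abs _ _).trans ?_
    calc _ ≤ ∑ _i : Fin n, ∑ _j : Fin n, δ := Finset.sum_le_sum fun i _ =>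
          (Finset.abs_sum_le_sum_abs _ _).trans (Finset.sum_le_sum fun j _ => h i j)
      _ = n ^ 2 * δ := by simp; ring
  have h1 := dbl _ _ _ fun i j => (key i j).1
  have h2 := dbl _ _ _ fun i j => (key i j).2
  set A := ∑ i, ∑ j, (u i * v j - w i j) ^ 2
  set B := ∑ i, ∑ j, (u i * v j) ^ 2
  set A' := ∑ i, ∑ j, (u' i * v' j - w' i j) ^ 2
  set B' := ∑ i, ∑ j, (u' i * v' j) ^ 2
  rw [show Z * N ^ 2 * A - Z * B - π ^ 4 * (Z * N ^ 2 * A' - Z * B') =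
    Z * N ^ 2 * (A - π ^ 4 * A') - Z * (B - π ^ 4 * B') by ring]
  refine (abs_sub _ _).trans ?_
  rw [abs_mul (Z * N ^ 2), abs_of_nonneg (by positivity : 0 ≤ Z * N ^ 2), abs_mul Z,
    abs_of_nonneg hZ]
  have hZN : Z ≤ Z * N ^ 2 := le_mul_of_one_le_right hZ (one_le_pow₀ hN)
  calc _ ≤ Z * N ^ 2 * (n ^ 2 * (160 * η)) + Z * N ^ 2 * (n ^ 2 * (65 * η)) :=
        add_le_add (mul_le_mul_of_nonneg_left h1 (by positivity))
          (mul_le_mul hZN h2 (abs_nonneg _) (by positivity))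
    _ = (450 * Z * N ^ 2 * n ^ 2 * η) / 2 := by ring
    _ ≤ 1 / 2 := by linarith

namespace LogCost.Params

variable (p : Params)

theorem abs_signed_le (hh : 1 ≤ p.h) (code i : ℕ) : |p.signed code i| ≤ p.h := by
  have := natDigit_lt (q := 2 * p.h) (by omega) code i
  unfold signed
  rw [abs_le]
  constructor <;> omega

theorem sum_range_ite_mul_le (m a : ℕ) {b : ℤ} (hb : 0 ≤ b) :
    ∑ i ∈ Finset.range m, (if a = i then 1 else 0) * b ≤ b := by
  rw [← Finset.sum_mul, Finset.sum_ite_eq]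
  split_ifs <;> omega

theorem abs_ite_mul (P : Prop) [Decidable P] (b : ℤ) :
    |(if P then 1 else 0) * b| = (if P then 1 else 0) * |b| := by
  split_ifs <;> simp

theorem sum_abs_weight_le (hh : 1 ≤ p.h) (code m : ℕ) :
    ∑ i ∈ Finset.range m, |p.weight code i| ≤ p.s * p.h := by
  calc ∑ i ∈ Finset.range m, |p.weight code i|
      ≤ ∑ i ∈ Finset.range m, ∑ l ∈ Finset.range p.s,
        (if natDigit (2 * p.h) code (4 * p.L + 2 * l) = i then 1 else 0) *
          |p.signed code (4 * p.L + 2 * l + 1)| := by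
        refine Finset.sum_le_sum fun i _ => (Finset.abs_sum_le_sum_abs _ _).trans_eq ?_
        exact Finset.sum_congr rfl fun l _ => abs_ite_mul _ _
    _ = ∑ l ∈ Finset.range p.s, ∑ i ∈ Finset.range m,
        (if natDigit (2 * p.h) code (4 * p.L + 2 * l) = i then 1 else 0) *
          |p.signed code (4 * p.L + 2 * l + 1)| := Finset.sum_comm
    _ ≤ ∑ _l ∈ Finset.range p.s, (p.h : ℤ) := Finset.sum_le_sum fun l _ =>
        (sum_range_ite_mul_le _ _ (abs_nonneg _)).trans (p.abs_signed_le hh _ _)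
    _ = p.s * p.h := by simp

theorem sum_abs_entry_le (hh : 1 ≤ p.h) (code r m : ℕ) :
    ∑ i ∈ Finset.range m, |p.entry code r i| ≤ ((p.s + 2) * p.h ^ 2 : ℕ) := by
  have h1 := p.sum_abs_weight_le hh code m
  have h2 := p.abs_signed_le hh code
  calc ∑ i ∈ Finset.range m, |p.entry code r i|
      ≤ ∑ i ∈ Finset.range m, (p.h * |p.weight code i|
        + (if natDigit (2 * p.h) code (4 * r + 1) = i then 1 else 0) * |p.signed code (4 * r + 2)|
        + (if 2 * p.n = i then 1 else 0) * |p.signed code (4 * r + 3)|) := by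
        refine Finset.sum_le_sum fun i _ => ?_
        unfold entry
        refine (abs_add_three _ _ _).trans ?_
        rw [abs_ite_mul, abs_ite_mul, abs_mul]
        refine add_le_add (add_le_add (mul_le_mul_of_nonneg_right (h2 _) (abs_nonneg _)) le_rfl) ?_
        simp only [eq_comm, le_refl]
    _ ≤ p.h * (p.s * p.h) + p.h + p.h := by
        rw [Finset.sum_add_distrib, Finset.sum_add_distrib, ← Finset.mul_sum]
        exact add_le_add (add_le_add (mul_le_mul_of_nonneg_left h1 (by positivity))
          ((sum_range_ite_mul_le _ _ (abs_nonneg _)).trans (h2 _)))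
          ((sum_range_ite_mul_le _ _ (abs_nonneg _)).trans (h2 _))
    _ ≤ _ := by
        push_cast
        have : (1 : ℤ) ≤ p.h := by exact_mod_cast hh
        nlinarith

/-- Expanding over words is multiplicative for sums of absolute values. The bound serves twice: for
the error of the approximate moments and for the size of the output. -/
theorem sum_abs_wordCoeff_le (hh : 1 ≤ p.h) (code : ℕ) :
    ∑ c ∈ Finset.range ((2 * p.n + 1) ^ (2 * p.L)), |p.wordCoeff code c| ≤
      (((p.s + 2) * p.h ^ 2) ^ (2 * p.L) : ℕ) := by
  unfold wordCoeff
  simp only [Finset.abs_prod]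
  rw [← prod_range_sum_range (2 * p.n + 1) (2 * p.L) fun j i => |p.entry code (j / 2) i|]
  calc _ ≤ ∏ _j ∈ Finset.range (2 * p.L), (((p.s + 2) * p.h ^ 2 : ℕ) : ℤ) :=
        Finset.prod_le_prod (fun j _ => Finset.sum_nonneg fun i _ => abs_nonneg _)
          fun j _ => p.sum_abs_entry_le hh _ _ _
    _ = _ := by simp

/-- The oracle `O` answers the questions of the search correctly for `F`, and the sizes are such that
the errors do not matter. -/
structure Sound (D : ℕ) (F : MvPolynomial (PairVar p.n) ℝ →ₗ[ℝ] ℝ) (O : Oracle) : Prop where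
  pe : IsSpherePE D F
  degree_le : 2 * p.L + 2 ≤ D
  answer : ∀ c a b : ℕ, a ≤ 2 * p.n → b ≤ 2 * p.n →
    |(O (p.question c a b) (3 * p.E) : ℝ) / 2 ^ (3 * p.E) -
      F (monomial (p.wordMonomial c + letterExp p.n a + letterExp p.n b) 1)| ≤ 1 / 2 ^ (3 * p.E)
  n_pos : 1 ≤ p.n
  h_pos : 1 ≤ p.h
  N_pos : 1 ≤ p.N
  s_pos : 1 ≤ p.s
  coeff_le : ((p.s + 2) * p.h ^ 2) ^ (2 * p.L) ≤ 2 ^ p.E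
  small : 450 * (4608 * p.s ^ 2) * p.N ^ 2 * p.n ^ 2 * 8 ≤ 2 ^ p.E

variable {p} {D : ℕ} {F : MvPolynomial (PairVar p.n) ℝ →ₗ[ℝ] ℝ} {O : Oracle}

theorem candidate_sq_mul (code a b : ℕ) :
    F (p.candidate code ^ 2 * (letter p.n a * letter p.n b)) =
      ∑ c ∈ Finset.range ((2 * p.n + 1) ^ (2 * p.L)), (p.wordCoeff code c : ℝ) *
        F (monomial (p.wordMonomial c + letterExp p.n a + letterExp p.n b) 1) := by
  rw [candidate_sq, Finset.sum_mul, map_sum]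
  refine Finset.sum_congr rfl fun c _ => ?_
  rw [letter, letter, monomial_mul, monomial_mul, ← smul_eq_mul (p.wordCoeff code c : ℝ) (F _),
    ← map_smul, smul_monomial, add_assoc]
  simp

/-- The oracle error `2^(-3E)` is amplified by the sum of the absolute values of the coefficients,
at most `2^E`. -/
theorem Sound.moment_error (h : p.Sound D F O) (code : ℕ) {a b : ℕ} (ha : a ≤ 2 * p.n)
    (hb : b ≤ 2 * p.n) :
    |(p.moment O code a b : ℝ) / 2 ^ (3 * p.E) -
      F (p.candidate code ^ 2 * (letter p.n a * letter p.n b))| ≤ 1 / 2 ^ (2 * p.E) := by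
  rw [candidate_sq_mul, moment]
  push_cast
  rw [Finset.sum_div, ← Finset.sum_sub_distrib]
  have hsum : (∑ c ∈ Finset.range ((2 * p.n + 1) ^ (2 * p.L)), |(p.wordCoeff code c : ℝ)|) ≤
      2 ^ p.E := by
    have h1 := p.sum_abs_wordCoeff_le h.h_pos code
    have h2 := h1.trans (by exact_mod_cast h.coeff_le : _ ≤ ((2 ^ p.E : ℕ) : ℤ))
    exact_mod_cast h2
  calc _ ≤ ∑ c ∈ Finset.range ((2 * p.n + 1) ^ (2 * p.L)),
        |(p.wordCoeff code c : ℝ)| * (1 / 2 ^ (3 * p.E)) := by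
        refine (Finset.abs_sum_le_sum_abs _ _).trans (Finset.sum_le_sum fun c _ => ?_)
        rw [mul_div_assoc, ← mul_sub, abs_mul]
        exact mul_le_mul_of_nonneg_left (h.answer c a b ha hb) (abs_nonneg _)
    _ ≤ 2 ^ p.E * (1 / 2 ^ (3 * p.E)) := by
        rw [← Finset.sum_mul]
        exact mul_le_mul_of_nonneg_right hsum (by positivity)
    _ = 1 / 2 ^ (2 * p.E) := by
        rw [show 3 * p.E = p.E + 2 * p.E by ring, pow_add]
        field_simp

/-- The comparison of the test with the exact quantities. -/
theorem Sound.test (h : p.Sound D F O) (code : ℕ)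
    (hm : 2 ^ (2 * p.E) ≤ p.moment O code (2 * p.n) (2 * p.n)) :
    0 < F (p.candidate code ^ 2) ∧ ∃ π : ℝ, |π - 1| ≤ 1 / 8 ∧
      |((4608 * (p.s : ℝ) ^ 2 * (p.N : ℝ) ^ 2 * p.deviation O code
        - 4608 * (p.s : ℝ) ^ 2 * p.signal O code) / p.moment O code (2 * p.n) (2 * p.n) ^ 4)
      - π ^ 4 * (4608 * (p.s : ℝ) ^ 2 * (p.N : ℝ) ^ 2 * crossCov (reweight F (p.candidate code))
        - 4608 * (p.s : ℝ) ^ 2 * (normSqU (reweight F (p.candidate code)) *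
          normSqV (reweight F (p.candidate code))))| ≤ 1 / 2 := by
  set G := p.candidate code with hG
  set m₀ : ℝ := (p.moment O code (2 * p.n) (2 * p.n) : ℝ) with hm₀
  set t : ℝ := 2 ^ (3 * p.E) with ht
  set η : ℝ := 1 / 2 ^ p.E with hη
  have hE0 : (0 : ℝ) < 2 ^ p.E := by positivity
  have hE1 : (1 : ℝ) ≤ 2 ^ p.E := one_le_pow₀ (by norm_num)
  have ht0 : 0 < t := by positivity
  have hsmall : (450 * (4608 * (p.s : ℝ) ^ 2) * (p.N : ℝ) ^ 2 * (p.n : ℝ) ^ 2 * 8 : ℝ) ≤ 2 ^ p.E := by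
    exact_mod_cast h.small
  have hmr : (2 : ℝ) ^ (2 * p.E) ≤ m₀ := by rw [hm₀]; exact_mod_cast hm
  have hm0 : 0 < m₀ := lt_of_lt_of_le (by positivity) hmr
  -- The first condition of the test says that the approximate mass is at least `2^(-E)`. The
  -- absolute error `2^(-2E)` is therefore a relative error of at most `η = 2^(-E)`.
  have hτ : 1 / 2 ^ (2 * p.E) * t ≤ η * m₀ := by
    calc 1 / 2 ^ (2 * p.E) * t = η * 2 ^ (2 * p.E) := by
          rw [ht, hη, show 3 * p.E = p.E + 2 * p.E by ring, pow_add, two_mul, pow_add]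
          field_simp
      _ ≤ η * m₀ := mul_le_mul_of_nonneg_left hmr (by positivity)
  have err : ∀ a b, a ≤ 2 * p.n → b ≤ 2 * p.n →
      |(p.moment O code a b : ℝ) / m₀ - t / m₀ * F (G ^ 2 * (letter p.n a * letter p.n b))| ≤ η := by
    intro a b ha hb
    have h1 := h.moment_error code ha hb
    have e : (p.moment O code a b : ℝ) / m₀ - t / m₀ * F (G ^ 2 * (letter p.n a * letter p.n b)) =
        ((p.moment O code a b : ℝ) / t - F (G ^ 2 * (letter p.n a * letter p.n b))) * (t / m₀) := by
      field_simp
    rw [e, abs_mul, abs_of_pos (by positivity : 0 < t / m₀)]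
    calc _ ≤ 1 / 2 ^ (2 * p.E) * (t / m₀) := mul_le_mul_of_nonneg_right h1 (by positivity)
      _ = 1 / 2 ^ (2 * p.E) * t / m₀ := by ring
      _ ≤ η := by rw [div_le_iff₀ hm0]; exact hτ
  have hη8 : η ≤ 1 / 8 := by
    rw [hη]
    refine one_div_le_one_div_of_le (by norm_num) (le_trans ?_ hsmall)
    have h1 : (1 : ℝ) ≤ (p.s : ℝ) ^ 2 := one_le_pow₀ (by exact_mod_cast h.s_pos)
    have h2 : (1 : ℝ) ≤ (p.N : ℝ) ^ 2 := one_le_pow₀ (by exact_mod_cast h.N_pos)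
    have h3 : (1 : ℝ) ≤ (p.n : ℝ) ^ 2 := one_le_pow₀ (by exact_mod_cast h.n_pos)
    have h4 := one_le_mul_of_one_le_of_one_le (one_le_mul_of_one_le_of_one_le h1 h2) h3
    nlinarith
  have hη0 : 0 ≤ η := by positivity
  have hπ := err (2 * p.n) (2 * p.n) le_rfl le_rfl
  rw [letter_two_mul, mul_one, mul_one, ← hm₀, div_self hm0.ne'] at hπ
  have hP : 0 < F (G ^ 2) := by
    by_contra! hneg
    have : t / m₀ * F (G ^ 2) ≤ 0 := mul_nonpos_of_nonneg_of_nonpos (by positivity) hneg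
    have := (abs_le.1 hπ).2
    linarith
  -- The witness `π` is the exact mass divided by the approximate one.
  refine ⟨hP, t / m₀ * F (G ^ 2), by rw [abs_sub_comm]; exact hπ.trans hη8, ?_⟩
  set F' := reweight F G with hF'
  have hre : ∀ f, t / m₀ * F (G ^ 2 * f) = t / m₀ * F (G ^ 2) * F' f := by
    intro f
    rw [hF', reweight_apply]
    field_simp
  have hdeg := p.totalDegree_candidate_le code
  have hpe : IsSpherePE 2 F' := h.pe.of_reweight (by
    have := h.degree_le
    rw [hG]
    omega) hP
  have bound : ∀ a b, a ≤ 2 * p.n → b ≤ 2 * p.n → |F' (letter p.n a * letter p.n b)| ≤ 1 := by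
    intro a b ha hb
    rw [letter, letter, monomial_mul, mul_one]
    refine hpe.abs_monomial_le (K := 1) (by norm_num) ?_
    rw [map_add]
    have := degree_letterExp_le ha
    have := degree_letterExp_le hb
    omega
  have near : ∀ a b, a ≤ 2 * p.n → b ≤ 2 * p.n → |(p.moment O code a b : ℝ) / m₀ -
      t / m₀ * F (G ^ 2) * F' (letter p.n a * letter p.n b)| ≤ η := fun a b ha hb => by
    rw [← hre]; exact err a b ha hb
  have lU : ∀ i : Fin p.n, letter p.n i = X (Sum.inl i) := fun i => letter_coordIndex (Sum.inl i)
  have lV : ∀ j : Fin p.n, letter p.n (p.n + j) = X (Sum.inr j) := fun j =>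
    letter_coordIndex (Sum.inr j)
  have hi : ∀ i : Fin p.n, (i : ℕ) ≤ 2 * p.n := fun i => by have := i.2; omega
  have hj : ∀ i : Fin p.n, p.n + (i : ℕ) ≤ 2 * p.n := fun i => by have := i.2; omega
  have key := test_error (u := fun i : Fin p.n => (p.moment O code i (2 * p.n) : ℝ) / m₀)
    (v := fun j : Fin p.n => (p.moment O code (p.n + j) (2 * p.n) : ℝ) / m₀)
    (w := fun i j : Fin p.n => (p.moment O code i (p.n + j) : ℝ) / m₀)
    (u' := fun i => F' (X (Sum.inl i))) (v' := fun j => F' (X (Sum.inr j)))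
    (w' := fun i j => F' (X (Sum.inl i) * X (Sum.inr j))) (π := t / m₀ * F (G ^ 2)) (η := η)
    (Z := 4608 * (p.s : ℝ) ^ 2) (N := p.N) (by linarith) (by rw [abs_sub_comm]; exact hπ)
    (fun i => by simpa only [lU, letter_two_mul, mul_one] using bound i (2 * p.n) (hi i) le_rfl)
    (fun j => by
      simpa only [lV, letter_two_mul, mul_one] using bound (p.n + j) (2 * p.n) (hj j) le_rfl)
    (fun i j => by simpa only [lU, lV] using bound i (p.n + j) (hi i) (hj j))
    (fun i => by simpa only [lU, letter_two_mul, mul_one] using near i (2 * p.n) (hi i) le_rfl)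
    (fun j => by
      simpa only [lV, letter_two_mul, mul_one] using near (p.n + j) (2 * p.n) (hj j) le_rfl)
    (fun i j => by simpa only [lU, lV] using near i (p.n + j) (hi i) (hj j))
    (by exact_mod_cast h.N_pos) (by positivity) (by
      rw [hη, mul_one_div, div_le_one hE0]
      refine le_trans ?_ hsmall
      exact le_mul_of_one_le_right (by positivity) (by norm_num))
  have e1 : (p.deviation O code : ℝ) / m₀ ^ 4 = ∑ i : Fin p.n, ∑ j : Fin p.n,
      ((p.moment O code i (2 * p.n) : ℝ) / m₀ * ((p.moment O code (p.n + j) (2 * p.n) : ℝ) / m₀)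
        - (p.moment O code i (p.n + j) : ℝ) / m₀) ^ 2 := by
    rw [deviation]
    push_cast
    rw [Finset.sum_div, Finset.sum_range]
    refine Finset.sum_congr rfl fun i _ => ?_
    rw [Finset.sum_div, Finset.sum_range]
    refine Finset.sum_congr rfl fun j _ => ?_
    rw [← hm₀]
    field_simp
  have e2 : (p.signal O code : ℝ) / m₀ ^ 4 = ∑ i : Fin p.n, ∑ j : Fin p.n,
      ((p.moment O code i (2 * p.n) : ℝ) / m₀ *
        ((p.moment O code (p.n + j) (2 * p.n) : ℝ) / m₀)) ^ 2 := by
    rw [signal]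
    push_cast
    rw [Finset.sum_div, Finset.sum_range]
    refine Finset.sum_congr rfl fun i _ => ?_
    rw [Finset.sum_div, Finset.sum_range]
    refine Finset.sum_congr rfl fun j _ => ?_
    field_simp
  have e3 : crossCov F' = ∑ i, ∑ j, (F' (X (Sum.inl i)) * F' (X (Sum.inr j))
      - F' (X (Sum.inl i) * X (Sum.inr j))) ^ 2 := by
    rw [crossCov, Finset.sum_comm]
    refine Finset.sum_congr rfl fun i _ => Finset.sum_congr rfl fun j _ => ?_
    rw [covU, mul_comm (X (Sum.inr j))]
    ring
  have e4 : normSqU F' * normSqV F' =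
      ∑ i, ∑ j, (F' (X (Sum.inl i)) * F' (X (Sum.inr j))) ^ 2 := by
    rw [normSqU, normSqV, Finset.sum_mul_sum]
    simp only [mul_pow]
  rw [e3, e4, sub_div, mul_div_assoc, mul_div_assoc, e1, e2]
  exact key

/-- Acceptance puts the approximate difference, divided by the fourth power of the approximate mass,
at `-1` or below. The error is at most `1/2`, so `π⁴` times the exact difference is still negative.
-/
theorem Sound.of_accepts (h : p.Sound D F O) {code : ℕ} (hacc : p.Accepts O code) :
    0 < F (p.candidate code ^ 2) ∧
      (p.N : ℝ) ^ 2 * crossCov (reweight F (p.candidate code)) ≤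
        normSqU (reweight F (p.candidate code)) * normSqV (reweight F (p.candidate code)) := by
  obtain ⟨hpos, π, hπ, htest⟩ := h.test code hacc.1
  refine ⟨hpos, ?_⟩
  have hm0 : (0 : ℝ) < p.moment O code (2 * p.n) (2 * p.n) := by
    have : (0 : ℤ) < p.moment O code (2 * p.n) (2 * p.n) := lt_of_lt_of_le (by positivity) hacc.1
    exact_mod_cast this
  have h2 : (4608 * (p.s : ℝ) ^ 2 * (p.N : ℝ) ^ 2 * p.deviation O code
      + (p.moment O code (2 * p.n) (2 * p.n) : ℝ) ^ 4) ≤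
      4608 * (p.s : ℝ) ^ 2 * p.signal O code := by exact_mod_cast hacc.2
  have h3 : (4608 * (p.s : ℝ) ^ 2 * (p.N : ℝ) ^ 2 * p.deviation O code
        - 4608 * (p.s : ℝ) ^ 2 * p.signal O code) / p.moment O code (2 * p.n) (2 * p.n) ^ 4 ≤ -1 := by
    rw [div_le_iff₀ (by positivity)]
    linarith
  have h4 := (abs_le.1 htest).1
  have hπ0 : 0 < π := by have := (abs_le.1 hπ).1; linarith
  have h5 : π ^ 4 * (4608 * (p.s : ℝ) ^ 2 * ((p.N : ℝ) ^ 2 * crossCov (reweight F (p.candidate code))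
        - (normSqU (reweight F (p.candidate code)) *
          normSqV (reweight F (p.candidate code))))) ≤ 0 := by
    rw [mul_sub, ← mul_assoc]
    linarith
  by_contra! hneg
  have hs : (0 : ℝ) < (p.s : ℝ) := by exact_mod_cast h.s_pos
  have := mul_pos (pow_pos hπ0 4) (mul_pos (by positivity : (0 : ℝ) < 4608 * (p.s : ℝ) ^ 2)
    (sub_pos.2 hneg))
  linarith

/-- The margin of near products pays for the errors. With `A` the cross-covariance and `B` the
product of the squared means, `N² A ≤ B / 4` and `4608 s² B ≥ 4` (as `4608 = 4 * 1152`), so the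
exact difference is at most `-3`. Since `π⁴ ≥ 1/2` and the error is at most `1/2`, the approximate
difference is at most `-1`. -/
theorem Sound.accepts (h : p.Sound D F O) {code : ℕ}
    (hmass : 2 / 2 ^ p.E ≤ F (p.candidate code ^ 2))
    (hnear : IsNearlyProduct (1 / (4 * (p.N : ℝ) ^ 2)) (1 / (1152 * (p.s : ℝ) ^ 2))
      (reweight F (p.candidate code))) : p.Accepts O code := by
  have hE0 : (0 : ℝ) < 2 ^ p.E := by positivity
  have hE1 : (1 : ℝ) ≤ 2 ^ p.E := one_le_pow₀ (by norm_num)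
  have hs : (0 : ℝ) < (p.s : ℝ) := by exact_mod_cast h.s_pos
  have hN : (0 : ℝ) < (p.N : ℝ) := by exact_mod_cast h.N_pos
  have hm : 2 ^ (2 * p.E) ≤ p.moment O code (2 * p.n) (2 * p.n) := by
    have h1 := h.moment_error code (le_refl (2 * p.n)) (le_refl (2 * p.n))
    rw [letter_two_mul, mul_one, mul_one] at h1
    have h2 := (abs_le.1 h1).1
    have h3 : (1 : ℝ) / 2 ^ (2 * p.E) ≤ 1 / 2 ^ p.E :=
      one_div_le_one_div_of_le hE0 (pow_le_pow_right₀ (by norm_num) (by omega))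
    have h4 : (1 : ℝ) / 2 ^ p.E ≤ (p.moment O code (2 * p.n) (2 * p.n) : ℝ) / 2 ^ (3 * p.E) := by
      have e : (2 : ℝ) / 2 ^ p.E = 1 / 2 ^ p.E + 1 / 2 ^ p.E := by ring
      linarith
    rw [le_div_iff₀ (by positivity), show 3 * p.E = p.E + 2 * p.E by ring, pow_add,
      ← mul_assoc, one_div_mul_cancel hE0.ne', one_mul] at h4
    exact_mod_cast h4
  refine ⟨hm, ?_⟩
  obtain ⟨hpos, π, hπ, htest⟩ := h.test code hm
  have hm0 : (0 : ℝ) < p.moment O code (2 * p.n) (2 * p.n) := by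
    have : (0 : ℤ) < p.moment O code (2 * p.n) (2 * p.n) := lt_of_lt_of_le (by positivity) hm
    exact_mod_cast this
  obtain ⟨h1, h2⟩ := hnear
  set A := crossCov (reweight F (p.candidate code))
  set B := normSqU (reweight F (p.candidate code)) * normSqV (reweight F (p.candidate code))
  have h3 : (p.N : ℝ) ^ 2 * A ≤ B / 4 := by
    calc (p.N : ℝ) ^ 2 * A ≤ (p.N : ℝ) ^ 2 * (1 / (4 * (p.N : ℝ) ^ 2) * B) :=
          mul_le_mul_of_nonneg_left h1 (by positivity)
      _ = B / 4 := by field_simp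
  have h4 : 4608 * (p.s : ℝ) ^ 2 * B ≥ 4 := by
    calc (4 : ℝ) = 4608 * (p.s : ℝ) ^ 2 * (1 / (1152 * (p.s : ℝ) ^ 2)) := by field_simp; norm_num
      _ ≤ _ := mul_le_mul_of_nonneg_left h2 (by positivity)
  have h5 : 4608 * (p.s : ℝ) ^ 2 * (p.N : ℝ) ^ 2 * A - 4608 * (p.s : ℝ) ^ 2 * B ≤ -3 := by
    have : 4608 * (p.s : ℝ) ^ 2 * ((p.N : ℝ) ^ 2 * A) ≤ 4608 * (p.s : ℝ) ^ 2 * (B / 4) :=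
      mul_le_mul_of_nonneg_left h3 (by positivity)
    nlinarith
  have h6 : (1 / 2 : ℝ) ≤ π ^ 4 := by
    have h7 : 7 / 8 ≤ π := by have := (abs_le.1 hπ).1; linarith
    calc (1 / 2 : ℝ) ≤ (7 / 8) ^ 4 := by norm_num
      _ ≤ π ^ 4 := pow_le_pow_left₀ (by norm_num) h7 4
  have h7 : π ^ 4 * (4608 * (p.s : ℝ) ^ 2 * (p.N : ℝ) ^ 2 * A - 4608 * (p.s : ℝ) ^ 2 * B) ≤
      -(3 / 2) := by nlinarith
  have h8 := (abs_le.1 htest).2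
  have h9 : (4608 * (p.s : ℝ) ^ 2 * (p.N : ℝ) ^ 2 * p.deviation O code
        - 4608 * (p.s : ℝ) ^ 2 * p.signal O code) / p.moment O code (2 * p.n) (2 * p.n) ^ 4 ≤ -1 := by
    linarith
  rw [div_le_iff₀ (by positivity)] at h9
  have h10 : (4608 * (p.s : ℝ) ^ 2 * (p.N : ℝ) ^ 2 * p.deviation O code
      + (p.moment O code (2 * p.n) (2 * p.n) : ℝ) ^ 4) ≤
      4608 * (p.s : ℝ) ^ 2 * p.signal O code := by linarith
  exact_mod_cast h10

end LogCost.Params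

end Test

/-! ### Encoding the polynomials of the existence proof by numbers. -/

section Codes

open MvPolynomial LogCost

theorem prod_range_getD {α M : Type*} [CommMonoid M] (f : α → M) (d : α) (l : List α) :
    ∏ r ∈ Finset.range l.length, f (l.getD r d) = (l.map f).prod := by
  induction l with
  | nil => simp
  | cons a l ih =>
    rw [List.length_cons, Finset.prod_range_succ', List.map_cons, List.prod_cons, ← ih, mul_comm]
    simp

theorem sum_range_getD {α M : Type*} [AddCommMonoid M] (f : α → M) (d : α) (l : List α) :
    ∑ r ∈ Finset.range l.length, f (l.getD r d) = (l.map f).sum := by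
  induction l with
  | nil => simp
  | cons a l ih =>
    rw [List.length_cons, Finset.sum_range_succ', List.map_cons, List.sum_cons, ← ih, add_comm]
    simp

theorem getD_of_forall {α : Type*} {P : α → Prop} {d : α} {l : List α} (hd : P d)
    (hl : ∀ x ∈ l, P x) (r : ℕ) : P (l.getD r d) := by
  rw [List.getD_eq_getElem?_getD]
  cases h : l[r]? with
  | none => simpa using hd
  | some x => exact hl x (List.mem_of_getElem? h)

namespace LogCost.Params

variable (p : Params)

/-- Encoding of the coefficients of the factors and of the linear form. -/
theorem exists_code (ρ : ℕ → ℤ × ℕ × ℤ × ℤ) (π : ℕ → ℕ × ℤ) (hs : p.s ≤ p.L)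
    (hρ : ∀ r, |(ρ r).1| < p.h ∧ (ρ r).2.1 < 2 * p.h ∧ |(ρ r).2.2.1| < p.h ∧ |(ρ r).2.2.2| < p.h)
    (hπ : ∀ l, (π l).1 < 2 * p.h ∧ |(π l).2| < p.h) :
    ∃ code < (2 * p.h) ^ (6 * p.L),
      (∀ r < p.L, p.signed code (4 * r) = (ρ r).1 ∧
        natDigit (2 * p.h) code (4 * r + 1) = (ρ r).2.1 ∧
        p.signed code (4 * r + 2) = (ρ r).2.2.1 ∧ p.signed code (4 * r + 3) = (ρ r).2.2.2) ∧
      ∀ l < p.s, natDigit (2 * p.h) code (4 * p.L + 2 * l) = (π l).1 ∧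
        p.signed code (4 * p.L + 2 * l + 1) = (π l).2 := by
  -- Layout of a code: four digits for each of the `L` rows, then position and value of up to `s`
  -- entries of the form. Signed values are shifted by `h`, and `s ≤ L` makes `6 L` digits enough.
  let φ : ℕ → ℕ := fun i =>
    if i < 4 * p.L then
      (if i % 4 = 0 then ((ρ (i / 4)).1 + p.h).toNat else if i % 4 = 1 then (ρ (i / 4)).2.1
        else if i % 4 = 2 then ((ρ (i / 4)).2.2.1 + p.h).toNat
        else ((ρ (i / 4)).2.2.2 + p.h).toNat)
    else if (i - 4 * p.L) % 2 = 0 then (π ((i - 4 * p.L) / 2)).1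
      else ((π ((i - 4 * p.L) / 2)).2 + p.h).toNat
  have key : ∀ z : ℤ, |z| < p.h → (z + p.h).toNat < 2 * p.h ∧ (((z + p.h).toNat : ℕ) : ℤ) - p.h = z := by
    intro z hz
    rw [abs_lt] at hz
    constructor <;> omega
  obtain ⟨code, hc, hd⟩ := exists_natDigit_eq (2 * p.h) (6 * p.L) φ (by
    intro i _
    obtain ⟨h1, h2, h3, h4⟩ := hρ (i / 4)
    obtain ⟨h5, h6⟩ := hπ ((i - 4 * p.L) / 2)
    simp only [φ]
    split_ifs
    exacts [(key _ h1).1, h2, (key _ h3).1, (key _ h4).1, h5, (key _ h6).1])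
  refine ⟨code, hc, fun r hr => ?_, fun l hl => ?_⟩
  · obtain ⟨h1, h2, h3, h4⟩ := hρ r
    refine ⟨?_, ?_, ?_, ?_⟩
    · rw [signed, hd _ (by omega)]
      simp only [φ]
      rw [if_pos (by omega), if_pos (by omega), show 4 * r / 4 = r by omega, (key _ h1).2]
    · rw [hd _ (by omega)]
      simp only [φ]
      rw [if_pos (by omega), if_neg (by omega), if_pos (by omega),
        show (4 * r + 1) / 4 = r by omega]
    · rw [signed, hd _ (by omega)]
      simp only [φ]
      rw [if_pos (by omega), if_neg (by omega), if_neg (by omega), if_pos (by omega),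
        show (4 * r + 2) / 4 = r by omega, (key _ h3).2]
    · rw [signed, hd _ (by omega)]
      simp only [φ]
      rw [if_pos (by omega), if_neg (by omega), if_neg (by omega), if_neg (by omega),
        show (4 * r + 3) / 4 = r by omega, (key _ h4).2]
  · obtain ⟨h5, h6⟩ := hπ l
    constructor
    · rw [hd _ (by omega)]
      simp only [φ]
      rw [if_neg (by omega), if_pos (by omega), show (4 * p.L + 2 * l - 4 * p.L) / 2 = l by omega]
    · rw [signed, hd _ (by omega)]
      simp only [φ]
      rw [if_neg (by omega), if_neg (by omega),
        show (4 * p.L + 2 * l + 1 - 4 * p.L) / 2 = l by omega, (key _ h6).2]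

theorem sum_ite_letter (a : ℕ) (ha : a ≤ 2 * p.n) (x : ℤ) :
    ∑ i ∈ Finset.range (2 * p.n + 1),
      C (((if a = i then 1 else 0) * x : ℤ) : ℝ) * letter p.n i = C (x : ℝ) * letter p.n a := by
  rw [Finset.sum_eq_single a]
  · simp
  · intro i _ hi
    rw [if_neg (Ne.symm hi)]
    simp
  · intro h
    exact absurd (Finset.mem_range.2 (by omega)) h

theorem row_eq (code r : ℕ) (hι : natDigit (2 * p.h) code (4 * r + 1) ≤ 2 * p.n) :
    p.row code r = C (p.signed code (4 * r) : ℝ) *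
        (∑ i ∈ Finset.range (2 * p.n + 1), C (p.weight code i : ℝ) * letter p.n i)
      + C (p.signed code (4 * r + 2) : ℝ) * letter p.n (natDigit (2 * p.h) code (4 * r + 1))
      + C (p.signed code (4 * r + 3) : ℝ) := by
  have e1 := p.sum_ite_letter _ hι (p.signed code (4 * r + 2))
  have e2 := p.sum_ite_letter _ le_rfl (p.signed code (4 * r + 3))
  rw [letter_two_mul, mul_one] at e2
  rw [← e1, ← e2, Finset.mul_sum, ← Finset.sum_add_distrib, ← Finset.sum_add_distrib, row]
  refine Finset.sum_congr rfl fun i _ => ?_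
  rw [entry]
  simp only [Int.cast_add, map_add, add_mul, Int.cast_mul (p.signed code (4 * r)), map_mul, mul_assoc,
    eq_comm]

theorem sum_weight (code : ℕ)
    (ha : ∀ l < p.s, natDigit (2 * p.h) code (4 * p.L + 2 * l) ≤ 2 * p.n) :
    ∑ i ∈ Finset.range (2 * p.n + 1), C (p.weight code i : ℝ) * letter p.n i =
      ∑ l ∈ Finset.range p.s, C (p.signed code (4 * p.L + 2 * l + 1) : ℝ) *
        letter p.n (natDigit (2 * p.h) code (4 * p.L + 2 * l)) := by
  unfold weight
  simp only [Int.cast_sum, map_sum, Finset.sum_mul]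
  rw [Finset.sum_comm]
  exact Finset.sum_congr rfl fun l hl => p.sum_ite_letter _ (ha l (Finset.mem_range.1 hl)) _

/-- The polynomials of the shape that the search has to consider have codes. -/
theorem exists_candidate_eq (w : Fin p.n → ℤ) (t : ℕ) (j : ℤ) (steps : List (PairVar p.n × ℤ)) (N₀ : ℕ)
    (hw : ∀ i, |w i| ≤ p.s) (hcard : (Finset.univ.filter fun i => w i ≠ 0).card ≤ p.s)
    (hsteps : ∀ q ∈ steps, |q.2| ≤ 2 * p.n) (hlen : t + 1 + steps.length ≤ p.L) (hs : p.s ≤ p.L)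
    (hsh : p.s < p.h) (hN₀ : N₀ < p.h) (hj : |j| < p.h) (hn : 2 * p.n < p.h) (hh : 3 < p.h) :
    ∃ code < (2 * p.h) ^ (6 * p.L), p.candidate code =
      formV (fun i => (w i : ℝ)) ^ t * (C (N₀ : ℝ) * formV (fun i => (w i : ℝ)) + C (j : ℝ)) *
        (steps.map stepFactor).prod := by
  classical
  set sup := (Finset.univ.filter fun i => w i ≠ 0).toList with hsup
  have hsl : sup.length ≤ p.s := by rw [hsup, Finset.length_toList]; exact hcard
  -- The support of `w`, padded with entries of coefficient 0.
  set pairs : List (ℕ × ℤ) := sup.map (fun i => (coordIndex (Sum.inr i : PairVar p.n), w i)) ++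
    List.replicate (p.s - sup.length) (0, 0) with hpairs
  -- The `t` copies of the form, the factor that selects the sign, the step factors, and rows equal
  -- to the constant 1 as padding.
  set rows : List (ℤ × ℕ × ℤ × ℤ) := (List.replicate t (1, 0, 0, 0) ++ [((N₀ : ℤ), 0, 0, j)]) ++
    (steps.map (fun q => (0, coordIndex q.1, q.2, 3)) ++
      List.replicate (p.L - (t + 1 + steps.length)) (0, 0, 0, 1)) with hrows
  have hpl : pairs.length = p.s := by rw [hpairs]; simp; omega
  have hrl : rows.length = p.L := by rw [hrows]; simp; omega
  have hpb : ∀ x ∈ pairs, (x.1 ≤ 2 * p.n ∧ |x.2| < p.h) := by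
    intro x hx
    rw [hpairs, List.mem_append] at hx
    rcases hx with hx | hx
    · obtain ⟨i, _, rfl⟩ := List.mem_map.1 hx
      have := coordIndex_lt (Sum.inr i : PairVar p.n)
      have := hw i
      exact ⟨by dsimp only; omega, by dsimp only; omega⟩
    · rw [List.eq_of_mem_replicate hx]
      simp; omega
  have hrb : ∀ x ∈ rows, (|x.1| < p.h ∧ x.2.1 ≤ 2 * p.n ∧ |x.2.2.1| < p.h ∧ |x.2.2.2| < p.h) := by
    intro x hx
    rw [hrows, List.mem_append, List.mem_append, List.mem_append] at hx
    rcases hx with (hx | hx) | hx | hx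
    · rw [List.eq_of_mem_replicate hx]
      simp; omega
    · rw [List.mem_singleton.1 hx]
      simp; omega
    · obtain ⟨q, hq, rfl⟩ := List.mem_map.1 hx
      have h1 := coordIndex_lt q.1
      have h2 := hsteps q hq
      refine ⟨by simp; omega, h1.le, by dsimp only; omega, by norm_num; omega⟩
    · rw [List.eq_of_mem_replicate hx]
      simp; omega
  have hpb' := getD_of_forall (d := ((0 : ℕ), (0 : ℤ)))
    (P := fun x : ℕ × ℤ => x.1 ≤ 2 * p.n ∧ |x.2| < p.h) (by simp; omega) hpb
  have hrb' := getD_of_forall (d := ((0 : ℤ), (0 : ℕ), (0 : ℤ), (1 : ℤ)))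
    (P := fun x : ℤ × ℕ × ℤ × ℤ =>
      |x.1| < p.h ∧ x.2.1 ≤ 2 * p.n ∧ |x.2.2.1| < p.h ∧ |x.2.2.2| < p.h) (by simp; omega) hrb
  obtain ⟨code, hc, hr, hp⟩ := p.exists_code (fun r => rows.getD r (0, 0, 0, 1))
    (fun l => pairs.getD l (0, 0)) hs
    (fun r => by
      obtain ⟨h1, h2, h3, h4⟩ := hrb' r
      exact ⟨h1, by omega, h3, h4⟩)
    (fun l => by
      obtain ⟨h1, h2⟩ := hpb' l
      exact ⟨by omega, h2⟩)
  refine ⟨code, hc, ?_⟩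
  have hform : ∑ i ∈ Finset.range (2 * p.n + 1), C (p.weight code i : ℝ) * letter p.n i =
      formV (fun i => (w i : ℝ)) := by
    rw [p.sum_weight code fun l hl => by rw [(hp l hl).1]; exact (hpb' l).1]
    rw [Finset.sum_congr rfl fun l hl => by
      rw [(hp l (Finset.mem_range.1 hl)).1, (hp l (Finset.mem_range.1 hl)).2]]
    have e := sum_range_getD (fun x : ℕ × ℤ => C (x.2 : ℝ) * letter p.n x.1) (0, 0) pairs
    rw [hpl] at e
    rw [e, hpairs, List.map_append, List.sum_append, List.map_map, List.map_replicate,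
      List.sum_replicate]
    simp only [Int.cast_zero, map_zero, zero_mul, smul_zero, add_zero]
    rw [hsup]
    have e2 := Finset.sum_map_toList (Finset.univ.filter fun i => w i ≠ 0)
      ((fun x : ℕ × ℤ => C (x.2 : ℝ) * letter p.n x.1) ∘
        fun i => (coordIndex (Sum.inr i : PairVar p.n), w i))
    rw [e2, formV, Finset.sum_filter]
    refine Finset.sum_congr rfl fun i _ => ?_
    simp only [Function.comp, letter_coordIndex]
    split_ifs with h0
    · rfl
    · rw [not_not.1 h0]; simp
  have hrow : ∀ r < p.L, p.row code r = (fun x : ℤ × ℕ × ℤ × ℤ =>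
      C (x.1 : ℝ) * formV (fun i => (w i : ℝ)) + C (x.2.2.1 : ℝ) * letter p.n x.2.1
        + C (x.2.2.2 : ℝ)) (rows.getD r (0, 0, 0, 1)) := by
    intro r hrL
    obtain ⟨h1, h2, h3, h4⟩ := hr r hrL
    rw [p.row_eq code r (by rw [h2]; exact (hrb' r).2.1), hform, h1, h2, h3, h4]
  rw [candidate, Finset.prod_congr rfl fun r hr => hrow r (Finset.mem_range.1 hr)]
  have e := prod_range_getD (fun x : ℤ × ℕ × ℤ × ℤ =>
      C (x.1 : ℝ) * formV (fun i => (w i : ℝ)) + C (x.2.2.1 : ℝ) * letter p.n x.2.1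
        + C (x.2.2.2 : ℝ)) (0, 0, 0, 1) rows
  rw [hrl] at e
  rw [e, hrows]
  simp only [List.map_append, List.prod_append, List.map_replicate, List.prod_replicate,
    List.map_map, List.map_cons, List.map_nil, List.prod_cons, List.prod_nil]
  simp only [Int.cast_one, Int.cast_zero, map_one, map_zero, one_mul, zero_mul, add_zero, zero_add,
    one_pow, mul_one, Int.cast_natCast]
  congr 3
  funext q
  simp only [Function.comp, stepFactor, Int.cast_zero, map_zero, zero_mul, zero_add,
    letter_coordIndex, Int.cast_ofNat]
  rw [add_comm]

end LogCost.Params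

end Codes

/-! ### Numerical bounds on the parameters. -/

section Sizes

open LogCost

theorem clog_le_three_mul_log {n : ℕ} (hn : 3 ≤ n) : (Nat.clog 2 n : ℝ) ≤ 3 * Real.log n := by
  have hn' : (3 : ℝ) ≤ n := by exact_mod_cast hn
  have h1 : Real.log 3 ≤ Real.log n := Real.log_le_log (by norm_num) hn'
  have h2 := Real.log_three_gt_d9
  have h3 := Real.log_two_gt_d9
  set ℓ := Nat.clog 2 n
  rcases Nat.eq_zero_or_pos ℓ with h0 | h0
  · rw [h0, Nat.cast_zero]; linarith
  have h4 : 2 ^ (ℓ - 1) < n := Nat.pow_pred_clog_lt_self (by norm_num) (by omega)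
  have h5 : ((ℓ - 1 : ℕ) : ℝ) * Real.log 2 ≤ Real.log n := by
    rw [← Real.log_pow]
    exact Real.log_le_log (by positivity) (by exact_mod_cast h4.le)
  rw [Nat.cast_sub h0, Nat.cast_one] at h5
  have h6 : (0 : ℝ) ≤ (ℓ : ℝ) - 1 := by
    have : (1 : ℝ) ≤ ℓ := by exact_mod_cast h0
    linarith
  nlinarith

theorem two_le_clog {n : ℕ} (hn : 3 ≤ n) : 2 ≤ Nat.clog 2 n := by
  have h := Nat.le_pow_clog (b := 2) (by norm_num) n
  by_contra! h1
  have : 2 ^ Nat.clog 2 n ≤ 2 ^ 1 := Nat.pow_le_pow_right (by norm_num) (by omega)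
  omega

/-- Up to an absolute constant, `E` is `√n (log n)² / ε²`. For `n ≥ 3` the constant is absorbed into
a further power of the logarithm, whence the exponent `302 = 2 + 300`. -/
theorem searchParams_E_le {n : ℕ} {ε : ℝ} (hn : 3 ≤ n) (hε : 0 < ε) (hε1 : ε ≤ 1) :
    ((searchParams n ⌈1 / ε⌉₊).E : ℝ) ≤ degreeBound 302 n ε := by
  have hn' : (3 : ℝ) ≤ n := by exact_mod_cast hn
  have hlog : (1.09 : ℝ) ≤ Real.log n :=
    (by linarith [Real.log_three_gt_d9] : (1.09 : ℝ) ≤ Real.log 3).trans (Real.log_le_log (by norm_num) hn')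
  have hℓ := clog_le_three_mul_log hn
  have hs : ((Nat.sqrt (n - 1) + 1 : ℕ) : ℝ) ≤ 2 * √(n : ℝ) := by
    have h1 : (Nat.sqrt (n - 1) : ℝ) ≤ √(n : ℝ) := by
      refine Real.le_sqrt_of_sq_le ?_
      have := Nat.sqrt_le' (n - 1)
      exact_mod_cast this.trans (Nat.sub_le _ _)
    have h2 : (1 : ℝ) ≤ √(n : ℝ) := Real.one_le_sqrt.2 (by linarith)
    push_cast
    linarith
  have hN : (⌈1 / ε⌉₊ : ℝ) ≤ 2 / ε := by
    have h1 := (Nat.ceil_lt_add_one (by positivity : 0 ≤ 1 / ε)).le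
    have h2 : 1 ≤ 1 / ε := by rw [le_div_iff₀ hε]; linarith
    calc _ ≤ 1 / ε + 1 := h1
      _ ≤ 1 / ε + 1 / ε := by linarith
      _ = 2 / ε := by ring
  set S : ℝ := ((Nat.sqrt (n - 1) + 1 : ℕ) : ℝ) with hS
  set Λ := Real.log n
  have hE : ((searchParams n ⌈1 / ε⌉₊).E : ℝ) =
      10 ^ 8 * (S * (Nat.clog 2 n : ℝ) ^ 2 * (⌈1 / ε⌉₊ : ℝ) ^ 2) := by
    simp only [searchParams, hS]
    push_cast
    ring
  -- The constant 72 collects `2 * 3² * 2²` from the bounds on `s`, the binary logarithm and `N`;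
  -- the exponent 300 suffices because `log 3 > 1.09`.
  have hΛ : (72 * 10 ^ 8 : ℝ) ≤ Λ ^ 300 := by
    have h1 : (5000 : ℝ) ≤ Λ ^ 100 := by
      calc (5000 : ℝ) ≤ 1.09 ^ 100 := by norm_num
        _ ≤ Λ ^ 100 := pow_le_pow_left₀ (by norm_num) hlog 100
    calc (72 * 10 ^ 8 : ℝ) ≤ 5000 ^ 3 := by norm_num
      _ ≤ (Λ ^ 100) ^ 3 := pow_le_pow_left₀ (by norm_num) h1 3
      _ = Λ ^ 300 := by rw [← pow_mul]
  rw [hE, degreeBound]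
  calc 10 ^ 8 * (S * (Nat.clog 2 n : ℝ) ^ 2 * (⌈1 / ε⌉₊ : ℝ) ^ 2)
      ≤ 10 ^ 8 * (2 * √(n : ℝ) * (3 * Λ) ^ 2 * (2 / ε) ^ 2) := by gcongr
    _ = (72 * 10 ^ 8) * (√(n : ℝ) * Λ ^ 2 / ε ^ 2) := by ring
    _ ≤ Λ ^ 300 * (√(n : ℝ) * Λ ^ 2 / ε ^ 2) :=
        mul_le_mul_of_nonneg_right hΛ (by positivity)
    _ = √(n : ℝ) * Λ ^ 302 / ε ^ 2 := by ring

/-- The inequalities between the parameters of the search. -/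
structure LogCost.Params.Valid (p : Params) (ℓ : ℕ) : Prop where
  three_le : 3 ≤ p.n
  N_pos : 1 ≤ p.N
  s_pos : 1 ≤ p.s
  s_le : p.s ≤ p.n
  n_le_sq : p.n ≤ p.s ^ 2
  n_le_pow : p.n ≤ 2 ^ ℓ
  two_le : 2 ≤ ℓ
  L_eq : p.L = 1000000 * p.s * ℓ * (p.N * p.N)
  E_eq : p.E = 100 * p.L * ℓ
  h_eq : p.h = 8000 * (p.n * p.n * p.n)

theorem searchParams_valid {n N : ℕ} (hn : 3 ≤ n) (hN : 1 ≤ N) :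
    (searchParams n N).Valid (Nat.clog 2 n) where
  three_le := hn
  N_pos := hN
  s_pos := Nat.le_add_left 1 _
  s_le := by
    change Nat.sqrt (n - 1) + 1 ≤ n
    have := Nat.sqrt_le_self (n - 1)
    omega
  n_le_sq := by
    change n ≤ (Nat.sqrt (n - 1) + 1) ^ 2
    have := Nat.lt_succ_sqrt' (n - 1)
    simp only [Nat.succ_eq_add_one] at this
    omega
  n_le_pow := Nat.le_pow_clog (by norm_num) n
  two_le := two_le_clog hn
  L_eq := rfl
  E_eq := rfl
  h_eq := rfl

namespace LogCost.Params.Valid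

variable {p : Params} {ℓ : ℕ}

theorem L_ge (v : p.Valid ℓ) : 1000000 * p.s * ℓ ≤ p.L ∧ 1000000 * (p.N * p.N) ≤ p.L ∧
    1000000 * p.s ≤ p.L ∧ 2000000 ≤ p.L := by
  have h1 := v.N_pos
  have h2 := v.s_pos
  have h3 := v.two_le
  have h4 : 1 ≤ p.N * p.N := Nat.mul_pos h1 h1
  rw [v.L_eq]
  refine ⟨Nat.le_mul_of_pos_right _ h4, Nat.mul_le_mul_right _ (by nlinarith), ?_, ?_⟩
  · rw [mul_assoc, mul_assoc]
    have : p.s * 1 ≤ p.s * (ℓ * (p.N * p.N)) := Nat.mul_le_mul_left _ (Nat.mul_pos (by omega) h4)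
    omega
  · have h5 : 2 ≤ p.s * ℓ * (p.N * p.N) := by
      calc 2 = 1 * 2 * 1 := rfl
        _ ≤ p.s * ℓ * (p.N * p.N) := Nat.mul_le_mul (Nat.mul_le_mul h2 h3) h4
    calc 2000000 = 1000000 * 2 := rfl
      _ ≤ 1000000 * (p.s * ℓ * (p.N * p.N)) := Nat.mul_le_mul_left _ h5
      _ = _ := by ring

theorem E_ge (v : p.Valid ℓ) : 200 * p.L ≤ p.E ∧ ℓ ≤ p.E := by
  have h1 := v.two_le
  have h2 := v.L_ge.2.2.2
  rw [v.E_eq]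
  constructor <;> nlinarith

theorem h_le (v : p.Valid ℓ) : p.h ≤ 2 ^ (10 * ℓ) ∧ 2 * p.h ≤ 2 ^ (10 * ℓ) := by
  have h1 := v.n_le_pow
  have h2 := v.two_le
  have h3 : 2 * p.h ≤ 2 ^ (10 * ℓ) := by
    rw [v.h_eq]
    calc 2 * (8000 * (p.n * p.n * p.n)) = 16000 * (p.n * p.n * p.n) := by ring
      _ ≤ 2 ^ 14 * (2 ^ ℓ * 2 ^ ℓ * 2 ^ ℓ) := by gcongr; norm_num
      _ = 2 ^ (14 + ℓ + ℓ + ℓ) := by rw [pow_add, pow_add, pow_add]; ring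
      _ ≤ 2 ^ (10 * ℓ) := Nat.pow_le_pow_right (by norm_num) (by omega)
  exact ⟨by omega, h3⟩

/-- As `E = 100 L ℓ`, any quantity `2 ^ (a ℓ)` raised to the power `b L` with `a b ≤ 100` fits below
`2 ^ E`. -/
theorem pow_le_E (v : p.Valid ℓ) {q a b : ℕ} (hq : q ≤ 2 ^ (a * ℓ)) (hab : a * b ≤ 100) :
    q ^ (b * p.L) ≤ 2 ^ p.E := by
  calc q ^ (b * p.L) ≤ (2 ^ (a * ℓ)) ^ (b * p.L) := Nat.pow_le_pow_left hq _
    _ = 2 ^ ((a * b) * (p.L * ℓ)) := by rw [← pow_mul]; ring_nf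
    _ ≤ 2 ^ p.E := Nat.pow_le_pow_right (by norm_num) (by
        rw [v.E_eq, mul_assoc 100]; exact Nat.mul_le_mul_right _ hab)

theorem words_le (v : p.Valid ℓ) : 2 * p.n * (2 * p.n + 1) ^ (2 * p.L) ≤ 2 ^ p.E := by
  have h1 := v.n_le_pow
  have h2 := v.two_le
  have h3 := v.three_le
  have h4 : 2 * p.n + 1 ≤ 2 ^ (2 * ℓ) := by
    calc 2 * p.n + 1 ≤ 4 * p.n := by omega
      _ ≤ 2 ^ 2 * 2 ^ ℓ := by gcongr; norm_num
      _ = 2 ^ (2 + ℓ) := by rw [pow_add]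
      _ ≤ _ := Nat.pow_le_pow_right (by norm_num) (by omega)
  have h5 : 1 ≤ p.L := by have := v.L_ge.2.2.2; omega
  calc 2 * p.n * (2 * p.n + 1) ^ (2 * p.L) ≤ (2 * p.n + 1) ^ 1 * (2 * p.n + 1) ^ (2 * p.L) := by
        rw [pow_one]; gcongr; omega
    _ = (2 * p.n + 1) ^ (1 + 2 * p.L) := by rw [pow_add]
    _ ≤ (2 * p.n + 1) ^ (3 * p.L) := Nat.pow_le_pow_right (by omega) (by omega)
    _ ≤ _ := v.pow_le_E h4 (by norm_num)

theorem coeff_le (v : p.Valid ℓ) : ((p.s + 2) * p.h ^ 2) ^ (2 * p.L) ≤ 2 ^ p.E := by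
  have h1 := v.n_le_pow
  have h2 := v.two_le
  have h3 := v.three_le
  have h4 := v.s_le
  refine v.pow_le_E (a := 22) ?_ (by norm_num)
  calc (p.s + 2) * p.h ^ 2 ≤ (2 ^ 1 * 2 ^ ℓ) * (2 ^ (10 * ℓ)) ^ 2 := by
        gcongr
        · omega
        · exact v.h_le.1
    _ = 2 ^ (1 + ℓ + 10 * ℓ * 2) := by rw [← pow_mul, ← pow_add, ← pow_add]
    _ ≤ _ := Nat.pow_le_pow_right (by norm_num) (by omega)

theorem small (v : p.Valid ℓ) :
    450 * (4608 * p.s ^ 2) * p.N ^ 2 * p.n ^ 2 * 8 ≤ 2 ^ p.E := by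
  have h1 := v.n_le_pow
  have h2 := v.s_le.trans h1
  have h3 : p.N ^ 2 ≤ 2 ^ (p.N * p.N) := by rw [sq]; exact Nat.lt_two_pow_self.le
  have h4 := v.L_ge
  have h5 := v.E_ge
  have h6 := v.two_le
  have h7 : ℓ ≤ p.L := by
    refine le_trans ?_ h4.1
    have := v.s_pos
    nlinarith
  calc 450 * (4608 * p.s ^ 2) * p.N ^ 2 * p.n ^ 2 * 8
      = 16588800 * p.s ^ 2 * p.N ^ 2 * p.n ^ 2 := by ring
    _ ≤ 2 ^ 24 * (2 ^ ℓ) ^ 2 * 2 ^ (p.N * p.N) * (2 ^ ℓ) ^ 2 := by gcongr; norm_num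
    _ = 2 ^ (24 + ℓ * 2 + p.N * p.N + ℓ * 2) := by rw [← pow_mul, pow_add, pow_add, pow_add]
    _ ≤ _ := Nat.pow_le_pow_right (by norm_num) (by omega)

/-- This guarantees that the candidate of the existence proof has enough mass to pass the first
condition of the test, even after the oracle error. -/
theorem mass_le (v : p.Valid ℓ) {t : ℕ} (ht : t + 1 ≤ p.L) :
    (2 : ℝ) / 2 ^ p.E ≤ (1 / (72 * p.s) : ℝ) ^ (t + 1) := by
  have h1 := v.n_le_pow
  have h2 := v.s_le.trans h1
  have h3 := v.two_le
  have h4 := v.L_ge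
  have h5 : 2 * (72 * p.s) ^ (t + 1) ≤ 2 ^ p.E := by
    have h6 : 72 * p.s ≤ 2 ^ (5 * ℓ) := by
      calc 72 * p.s ≤ 2 ^ 7 * 2 ^ ℓ := by gcongr; norm_num
        _ = 2 ^ (7 + ℓ) := by rw [pow_add]
        _ ≤ _ := Nat.pow_le_pow_right (by norm_num) (by omega)
    have h7 := v.s_pos
    calc 2 * (72 * p.s) ^ (t + 1) ≤ (72 * p.s) ^ 1 * (72 * p.s) ^ p.L := by
          rw [pow_one]
          exact Nat.mul_le_mul (by omega) (Nat.pow_le_pow_right (by omega) ht)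
      _ = (72 * p.s) ^ (1 + p.L) := by rw [pow_add]
      _ ≤ (72 * p.s) ^ (2 * p.L) := Nat.pow_le_pow_right (by omega) (by omega)
      _ ≤ _ := v.pow_le_E h6 (by norm_num)
  have h6 : (2 : ℝ) * (72 * p.s) ^ (t + 1) ≤ 2 ^ p.E := by exact_mod_cast h5
  have h7 : (0 : ℝ) < 72 * p.s := by
    have : (0 : ℝ) < p.s := by exact_mod_cast v.s_pos
    positivity
  rw [div_pow, one_pow, div_le_div_iff₀ (by positivity) (by positivity)]
  linarith

/-- The room for 5 more factors provides the summand 10 in the degree that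
`IsSpherePE.exists_candidate` asks for, as well as the factor that selects the sign. -/
theorem length_le (v : p.Valid ℓ) :
    p.s + 128 * p.s * (7 + ℓ) + 92160 * p.s * p.N ^ 2 * (5 + ℓ) + 5 ≤ p.L := by
  have h2 := v.two_le
  have h4 : 1 ≤ p.N ^ 2 := Nat.one_le_pow _ _ v.N_pos
  have h5 := v.s_pos
  have h6 : 1 ≤ p.s * ℓ * p.N ^ 2 := Nat.mul_pos (Nat.mul_pos h5 (by omega)) h4
  have e1 : p.s ≤ p.s * ℓ * p.N ^ 2 := by
    rw [mul_assoc]; exact Nat.le_mul_of_pos_right _ (Nat.mul_pos (by omega) h4)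
  have e2 : p.s * (7 + ℓ) ≤ 5 * (p.s * ℓ * p.N ^ 2) := by
    calc p.s * (7 + ℓ) ≤ p.s * (5 * ℓ) := Nat.mul_le_mul_left _ (by omega)
      _ = 5 * (p.s * ℓ) := by ring
      _ ≤ 5 * (p.s * ℓ * p.N ^ 2) := Nat.mul_le_mul_left _ (Nat.le_mul_of_pos_right _ h4)
  have e3 : p.s * p.N ^ 2 * (5 + ℓ) ≤ 4 * (p.s * ℓ * p.N ^ 2) := by
    calc p.s * p.N ^ 2 * (5 + ℓ) ≤ p.s * p.N ^ 2 * (4 * ℓ) := Nat.mul_le_mul_left _ (by omega)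
      _ = _ := by ring
  have eL : p.L = 1000000 * (p.s * ℓ * p.N ^ 2) := by rw [v.L_eq]; ring
  rw [eL]
  have e4 : 128 * p.s * (7 + ℓ) = 128 * (p.s * (7 + ℓ)) := by ring
  have e5 : 92160 * p.s * p.N ^ 2 * (5 + ℓ) = 92160 * (p.s * p.N ^ 2 * (5 + ℓ)) := by ring
  rw [e4, e5]
  omega

theorem h_ge (v : p.Valid ℓ) : p.s < p.h ∧ 3456 * p.s ^ 2 < p.h ∧ 7000 * p.s ^ 3 < p.h ∧
    2 * p.n < p.h ∧ 3 < p.h := by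
  have h1 := v.s_le
  have h2 := v.three_le
  have h3 : p.s ^ 2 ≤ p.n * p.n * p.n := by
    calc p.s ^ 2 ≤ p.n ^ 2 := Nat.pow_le_pow_left h1 2
      _ = p.n * p.n := sq _
      _ ≤ p.n * p.n * p.n := Nat.le_mul_of_pos_right _ (by omega)
  have h4 : p.s ^ 3 ≤ p.n * p.n * p.n := by
    calc p.s ^ 3 ≤ p.n ^ 3 := Nat.pow_le_pow_left h1 3
      _ = _ := by ring
  have h5 : p.n ≤ p.n * p.n * p.n := by
    rw [mul_assoc]; exact Nat.le_mul_of_pos_right _ (Nat.mul_pos (by omega) (by omega))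
  rw [v.h_eq]
  refine ⟨?_, ?_, ?_, ?_, ?_⟩ <;> omega

end LogCost.Params.Valid

end Sizes

/-! ### From functionals back to pseudo-distributions, and the theorem. -/

section Final

open MvPolynomial LogCost

/-- The pseudo-expectation as a linear functional. -/
noncomputable def pseudoExpLinear {σ : Type*} (μ : (σ → ℝ) →₀ ℝ) : MvPolynomial σ ℝ →ₗ[ℝ] ℝ where
  toFun := pseudoExp μ
  map_add' f g := by
    simp only [pseudoExp, Finsupp.sum, map_add, mul_add, Finset.sum_add_distrib]
  map_smul' c f := by
    simp only [pseudoExp, Finsupp.sum, smul_eval, RingHom.id_apply, smul_eq_mul, Finset.mul_sum]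
    exact Finset.sum_congr rfl fun x _ => by ring

theorem totalDegree_sum_sq_sub_one_le {n : ℕ} (v : Fin n → PairVar n) :
    (∑ i, X (v i) ^ 2 - 1 : MvPolynomial (PairVar n) ℝ).totalDegree ≤ 2 := by
  refine (totalDegree_sub _ _).trans (max_le ?_ (by simp))
  refine (totalDegree_finsetSum _ _).trans (Finset.sup_le fun i _ => ?_)
  exact (totalDegree_pow _ 2).trans (by simp)

theorem IsPseudoDistributionOnSpheres.isSpherePE {n d : ℕ} {μ : (PairVar n → ℝ) →₀ ℝ}
    (h : IsPseudoDistributionOnSpheres n d μ) : IsSpherePE d (pseudoExpLinear μ) := by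
  have aux : ∀ v : Fin n → PairVar n, SatisfiesEqZero d μ (∑ i, X (v i) ^ 2 - 1) →
      ∀ f, f.totalDegree + 2 ≤ d →
        pseudoExpLinear μ ((∑ i, X (v i) ^ 2) * f) = pseudoExpLinear μ f := by
    intro v hv f hf
    have h1 := hv f (by have := totalDegree_sum_sq_sub_one_le v; omega)
    have h2 : pseudoExpLinear μ ((∑ i, X (v i) ^ 2 - 1) * f) = 0 := h1
    rw [sub_mul, one_mul, map_sub] at h2
    exact sub_eq_zero.1 h2
  exact ⟨h.1.1, h.1.2, aux _ h.2.1, aux _ h.2.2⟩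

/-- The function `p · μ / Ẽ_μ p`. -/
noncomputable def reweighted {σ : Type*} (p : MvPolynomial σ ℝ) (μ : (σ → ℝ) →₀ ℝ) :
    (σ → ℝ) →₀ ℝ :=
  Finsupp.onFinset μ.support (fun x => eval x p * μ x / pseudoExp μ p) fun x hx => by
    rw [Finsupp.mem_support_iff]
    intro h0
    rw [h0] at hx
    simp at hx

theorem pseudoExp_reweighted {σ : Type*} (p f : MvPolynomial σ ℝ) (μ : (σ → ℝ) →₀ ℝ) :
    pseudoExp (reweighted p μ) f = pseudoExp μ (p * f) / pseudoExp μ p := by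
  rw [pseudoExp, reweighted, Finsupp.onFinset_sum _ (by simp)]
  conv_rhs => rw [pseudoExp, Finsupp.sum, Finset.sum_div]
  refine Finset.sum_congr rfl fun x _ => ?_
  rw [map_mul]
  ring

theorem pseudoExp_reweighted_sq {n : ℕ} (g f : MvPolynomial (PairVar n) ℝ)
    (μ : (PairVar n → ℝ) →₀ ℝ) :
    pseudoExp (reweighted (g ^ 2) μ) f = reweight (pseudoExpLinear μ) g f := by
  rw [pseudoExp_reweighted, reweight_apply]; rfl

theorem IsPseudoDistributionOnSpheres.reweighted {n d k : ℕ} {μ : (PairVar n → ℝ) →₀ ℝ}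
    (h : IsPseudoDistributionOnSpheres n d μ) {g : MvPolynomial (PairVar n) ℝ}
    (hg : 2 * g.totalDegree ≤ k) (hk : k ≤ d) (hpos : 0 < pseudoExp μ (g ^ 2)) :
    IsPseudoDistributionOnSpheres n (d - k) (reweighted (g ^ 2) μ) := by
  have hd := totalDegree_sq_le g
  have aux : ∀ q : MvPolynomial (PairVar n) ℝ, SatisfiesEqZero d μ q →
      SatisfiesEqZero (d - k) (_root_.reweighted (g ^ 2) μ) q := by
    intro q hq f hf
    rw [pseudoExp_reweighted, mul_left_comm, hq, zero_div]
    have := totalDegree_mul (g ^ 2) f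
    omega
  refine ⟨⟨?_, fun f hf => ?_⟩, aux _ h.2.1, aux _ h.2.2⟩
  · rw [pseudoExp_reweighted, mul_one, div_self hpos.ne']
  · rw [pseudoExp_reweighted, ← mul_pow]
    refine div_nonneg (h.1.2 _ ?_) hpos.le
    have := totalDegree_mul g f
    omega

theorem frobNorm_sub_le {n : ℕ} {μ' : (PairVar n → ℝ) →₀ ℝ}
    {F : MvPolynomial (PairVar n) ℝ →ₗ[ℝ] ℝ} (hF : ∀ f, pseudoExp μ' f = F f) {ε : ℝ} (hε : 0 ≤ ε)
    (h : crossCov F ≤ ε ^ 2 * (normSqU F * normSqV F)) :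
    frobNorm (Matrix.vecMulVec (meanU μ') (meanV μ') - momentUV μ') ≤
      ε * frobNorm (Matrix.vecMulVec (meanU μ') (meanV μ')) := by
  have e1 : ∑ i, ∑ j, (Matrix.vecMulVec (meanU μ') (meanV μ') - momentUV μ') i j ^ 2 =
      crossCov F := by
    rw [crossCov, Finset.sum_comm]
    refine Finset.sum_congr rfl fun i _ => Finset.sum_congr rfl fun j _ => ?_
    rw [covU, Matrix.sub_apply, Matrix.vecMulVec_apply, momentUV, Matrix.of_apply, meanU, meanV,
      hF, hF, hF, mul_comm (X (Sum.inl j))]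
    ring
  have e2 : ∑ i, ∑ j, Matrix.vecMulVec (meanU μ') (meanV μ') i j ^ 2 =
      normSqU F * normSqV F := by
    rw [normSqU, normSqV, Finset.sum_mul_sum]
    refine Finset.sum_congr rfl fun i _ => Finset.sum_congr rfl fun j _ => ?_
    rw [Matrix.vecMulVec_apply, meanU, meanV, hF, hF, mul_pow]
  rw [frobNorm, frobNorm, e1, e2]
  calc √(crossCov F) ≤ √(ε ^ 2 * (normSqU F * normSqV F)) := Real.sqrt_le_sqrt h
    _ = ε * √(normSqU F * normSqV F) := by rw [Real.sqrt_mul (sq_nonneg ε), Real.sqrt_sq hε]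

namespace LogCost.Params

variable {p : Params}

/-- The store lists the terms of the square of the candidate with the given code. -/
def Lists (p : Params) (code : ℕ) (s : Store) : Prop :=
  s 2 0 = (((2 * p.n + 1) ^ (2 * p.L) : ℕ) : ℤ) ∧ ∀ c < (2 * p.n + 1) ^ (2 * p.L),
    s 4 c = p.wordCoeff code c ∧ s 5 c = 1 ∧
      ∀ i < 2 * p.n, s 3 (2 * p.n * c + i) = p.wordExp c i

theorem Lists.output_eq {code : ℕ} {s : Store} (h : p.Lists code s) :
    output p.n s = ∑ c ∈ Finset.range ((2 * p.n + 1) ^ (2 * p.L)),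
      monomial (p.wordMonomial c) (p.wordCoeff code c : ℚ) := by
  rw [output, h.1, Int.toNat_natCast]
  refine Finset.sum_congr rfl fun c hc => ?_
  obtain ⟨h4, h5, h3⟩ := h.2 c (Finset.mem_range.1 hc)
  rw [h4, h5, Int.cast_one, div_one]
  congr 2
  rw [wordMonomial]
  congr 1
  funext v
  rcases v with i | i
  · have hi := i.2
    simp only [Sum.elim_inl, coordIndex]
    rw [h3 i (by omega), Int.toNat_natCast]
  · have hi := i.2
    simp only [Sum.elim_inr, coordIndex]
    rw [add_assoc, h3 (p.n + i) (by omega), Int.toNat_natCast]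

theorem Lists.map_output {code : ℕ} {s : Store} (h : p.Lists code s) :
    (output p.n s).map (algebraMap ℚ ℝ) = p.candidate code ^ 2 := by
  rw [h.output_eq, candidate_sq, map_sum]
  refine Finset.sum_congr rfl fun c _ => ?_
  rw [map_monomial]
  simp

/-- A coefficient of the output is the sum of the integers of all words with the given monomial, so
the bound on the total of their absolute values applies. -/
theorem Lists.coeff_output {code : ℕ} {s : Store} (h : p.Lists code s) (hh : 1 ≤ p.h)
    (α : PairVar p.n →₀ ℕ) :
    |((output p.n s).coeff α).num| ≤ (((p.s + 2) * p.h ^ 2) ^ (2 * p.L) : ℕ) ∧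
      ((output p.n s).coeff α).den = 1 := by
  classical
  have e : (output p.n s).coeff α = ((∑ c ∈ Finset.range ((2 * p.n + 1) ^ (2 * p.L)),
      if p.wordMonomial c = α then p.wordCoeff code c else 0 : ℤ) : ℚ) := by
    rw [h.output_eq, coeff_sum]
    push_cast
    refine Finset.sum_congr rfl fun c _ => ?_
    rw [coeff_monomial]
  rw [e, Rat.num_intCast, Rat.den_intCast]
  refine ⟨?_, rfl⟩
  refine (Finset.abs_sum_le_sum_abs _ _).trans (le_trans ?_ (p.sum_abs_wordCoeff_le hh code))
  refine Finset.sum_le_sum fun c _ => ?_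
  split_ifs
  · exact le_rfl
  · rw [abs_zero]; exact abs_nonneg _

theorem Valid.sound {ℓ d : ℕ} (v : p.Valid ℓ) {μ : (PairVar p.n → ℝ) →₀ ℝ} {O : Oracle} {k : ℝ}
    (hμ : IsPseudoDistributionOnSpheres p.n d μ) (hO : IsMomentOracle (k + 2) μ O)
    (hk : (2 * p.L : ℝ) ≤ k) (hd : k + 2 ≤ d) : p.Sound d (pseudoExpLinear μ) O where
  pe := hμ.isSpherePE
  degree_le := by
    have : ((2 * p.L + 2 : ℕ) : ℝ) ≤ d := by push_cast; linarith
    exact_mod_cast this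
  answer c a b ha hb := by
    rw [question_eq]
    refine hO _ ?_ _
    have h1 : (((p.wordMonomial c + letterExp p.n a + letterExp p.n b).degree : ℕ) : ℝ) ≤
        ((2 * p.L + 2 : ℕ) : ℝ) := by exact_mod_cast p.degree_question_le ha hb
    push_cast at h1
    linarith
  n_pos := by have := v.three_le; omega
  h_pos := by have := v.h_ge.2.2.2.2; omega
  N_pos := v.N_pos
  s_pos := v.s_pos
  coeff_le := v.coeff_le
  small := v.small

/-- Here the unit `T` of the running time is `E`. Pseudo-moments have absolute value at most 1, so
an answer of precision `3 E` has only about `3 E` bits. -/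
theorem Valid.fits {ℓ D : ℕ} (v : p.Valid ℓ) {F : MvPolynomial (PairVar p.n) ℝ →ₗ[ℝ] ℝ} {O : Oracle}
    (h : p.Sound D F O) : p.Fits O p.E := by
  have hL := v.L_ge
  have hE := v.E_ge
  have h1 : p.E < 2 ^ p.E := Nat.lt_two_pow_self
  have h2 : 3 * p.E + 3 ≤ 2 ^ p.E := by
    obtain ⟨m, hm⟩ : ∃ m, p.E = m + 3 := ⟨p.E - 3, by omega⟩
    have : m < 2 ^ m := Nat.lt_two_pow_self
    rw [hm, pow_add]
    omega
  have hw := v.words_le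
  have hn := v.three_le
  have hM : 1 ≤ (2 * p.n + 1) ^ (2 * p.L) := Nat.one_le_pow _ _ (by omega)
  refine ⟨by omega, by omega, le_trans (Nat.le_mul_of_pos_right _ hM) hw, by omega,
    le_trans (Nat.le_mul_of_pos_left _ (by omega)) hw,
    v.pow_le_E v.h_le.2 (by norm_num), fun c _ a ha b hb => ?_⟩
  have h3 := h.answer c a b ha hb
  have h4 := h.pe.abs_monomial_le (K := p.L + 1) (by have := h.degree_le; omega)
    (p.degree_question_le (c := c) ha hb)
  set z := O (p.question c a b) (3 * p.E)
  have ht : (0 : ℝ) < 2 ^ (3 * p.E) := by positivity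
  have h5 : |(z : ℝ)| ≤ 2 ^ (3 * p.E) + 1 := by
    have h6 := (abs_sub_abs_le_abs_sub _ _).trans h3
    rw [abs_div, abs_of_pos ht] at h6
    have h7 : |(z : ℝ)| / 2 ^ (3 * p.E) ≤ 1 + 1 / 2 ^ (3 * p.E) := by linarith
    rw [div_le_iff₀ ht, add_mul, one_mul, one_div_mul_cancel ht.ne'] at h7
    exact h7
  have h6 : z.natAbs ≤ 2 ^ (3 * p.E) + 1 := by
    have : ((z.natAbs : ℕ) : ℝ) ≤ ((2 ^ (3 * p.E) + 1 : ℕ) : ℝ) := by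
      rw [Nat.cast_natAbs]
      push_cast
      exact h5
    exact_mod_cast this
  have h7 : bits z ≤ 3 * p.E + 2 + 1 := bits_le_of_natAbs_lt (by
    rw [pow_add]
    have : 1 ≤ 2 ^ (3 * p.E) := Nat.one_le_two_pow
    omega)
  omega

theorem Valid.exists_accepts {ℓ D : ℕ} (v : p.Valid ℓ) {F : MvPolynomial (PairVar p.n) ℝ →ₗ[ℝ] ℝ}
    {O : Oracle} (h : p.Sound D F O) : ∃ c < (2 * p.h) ^ (6 * p.L), p.Accepts O c := by
  have hlen := v.length_le
  have hdeg := h.degree_le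
  obtain ⟨w, t, j, steps, hw, hcard, ht, hj, hst, hsteps, hmass, hnear⟩ :=
    h.pe.exists_candidate (N₀ := 3456 * p.s ^ 2) v.s_pos v.s_le v.n_le_sq v.n_le_pow v.N_pos rfl
      (by omega)
  obtain ⟨hh1, hh2, hh3, hh4, hh5⟩ := v.h_ge
  obtain ⟨code, hc, e⟩ := p.exists_candidate_eq w t j steps (3456 * p.s ^ 2) hw hcard hsteps
    (by omega) (by have := v.L_ge.2.2.1; omega) hh1 hh2
    (lt_of_le_of_lt hj (by exact_mod_cast hh3)) hh4 hh5
  rw [← e] at hmass hnear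
  exact ⟨code, hc, h.accepts ((v.mass_le (by omega)).trans hmass) hnear⟩

end LogCost.Params

end Final

theorem theorem4p1 :
    ∃ (C : ℕ) (B : ℝ) (P : LogCost.Prog), 1 ≤ C ∧
      ∀ (n : ℕ) (ε : ℝ) (d : ℕ) (μ : (PairVar n → ℝ) →₀ ℝ) (O : LogCost.Oracle),
        3 ≤ n → 0 < ε → ε ≤ 1 →
        degreeBound C n ε + 2 ≤ d →
        IsPseudoDistributionOnSpheres n d μ →
        IsMomentOracle (degreeBound C n ε + 2) μ O →
        ∃ (s : LogCost.Store) (t : ℕ) (p : MvPolynomial (PairVar n) ℚ)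
          (μ' : (PairVar n → ℝ) →₀ ℝ),
          LogCost.Exec O P (LogCost.input n ⌈1 / ε⌉₊) s t ∧
          (t : ℝ) ≤ 2 ^ (B * degreeBound C n ε) ∧
          p = LogCost.output n s ∧
          (∀ α, |((p.coeff α).num : ℝ)| ≤ 2 ^ (B * degreeBound C n ε) ∧
            ((p.coeff α).den : ℝ) ≤ 2 ^ (B * degreeBound C n ε)) ∧
          IsReweighting ⌊degreeBound C n ε⌋₊ (p.map (algebraMap ℚ ℝ)) μ μ' ∧
          IsPseudoDistributionOnSpheres n (d - ⌊degreeBound C n ε⌋₊) μ' ∧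
          frobNorm (Matrix.vecMulVec (meanU μ') (meanV μ') - momentUV μ') ≤
            ε * frobNorm (Matrix.vecMulVec (meanU μ') (meanV μ')) := by
  -- The running time is at most `2 ^ ((searchRank + 1) E)` and `E ≤ k`, so `searchRank + 1` serves
  -- as `B`.
  refine ⟨302, (LogCost.searchRank + 1 : ℕ), LogCost.searchProg, by norm_num, ?_⟩
  intro n ε d μ O hn hε hε1 hd hμ hO
  set k := degreeBound 302 n ε with hk
  set N := ⌈1 / ε⌉₊ with hN
  have hNε : 1 / ε ≤ N := Nat.le_ceil _
  have hN1 : 1 ≤ N := Nat.one_le_iff_ne_zero.2 (Nat.ceil_pos.2 (by positivity)).ne'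
  have hEk : ((LogCost.searchParams n N).E : ℝ) ≤ k := searchParams_E_le hn hε hε1
  have v := searchParams_valid hn hN1
  have hLE := v.E_ge.1
  have hL := v.L_ge
  have h2L : (2 * (LogCost.searchParams n N).L : ℝ) ≤ k := by
    have : ((2 * (LogCost.searchParams n N).L : ℕ) : ℝ) ≤ (LogCost.searchParams n N).E := by
      exact_mod_cast (by omega : 2 * (LogCost.searchParams n N).L ≤ (LogCost.searchParams n N).E)
    push_cast at this
    linarith
  have sound : (LogCost.searchParams n N).Sound d (pseudoExpLinear μ) O := v.sound hμ hO h2L hd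
  have fits := v.fits sound
  obtain ⟨s, t, hexec, htime, hlist⟩ := LogCost.searchProg_spec O (by omega) (by omega)
    (by
      have h1 : N ≤ N * N := Nat.le_mul_of_pos_left _ hN1
      have h2 : (LogCost.searchParams n N).E < 2 ^ (LogCost.searchParams n N).E :=
        Nat.lt_two_pow_self
      have h3 : 1000000 * (N * N) ≤ (LogCost.searchParams n N).L := hL.2.1
      omega) fits v.words_le
  obtain ⟨-, hacc⟩ := (LogCost.searchParams n N).found_spec O (v.exists_accepts sound)
  set code := (LogCost.searchParams n N).found O
  have lists : (LogCost.searchParams n N).Lists code s := hlist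
  obtain ⟨hpos, hcov⟩ := sound.of_accepts hacc
  have hmap : (LogCost.output n s).map (algebraMap ℚ ℝ) =
      (LogCost.searchParams n N).candidate code ^ 2 := lists.map_output
  have hdeg := (LogCost.searchParams n N).totalDegree_candidate_le code
  set G : MvPolynomial (PairVar n) ℝ := (LogCost.searchParams n N).candidate code
  have hpos' : 0 < pseudoExp μ (G ^ 2) := hpos
  have hkf : 2 * G.totalDegree ≤ ⌊k⌋₊ := by
    refine le_trans (Nat.mul_le_mul_left 2 hdeg) (Nat.le_floor ?_)
    push_cast
    exact h2L
  have hk0 : 0 ≤ k := le_trans (by positivity) hEk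
  have hkd : ⌊k⌋₊ ≤ d := by
    have h1 := Nat.floor_le hk0
    have : ((⌊k⌋₊ : ℕ) : ℝ) ≤ d := by linarith
    exact_mod_cast this
  have hpow : (2 : ℝ) ^ (LogCost.searchParams n N).E ≤
      2 ^ (((LogCost.searchRank + 1 : ℕ) : ℝ) * k) := by
    rw [← Real.rpow_natCast]
    refine Real.rpow_le_rpow_of_exponent_le (by norm_num) (hEk.trans ?_)
    exact le_mul_of_one_le_left hk0 (by exact_mod_cast Nat.le_add_left 1 _)
  refine ⟨s, t, _, reweighted (G ^ 2) μ, hexec, ?_, rfl, fun α => ⟨?_, ?_⟩, ?_, ?_, ?_⟩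
  · calc (t : ℝ) ≤ ((2 ^ ((LogCost.searchRank + 1) * (LogCost.searchParams n N).E) : ℕ) : ℝ) := by
          exact_mod_cast htime
      _ = (2 : ℝ) ^ (((LogCost.searchRank + 1 : ℕ) : ℝ) * (LogCost.searchParams n N).E) := by
          rw [← Nat.cast_mul, Real.rpow_natCast]; push_cast; rfl
      _ ≤ _ := Real.rpow_le_rpow_of_exponent_le (by norm_num)
          (mul_le_mul_of_nonneg_left hEk (by positivity))
  · have h1 := (lists.coeff_output sound.h_pos α).1
    have h2 := h1.trans (by exact_mod_cast v.coeff_le :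
      _ ≤ ((2 ^ (LogCost.searchParams n N).E : ℕ) : ℤ))
    refine le_trans ?_ hpow
    have h3 : ((|((LogCost.output n s).coeff α).num| : ℤ) : ℝ) ≤
        (((2 ^ (LogCost.searchParams n N).E : ℕ) : ℤ) : ℝ) := Int.cast_le.2 h2
    push_cast at h3
    exact h3
  · have h1 : ((LogCost.output n s).coeff α).den = 1 := (lists.coeff_output sound.h_pos α).2
    rw [h1, Nat.cast_one]
    exact le_trans (one_le_pow₀ (by norm_num)) hpow
  · rw [hmap]
    exact ⟨⟨1, fun _ => G, fun _ => hkf, (Fin.sum_univ_one fun _ => G ^ 2).symm⟩, hpos', fun x => rfl⟩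
  · exact hμ.reweighted hkf hkd hpos'
  · refine frobNorm_sub_le (pseudoExp_reweighted_sq G · μ) hε.le ?_
    have hN0 : (0 : ℝ) < N := by exact_mod_cast hN1
    have hcov' : (N : ℝ) ^ 2 * crossCov (reweight (pseudoExpLinear μ) G) ≤
        normSqU (reweight (pseudoExpLinear μ) G) * normSqV (reweight (pseudoExpLinear μ) G) := hcov
    -- Rounding `1 / ε` up to `N` only strengthens the inequality that the test certifies.
    have h1 : 1 ≤ ε * N := by
      rw [div_le_iff₀ hε] at hNε
      linarith
    have h2 : 0 ≤ crossCov (reweight (pseudoExpLinear μ) G) :=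
      Finset.sum_nonneg fun i _ => Finset.sum_nonneg fun j _ => sq_nonneg _
    calc crossCov (reweight (pseudoExpLinear μ) G)
        ≤ (ε * N) ^ 2 * crossCov (reweight (pseudoExpLinear μ) G) :=
          le_mul_of_one_le_left h2 (one_le_pow₀ h1)
      _ = ε ^ 2 * ((N : ℝ) ^ 2 * crossCov (reweight (pseudoExpLinear μ) G)) := by ring
      _ ≤ _ := mul_le_mul_of_nonneg_left hcov' (sq_nonneg ε)
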